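/- **Setting.** All Banach spaces are real. Let $\mathcal D$ be the collection of dyadic intervals $[i2^{-j},(i+1)2^{-j})$, $j\ge 0$, $0\le i<2^j$, in $[0,1)$, enumerated by $\iota([i2^{-j},(i+1)2^{-j}))=2^j+i\in\mathbb N=\{1,2,\dots\}$; put $\mathcal D^+=\mathcal D\cup\{\varnothing\}$, $\iota(\varnothing)=0$. For $I\in\mathcal D$ with left half $I^+$ and right half $I^-$ let $h_I=\chi_{I^+}-\chi_{I^-}$, and let $h_\varnothing=\chi_{[0,1)}$. Put $H=\operatorname{span}\{h_I: I\in\mathcal D^+\}$, and let $r_n=\sum_{|I|=2^{-n}}h_I$, $n\ge0$, be the Rademacher functions. Let $\|\cdot\|_X$ be a norm on $H$ such that $\|x\|_X=\|y\|_X$ whenever $x,y\in H$ and $|x|,|y|$ have the same distribution, and such that $\|\chi_{[0,1)}\|_X=1$. Let $(r_I)_{I\in\mathcal D^+}$ be either the independent sequence $(r_{\iota(I)})_{I\in\mathcal D^+}$ or the constant sequence $(r_0)_{I\in\mathcal D^+}$. Let $X(\mathbf r)$ be the completion of $H$ under the norm $$\Bigl\|\sum_{I\in\mathcal D^+}a_Ih_I\Bigr\|_{X(\mathbf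 r)}=\Bigl\|s\mapsto\int_0^1\Bigl|\sum_{I\in\mathcal D^+}r_I(u)a_Ih_I(s)\Bigr|\,du\Bigr\|_X .$$ A *Haar system Hardy space* is a space $Y=X_0(\mathbf r)$, the closed linear span of $(h_I)_{I\in\mathcal D}$ in $X(\mathbf r)$. **Definition.** Let $E$ be a Banach space with Schauder basis $(e_j)_{j=1}^\infty$ and biorthogonal functionals $(e_j^*)_{j=1}^\infty$, and let $C>0$. The system $((e_j,e_j^*))_{j=1}^\infty$ is *$C$-strategically supporting in $E\times E^*$ with projectional factors* if for every $\eta>0$ and every partition $\mathbb N=N_1\cup N_2$ there is $i\in\{1,2\}$ such that player (A) has a winning strategy in the following infinite game. In turn $k=1,2,\dots$, player (A), knowing the previous turns, chooses a finite set $E_k\subset N_i$ and real numbers $(\lambda^k_j)_{j\in E_k}$, $(\mu^k_j)_{j\in E_k}$; then player (B) chooses signs $(\varepsilon^k_j)_{j\in E_k}\in\{\pm1\}^{E_k}$. With $$x_k=\sum_{j\in E_k}\varepsilon^k_j\lambda^k_je_j,\qquad x_k^*=\sum_{j\in E_k}\varepsilon^k_j\mu^k_je_j^*,$$ player (A) wins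 if 1. whenever $\sum_k a_ke_k$ converges in norm, for scalars $a_k$, so does $\sum_k a_kx_k$, and $\|\sum_k a_kx_k\|\le\sqrt{C+\eta}\,\|\sum_k a_ke_k\|$; 2. whenever $\sum_k a_ke_k^*$ converges weak*, for scalars $a_k$, so does $\sum_k a_kx_k^*$, and the weak* sums satisfy $\|\sum_k a_kx_k^*\|\le\sqrt{C+\eta}\,\|\sum_k a_ke_k^*\|$; moreover, $\sum_k\langle x_k^*,x\rangle e_k$ converges in norm for every $x\in E$; 3. $1\le\langle x_k^*,x_k\rangle=\sum_{j\in E_k}\lambda^k_j\mu^k_j\le1+\eta$ for all $k$; 4. $\lambda^k_j\mu^k_j\ge0$ for all $k$ and all $j\in E_k$; 5. $\langle x_k^*,x_l\rangle=\delta_{kl}$ for all $k,l$. **Theorem.** Let $Y$ be a Haar system Hardy space. Then $(h_I/\|h_I\|_Y)_{I\in\mathcal D}$, in the order given by $\iota$, is a Schauder basis of $Y$, and, with $(h_I^*)_{I\in\mathcal D}$ denoting its biorthogonal functionals, the system $((h_I/\|h_I\|_Y,h_I^*))_{I\in\mathcal D}$ is $2$-strategically supporting in $Y\times Y^*$ with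 projectional factors. -/

import Mathlib

open MeasureTheory ProbabilityTheory

noncomputable section

namespace HaarHardy

/-! ### Dyadic intervals, the Haar system and the Rademacher functions -/

/-- The dyadic interval `[i / 2 ^ j, (i + 1) / 2 ^ j)`; it lies in `[0, 1)` iff `i < 2 ^ j`. -/
def dyadicInterval (j i : ℕ) : Set ℝ := Set.Ico ((i : ℝ) / 2 ^ j) (((i : ℝ) + 1) / 2 ^ j)

/-- The Haar function of `I = [i / 2 ^ j, (i + 1) / 2 ^ j)`: the characteristic function of the
left half of `I` minus that of the right half of `I`. -/
def haarFn (j i : ℕ) : ℝ → ℝ :=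
  (dyadicInterval (j + 1) (2 * i)).indicator 1 - (dyadicInterval (j + 1) (2 * i + 1)).indicator 1

/-- The Haar system `(h_I)`, where `I` runs through the dyadic intervals in `[0, 1)` and `∅`,
enumerated in the usual linear order: `haar 0 = h_∅` is the characteristic function of `[0, 1)`,
and `haar (2 ^ j + i)`, for `0 ≤ i < 2 ^ j`, is the Haar function of
`[i / 2 ^ j, (i + 1) / 2 ^ j)`.  Functions on `[0, 1)` are extended to `ℝ` by zero. -/
def haar : ℕ → ℝ → ℝ
  | 0 => (Set.Ico (0 : ℝ) 1).indicator 1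
  | n + 1 => haarFn (Nat.log 2 (n + 1)) (n + 1 - 2 ^ Nat.log 2 (n + 1))

/-- The `n`-th standard Rademacher function: the sum of the Haar functions of all dyadic intervals
of length `2 ^ (-n)` in `[0, 1)`. -/
def rademacher (n : ℕ) : ℝ → ℝ := ∑ i ∈ Finset.range (2 ^ n), haarFn n i

/-- The space `H`, the linear span of the Haar system. -/
def haarSpan : Submodule ℝ (ℝ → ℝ) := Submodule.span ℝ (Set.range haar)

theorem haar_mem (n : ℕ) : haar n ∈ haarSpan := Submodule.subset_span ⟨n, rfl⟩

/-! ### Elements of `H` as dyadic step functions -/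

theorem mem_dyadicInterval {j i : ℕ} {s : ℝ} :
    s ∈ dyadicInterval j i ↔ 0 ≤ s ∧ ⌊2 ^ j * s⌋₊ = i := by
  have h2 : (0 : ℝ) < 2 ^ j := by positivity
  unfold dyadicInterval
  rw [Set.mem_Ico, div_le_iff₀ h2, lt_div_iff₀ h2]
  constructor
  · rintro ⟨h, h'⟩
    have hs : 0 ≤ s := by
      by_contra hs
      have h0 : (0 : ℝ) ≤ i := Nat.cast_nonneg i
      nlinarith
    refine ⟨hs, (Nat.floor_eq_iff (by positivity)).2 ⟨by linarith, by linarith⟩⟩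
  · rintro ⟨hs, h⟩
    have := (Nat.floor_eq_iff (by positivity)).1 h
    exact ⟨by linarith [this.1], by linarith [this.2]⟩

/-- `f` vanishes outside `[0, 1)` and is constant on each dyadic interval of length `2 ^ (-n)`. -/
def IsStep (n : ℕ) (f : ℝ → ℝ) : Prop :=
  (∀ s, s ∉ Set.Ico (0 : ℝ) 1 → f s = 0) ∧
    ∀ s ∈ Set.Ico (0 : ℝ) 1, ∀ t ∈ Set.Ico (0 : ℝ) 1, ⌊2 ^ n * s⌋₊ = ⌊2 ^ n * t⌋₊ → f s = f t

theorem floor_of_le {n m : ℕ} (h : n ≤ m) (s : ℝ) :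
    ⌊2 ^ n * s⌋₊ = ⌊2 ^ m * s⌋₊ / 2 ^ (m - n) := by
  have := Nat.floor_div_natCast ((2 : ℝ) ^ m * s) (2 ^ (m - n))
  rw [← this]
  congr 1
  have h2 : (2 : ℝ) ^ m = 2 ^ n * 2 ^ (m - n) := by rw [← pow_add]; congr 1; omega
  rw [h2]
  push_cast
  field_simp

theorem IsStep.mono {n m : ℕ} (h : n ≤ m) {f : ℝ → ℝ} (hf : IsStep n f) : IsStep m f :=
  ⟨hf.1, fun s hs t ht hst => hf.2 s hs t ht (by rw [floor_of_le h, floor_of_le h, hst])⟩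

theorem floor_lt {n : ℕ} {s : ℝ} (hs : s ∈ Set.Ico (0 : ℝ) 1) : ⌊2 ^ n * s⌋₊ < 2 ^ n := by
  rw [Nat.floor_lt (mul_nonneg (by positivity) hs.1)]
  push_cast
  have : (0 : ℝ) < 2 ^ n := by positivity
  nlinarith [hs.2]

theorem isStep_dyadic {n i : ℕ} (hi : i < 2 ^ n) :
    IsStep n ((dyadicInterval n i).indicator 1) := by
  constructor
  · intro s hs
    rw [Set.indicator_of_notMem]
    intro h
    obtain ⟨h0, h1⟩ := mem_dyadicInterval.1 h
    apply hs
    refine ⟨h0, ?_⟩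
    have h2 : (0 : ℝ) < 2 ^ n := by positivity
    have h3 : (2 : ℝ) ^ n * s < i + 1 := by rw [← h1]; exact Nat.lt_floor_add_one _
    have h4 : (i : ℝ) + 1 ≤ 2 ^ n := by exact_mod_cast hi
    by_contra h5
    nlinarith
  · intro s hs t ht hst
    have : s ∈ dyadicInterval n i ↔ t ∈ dyadicInterval n i := by
      rw [mem_dyadicInterval, mem_dyadicInterval, hst]
      simp [hs.1, ht.1]
    by_cases h : s ∈ dyadicInterval n i
    · rw [Set.indicator_of_mem h, Set.indicator_of_mem (this.1 h)]; rfl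
    · rw [Set.indicator_of_notMem h, Set.indicator_of_notMem (fun h' => h (this.2 h'))]

theorem IsStep.add {n : ℕ} {f g : ℝ → ℝ} (hf : IsStep n f) (hg : IsStep n g) :
    IsStep n (f + g) :=
  ⟨fun s hs => by simp [hf.1 s hs, hg.1 s hs],
    fun s hs t ht h => by simp [hf.2 s hs t ht h, hg.2 s hs t ht h]⟩

theorem IsStep.smul {n : ℕ} {f : ℝ → ℝ} (c : ℝ) (hf : IsStep n f) : IsStep n (c • f) :=
  ⟨fun s hs => by simp [hf.1 s hs], fun s hs t ht h => by simp [hf.2 s hs t ht h]⟩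

theorem isStep_haarFn {j i : ℕ} (hi : i < 2 ^ j) : IsStep (j + 1) (haarFn j i) := by
  have h : 2 ^ (j + 1) = 2 * 2 ^ j := by ring
  have := (isStep_dyadic (n := j + 1) (i := 2 * i) (by omega)).add
    ((isStep_dyadic (n := j + 1) (i := 2 * i + 1) (by omega)).smul (-1))
  convert this using 1
  unfold haarFn
  rw [neg_one_smul, sub_eq_add_neg]

theorem log_index (n : ℕ) :
    n + 1 - 2 ^ Nat.log 2 (n + 1) < 2 ^ Nat.log 2 (n + 1) := by
  have h1 := Nat.lt_pow_succ_log_self (b := 2) (by norm_num) (n + 1)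
  rw [pow_succ] at h1
  omega

theorem isStep_haar_succ (n : ℕ) : IsStep (Nat.log 2 (n + 1) + 1) (haar (n + 1)) :=
  isStep_haarFn (log_index n)

theorem isStep_haar_zero : IsStep 0 (haar 0) := by
  have := isStep_dyadic (n := 0) (i := 0) (by norm_num)
  simpa [dyadicInterval, haar] using this

theorem isStep_of_mem {f : ℝ → ℝ} (hf : f ∈ haarSpan) : ∃ n, IsStep n f := by
  induction hf using Submodule.span_induction with
  | mem x hx =>
    obtain ⟨n, rfl⟩ := hx
    cases n with
    | zero => exact ⟨0, isStep_haar_zero⟩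
    | succ n => exact ⟨_, isStep_haar_succ n⟩
  | zero => exact ⟨0, fun s _ => rfl, fun _ _ _ _ _ => rfl⟩
  | add x y _ _ hx hy =>
    obtain ⟨n, hn⟩ := hx
    obtain ⟨m, hm⟩ := hy
    exact ⟨max n m, (hn.mono (le_max_left _ _)).add (hm.mono (le_max_right _ _))⟩
  | smul a x _ hx =>
    obtain ⟨n, hn⟩ := hx
    exact ⟨n, hn.smul a⟩

theorem haarFn_mem {j i : ℕ} (hi : i < 2 ^ j) : haarFn j i ∈ haarSpan := by
  have hp : 0 < 2 ^ j := by positivity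
  have h1 : (2 ^ j + i - 1) + 1 = 2 ^ j + i := by omega
  have h2 : Nat.log 2 (2 ^ j + i) = j := by
    rw [Nat.log_eq_iff (Or.inr ⟨by norm_num, by omega⟩), pow_succ]
    omega
  have : haar ((2 ^ j + i - 1) + 1) = haarFn j i := by
    rw [haar, h1, h2]
    congr 1
    omega
  rw [← this]
  exact haar_mem _

theorem rademacher_mem (n : ℕ) : rademacher n ∈ haarSpan :=
  Submodule.sum_mem _ fun _ hi => haarFn_mem (Finset.mem_range.1 hi)

theorem dyadic_split (j i : ℕ) :
    (dyadicInterval j i).indicator (1 : ℝ → ℝ) =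
      (dyadicInterval (j + 1) (2 * i)).indicator 1 +
        (dyadicInterval (j + 1) (2 * i + 1)).indicator 1 := by
  classical
  funext s
  have h := floor_of_le (Nat.le_succ j) s
  rw [Nat.succ_eq_add_one, Nat.add_sub_cancel_left, pow_one] at h
  simp only [Pi.add_apply, Set.indicator_apply, mem_dyadicInterval, h, Pi.one_apply]
  by_cases hs : 0 ≤ s
  · simp only [hs, true_and]
    split_ifs <;> first | omega | norm_num
  · simp [hs]

theorem dyadic_mem (j : ℕ) : ∀ i < 2 ^ j, (dyadicInterval j i).indicator 1 ∈ haarSpan := by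
  induction j with
  | zero =>
    intro i hi
    have : i = 0 := by simpa using hi
    subst this
    have := haar_mem 0
    simpa [dyadicInterval, haar] using this
  | succ j ih =>
    intro i hi
    have hk : i / 2 < 2 ^ j := by rw [pow_succ] at hi; omega
    have h1 := ih _ hk
    have h2 := haarFn_mem hk
    have h3 := dyadic_split j (i / 2)
    rcases Nat.even_or_odd' i with ⟨c, hc | hc⟩
    · have hc' : i / 2 = c := by omega
      rw [hc'] at h1 h2 h3
      have : (dyadicInterval (j + 1) i).indicator (1 : ℝ → ℝ) =
          (2⁻¹ : ℝ) • ((dyadicInterval j c).indicator 1 + haarFn j c) := by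
        rw [h3, haarFn, hc]
        funext s
        simp only [Pi.smul_apply, Pi.add_apply, Pi.sub_apply, smul_eq_mul]
        ring
      rw [this]
      exact Submodule.smul_mem _ _ (Submodule.add_mem _ h1 h2)
    · have hc' : i / 2 = c := by omega
      rw [hc'] at h1 h2 h3
      have : (dyadicInterval (j + 1) i).indicator (1 : ℝ → ℝ) =
          (2⁻¹ : ℝ) • ((dyadicInterval j c).indicator 1 - haarFn j c) := by
        rw [h3, haarFn, hc]
        funext s
        simp only [Pi.smul_apply, Pi.add_apply, Pi.sub_apply, smul_eq_mul]
        ring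
      rw [this]
      exact Submodule.smul_mem _ _ (Submodule.sub_mem _ h1 h2)

theorem left_end_mem {n i : ℕ} (hi : i < 2 ^ n) : (i : ℝ) / 2 ^ n ∈ Set.Ico (0 : ℝ) 1 := by
  refine ⟨by positivity, ?_⟩
  rw [div_lt_one (by positivity)]
  exact_mod_cast hi

theorem floor_left_end (n i : ℕ) : ⌊(2 : ℝ) ^ n * ((i : ℝ) / 2 ^ n)⌋₊ = i := by
  rw [mul_div_cancel₀ _ (by positivity), Nat.floor_natCast]

theorem IsStep.mem {n : ℕ} {f : ℝ → ℝ} (hf : IsStep n f) : f ∈ haarSpan := by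
  have : f = ∑ i ∈ Finset.range (2 ^ n),
      f ((i : ℝ) / 2 ^ n) • (dyadicInterval n i).indicator (1 : ℝ → ℝ) := by
    funext s
    rw [Finset.sum_apply]
    by_cases hs : s ∈ Set.Ico (0 : ℝ) 1
    · rw [Finset.sum_eq_single ⌊2 ^ n * s⌋₊]
      · rw [Pi.smul_apply, Set.indicator_of_mem (mem_dyadicInterval.2 ⟨hs.1, rfl⟩)]
        simp only [Pi.one_apply, smul_eq_mul, mul_one]
        exact hf.2 _ hs _ (left_end_mem (floor_lt hs)) (floor_left_end _ _).symm
      · intro i _ hi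
        rw [Pi.smul_apply, Set.indicator_of_notMem, smul_zero]
        exact fun h => hi (mem_dyadicInterval.1 h).2.symm
      · intro h
        exact absurd (Finset.mem_range.2 (floor_lt hs)) h
    · rw [hf.1 s hs, Finset.sum_eq_zero]
      intro i hi
      rw [Pi.smul_apply, (isStep_dyadic (Finset.mem_range.1 hi)).1 s hs, smul_zero]
  rw [this]
  exact Submodule.sum_mem _ fun i hi =>
    Submodule.smul_mem _ _ (dyadic_mem n i (Finset.mem_range.1 hi))

theorem integrable_of_mem {f : ℝ → ℝ} (hf : f ∈ haarSpan) : Integrable f := by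
  have hI : ∀ a b : ℝ, Integrable ((Set.Ico a b).indicator (1 : ℝ → ℝ)) := fun a b =>
    (integrable_indicator_iff measurableSet_Ico).2
      ((integrableOn_const_iff (C := (1 : ℝ))).2 (Or.inr (by simp)))
  induction hf using Submodule.span_induction with
  | mem x hx =>
    obtain ⟨n, rfl⟩ := hx
    cases n with
    | zero => exact hI 0 1
    | succ n => exact (hI _ _).sub (hI _ _)
  | zero => exact integrable_zero _ _ _
  | add x y _ _ hx hy => exact hx.add hy
  | smul a x _ hx => exact hx.smul a

/-! ### The Haar system is a basis of `H` -/

theorem haar_lt_eq {m n : ℕ} (hm : m < n + 1) :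
    haar m (((n + 1 - 2 ^ Nat.log 2 (n + 1) : ℕ) : ℝ) / 2 ^ Nat.log 2 (n + 1)) =
      haar m (((2 * (n + 1 - 2 ^ Nat.log 2 (n + 1)) + 1 : ℕ) : ℝ) /
        2 ^ (Nat.log 2 (n + 1) + 1)) := by
  set j := Nat.log 2 (n + 1) with hj
  have hi := log_index n
  rw [← hj] at hi
  set i := n + 1 - 2 ^ j with hidef
  have hle : 2 ^ j ≤ n + 1 := Nat.pow_log_le_self 2 (by omega)
  have hp := left_end_mem hi
  have hq : ((2 * i + 1 : ℕ) : ℝ) / 2 ^ (j + 1) ∈ Set.Ico (0 : ℝ) 1 :=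
    left_end_mem (by rw [pow_succ]; omega)
  have fp := floor_left_end j i
  have fq : ⌊(2 : ℝ) ^ j * (((2 * i + 1 : ℕ) : ℝ) / 2 ^ (j + 1))⌋₊ = i := by
    rw [floor_of_le (Nat.le_succ j), Nat.succ_eq_add_one, floor_left_end, Nat.add_sub_cancel_left,
      pow_one]
    omega
  cases m with
  | zero => exact (isStep_haar_zero.mono (Nat.zero_le j)).2 _ hp _ hq (by rw [fp, fq])
  | succ m =>
    have hjj : Nat.log 2 (m + 1) ≤ j := Nat.log_mono_right (by omega)
    rcases Nat.lt_or_eq_of_le hjj with h | h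
    · exact ((isStep_haar_succ m).mono h).2 _ hp _ hq (by rw [fp, fq])
    · have hne : m + 1 - 2 ^ j ≠ i := by
        have : 2 ^ j ≤ m + 1 := h ▸ Nat.pow_log_le_self 2 (by omega)
        omega
      have key : ∀ s : ℝ, ⌊(2 : ℝ) ^ j * s⌋₊ = i → haar (m + 1) s = 0 := by
        intro s hs
        rw [floor_of_le (Nat.le_succ j), Nat.succ_eq_add_one, Nat.add_sub_cancel_left,
          pow_one] at hs
        rw [haar, haarFn, h, Pi.sub_apply, Set.indicator_of_notMem, Set.indicator_of_notMem,
          sub_zero]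
        · intro hmem
          have := (mem_dyadicInterval.1 hmem).2
          omega
        · intro hmem
          have := (mem_dyadicInterval.1 hmem).2
          omega
      rw [key _ fp, key _ fq]

theorem haar_self_left (n : ℕ) :
    haar (n + 1) (((n + 1 - 2 ^ Nat.log 2 (n + 1) : ℕ) : ℝ) / 2 ^ Nat.log 2 (n + 1)) = 1 := by
  set j := Nat.log 2 (n + 1) with hj
  set i := n + 1 - 2 ^ j with hidef
  have e : ((i : ℕ) : ℝ) / 2 ^ j = ((2 * i : ℕ) : ℝ) / 2 ^ (j + 1) := by
    push_cast; rw [pow_succ]; field_simp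
  rw [haar, ← hj, ← hidef, e, haarFn, Pi.sub_apply, Set.indicator_of_mem,
    Set.indicator_of_notMem]
  · simp
  · intro h
    have := (mem_dyadicInterval.1 h).2
    rw [floor_left_end] at this
    omega
  · exact mem_dyadicInterval.2 ⟨by positivity, floor_left_end _ _⟩

theorem haar_self_right (n : ℕ) :
    haar (n + 1) (((2 * (n + 1 - 2 ^ Nat.log 2 (n + 1)) + 1 : ℕ) : ℝ) /
        2 ^ (Nat.log 2 (n + 1) + 1)) = -1 := by
  set j := Nat.log 2 (n + 1) with hj
  set i := n + 1 - 2 ^ j with hidef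
  rw [haar, ← hj, ← hidef, haarFn, Pi.sub_apply, Set.indicator_of_notMem,
    Set.indicator_of_mem]
  · simp
  · exact mem_dyadicInterval.2 ⟨by positivity, floor_left_end _ _⟩
  · intro h
    have := (mem_dyadicInterval.1 h).2
    rw [floor_left_end] at this
    omega

theorem haar_linearIndependent : LinearIndependent ℝ haar := by
  rw [linearIndependent_iff]
  intro l hl
  by_contra hne
  have hs : l.support.Nonempty := Finsupp.support_nonempty_iff.2 hne
  have hmax := l.support.max'_mem hs
  have hlt : ∀ m ∈ l.support, m ≠ l.support.max' hs → m < l.support.max' hs :=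
    fun m hm h => lt_of_le_of_ne (l.support.le_max' m hm) h
  have hz : ∀ s, ∑ m ∈ l.support, l m * haar m s = 0 := by
    intro s
    have := congrFun hl s
    rw [Finsupp.linearCombination_apply, Finsupp.sum, Finset.sum_apply] at this
    simpa using this
  revert hmax hlt
  generalize l.support.max' hs = n
  intro hmax hlt
  apply Finsupp.mem_support_iff.1 hmax
  cases n with
  | zero =>
    have := hz 0
    rw [Finset.sum_eq_single 0 (fun m hm h => absurd (hlt m hm h) (by omega))
      (fun h => absurd hmax h)] at this
    simpa [haar] using this
  | succ n =>
    have h1 := hz (((n + 1 - 2 ^ Nat.log 2 (n + 1) : ℕ) : ℝ) / 2 ^ Nat.log 2 (n + 1))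
    have h2 := hz (((2 * (n + 1 - 2 ^ Nat.log 2 (n + 1)) + 1 : ℕ) : ℝ) /
        2 ^ (Nat.log 2 (n + 1) + 1))
    have h3 := sub_eq_zero.2 (h1.trans h2.symm)
    rw [← Finset.sum_sub_distrib, Finset.sum_eq_single (n + 1)
      (fun m hm h => by rw [haar_lt_eq (hlt m hm h), sub_self]) (fun h => absurd hmax h),
      haar_self_left, haar_self_right] at h3
    linarith

/-- The Haar system as an algebraic basis of `H`. -/
def haarBasis : Module.Basis ℕ ℝ haarSpan := Module.Basis.span haar_linearIndependent

/-! ### Haar system spaces -/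

/-- A norm on `H` whose completion is a Haar system space: it is invariant under passing to
functions whose absolute values have the same distribution on `[0, 1)`, and the constant function
`1` on `[0, 1)` has norm `1`. -/
structure HaarSystemNorm extends Seminorm ℝ haarSpan where
  eq_zero_of_map_eq_zero : ∀ x : haarSpan, toFun x = 0 → x = 0
  map_eq_of_identDistrib : ∀ x y : haarSpan,
    IdentDistrib (fun s => |x.1 s|) (fun s => |y.1 s|)
      (volume.restrict (Set.Ico (0 : ℝ) 1)) (volume.restrict (Set.Ico (0 : ℝ) 1)) →
    toFun x = toFun y
  map_one : toFun ⟨haar 0, haar_mem 0⟩ = 1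

theorem HaarSystemNorm.map_eq_of_abs_eq (N : HaarSystemNorm) {x y : haarSpan}
    (h : ∀ s, |x.1 s| = |y.1 s|) : N.toSeminorm x = N.toSeminorm y := by
  refine N.map_eq_of_identDistrib x y ?_
  have : (fun s => |x.1 s|) = fun s => |y.1 s| := funext h
  rw [this]
  exact IdentDistrib.refl (integrable_of_mem y.2).abs.aestronglyMeasurable.aemeasurable.restrict

/-- `f` multiplied by the dyadic step function with values `θ`. -/
theorem isStep_mul {n : ℕ} {f : ℝ → ℝ} (hf : IsStep n f) (θ : ℕ → ℝ) :
    IsStep n (fun s => θ ⌊2 ^ n * s⌋₊ * f s) :=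
  ⟨fun s hs => by simp [hf.1 s hs], fun s hs t ht h => by simp only [h, hf.2 s hs t ht h]⟩

theorem HaarSystemNorm.mul_le (N : HaarSystemNorm) {n : ℕ} {f : ℝ → ℝ} (hf : IsStep n f)
    (k : ℕ) : ∀ θ : ℕ → ℝ, (∀ i, |θ i| ≤ 1) → (∀ i, k ≤ i → |θ i| = 1) →
      N.toSeminorm ⟨_, (isStep_mul hf θ).mem⟩ ≤ N.toSeminorm ⟨f, hf.mem⟩ := by
  induction k with
  | zero =>
    intro θ _ h
    refine (N.map_eq_of_abs_eq fun s => ?_).le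
    simp only [abs_mul, h _ (Nat.zero_le _), one_mul]
  | succ k ih =>
    intro θ h1 h2
    have hk := abs_le.1 (h1 k)
    have h := fun (c : ℝ) (hc : |c| = 1) => ih (Function.update θ k c)
      (fun i => by
        by_cases hi : i = k
        · subst hi; simp [hc]
        · simp [hi, h1 i])
      (fun i hi => by
        by_cases hik : i = k
        · subst hik; simp [hc]
        · simp only [ne_eq, hik, not_false_eq_true, Function.update_of_ne]
          exact h2 i (by omega))
    have hp := h 1 (by simp)
    have hm := h (-1) (by simp)
    have e : (⟨_, (isStep_mul hf θ).mem⟩ : haarSpan) =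
        ((1 + θ k) / 2) • (⟨_, (isStep_mul hf (Function.update θ k 1)).mem⟩ : haarSpan) +
        ((1 - θ k) / 2) • (⟨_, (isStep_mul hf (Function.update θ k (-1))).mem⟩ : haarSpan) := by
      apply Subtype.ext
      funext s
      simp only [Submodule.coe_add, Submodule.coe_smul, Pi.add_apply, Pi.smul_apply, smul_eq_mul]
      by_cases hs : ⌊2 ^ n * s⌋₊ = k
      · simp only [hs, Function.update_self]; ring
      · simp only [ne_eq, hs, not_false_eq_true, Function.update_of_ne]; ring
    rw [e]
    refine (map_add_le_add N.toSeminorm _ _).trans ?_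
    rw [map_smul_eq_mul, map_smul_eq_mul, Real.norm_of_nonneg (by linarith),
      Real.norm_of_nonneg (by linarith)]
    nlinarith

/-- Norms of Haar system spaces are monotone. -/
theorem HaarSystemNorm.mono (N : HaarSystemNorm) {x y : haarSpan}
    (h : ∀ s, |x.1 s| ≤ |y.1 s|) : N.toSeminorm x ≤ N.toSeminorm y := by
  obtain ⟨n, hx⟩ := isStep_of_mem x.2
  obtain ⟨m, hy⟩ := isStep_of_mem y.2
  replace hx := hx.mono (le_max_left n m)
  replace hy := hy.mono (le_max_right n m)
  generalize max n m = M at hx hy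
  let θ : ℕ → ℝ := fun i =>
    if i < 2 ^ M then x.1 ((i : ℝ) / 2 ^ M) / y.1 ((i : ℝ) / 2 ^ M) else 1
  have key := N.mul_le hy (2 ^ M) θ
    (fun i => by
      simp only [θ]
      split_ifs
      · rw [abs_div]; exact div_le_one_of_le₀ (h _) (abs_nonneg _)
      · simp)
    (fun i hi => by simp [θ, not_lt.2 hi])
  refine le_trans (N.map_eq_of_abs_eq fun s => ?_).le key
  congr 1
  by_cases hs : s ∈ Set.Ico (0 : ℝ) 1
  · have hl := floor_lt (n := M) hs
    have ex := hx.2 _ (left_end_mem hl) _ hs (floor_left_end _ _)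
    have ey := hy.2 _ (left_end_mem hl) _ hs (floor_left_end _ _)
    simp only [θ, hl, if_true, ex, ey]
    by_cases h0 : y.1 s = 0
    · have := h s
      rw [h0, abs_zero] at this
      simp [h0, abs_nonpos_iff.1 this]
    · field_simp
  · simp [hx.1 s hs, hy.1 s hs]

/-! ### Haar system Hardy spaces -/

/-- The two admissible choices of the sequence of Rademacher functions. -/
inductive RademacherChoice
  | independent
  | constant

/-- The sequence `(r_I)`, with the same enumeration as the Haar system: either the independent
sequence of all Rademacher functions, or the constant sequence with all terms equal to the
zeroth Rademacher function. -/
def RademacherChoice.seq : RademacherChoice → ℕ → ℝ → ℝ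
  | .independent => fun n => rademacher n
  | .constant => fun _ => rademacher 0

theorem RademacherChoice.seq_mem (r : RademacherChoice) (n : ℕ) : r.seq n ∈ haarSpan := by
  cases r
  · exact rademacher_mem n
  · exact rademacher_mem 0

/-- For `x = ∑ a_I h_I`, the function `(u, s) ↦ ∑ r_I(u) a_I h_I(s)`. -/
def randomSum (r : RademacherChoice) (x : haarSpan) (u s : ℝ) : ℝ :=
  (haarBasis.repr x).sum fun n a => r.seq n u * a * haar n s

/-- For `x = ∑ a_I h_I`, the function `s ↦ ∫₀¹ |∑ r_I(u) a_I h_I(s)| du`. -/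
def randomAverage (r : RademacherChoice) (x : haarSpan) (s : ℝ) : ℝ :=
  ∫ u in (0 : ℝ)..1, |randomSum r x u s|

theorem randomAverage_mem (r : RademacherChoice) (x : haarSpan) :
    randomAverage r x ∈ haarSpan := by
  have : ∃ M, ∀ n ∈ (haarBasis.repr x).support, IsStep M (haar n) := by
    choose f hf using fun n => isStep_of_mem (haar_mem n)
    exact ⟨(haarBasis.repr x).support.sup f, fun n hn => (hf n).mono (Finset.le_sup hn)⟩
  obtain ⟨M, hM⟩ := this
  refine IsStep.mem (n := M) ⟨fun s hs => ?_, fun s hs t ht hst => ?_⟩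
  · have : ∀ u, randomSum r x u s = 0 := fun u =>
      Finset.sum_eq_zero fun n hn => by simp only [(hM n hn).1 s hs, mul_zero]
    simp [randomAverage, this]
  · have : ∀ u, randomSum r x u s = randomSum r x u t := fun u =>
      Finset.sum_congr rfl fun n hn => by simp only [(hM n hn).2 s hs t ht hst]
    simp [randomAverage, this]

theorem randomSum_add (r : RademacherChoice) (x y : haarSpan) (u s : ℝ) :
    randomSum r (x + y) u s = randomSum r x u s + randomSum r y u s := by
  unfold randomSum
  rw [map_add, Finsupp.sum_add_index']
  · intro n; simp
  · intro n a b; ring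

theorem randomSum_smul (r : RademacherChoice) (c : ℝ) (x : haarSpan) (u s : ℝ) :
    randomSum r (c • x) u s = c * randomSum r x u s := by
  unfold randomSum
  rw [map_smul, Finsupp.sum_smul_index (by intro n; simp), Finsupp.mul_sum]
  exact Finset.sum_congr rfl fun n _ => by ring

theorem intervalIntegrable_randomSum (r : RademacherChoice) (x : haarSpan) (s : ℝ) :
    IntervalIntegrable (fun u => |randomSum r x u s|) volume 0 1 := by
  have : (fun u => randomSum r x u s) ∈ haarSpan := by
    have e : (fun u => randomSum r x u s) =
        ∑ n ∈ (haarBasis.repr x).support, (haarBasis.repr x n * haar n s) • r.seq n := by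
      funext u
      rw [Finset.sum_apply]
      exact Finset.sum_congr rfl fun n _ => by simp only [Pi.smul_apply, smul_eq_mul]; ring
    rw [e]
    exact Submodule.sum_mem _ fun n _ => Submodule.smul_mem _ _ (r.seq_mem n)
  exact (integrable_of_mem this).abs.intervalIntegrable

theorem randomAverage_nonneg (r : RademacherChoice) (x : haarSpan) (s : ℝ) :
    0 ≤ randomAverage r x s :=
  intervalIntegral.integral_nonneg zero_le_one fun _ _ => abs_nonneg _

/-- The Haar system Hardy norm
`‖∑ a_I h_I‖ = ‖s ↦ ∫₀¹ |∑ r_I(u) a_I h_I(s)| du‖_X` on `H`. -/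
def hardyNorm (N : HaarSystemNorm) (r : RademacherChoice) : Seminorm ℝ haarSpan :=
  Seminorm.of (fun x => N.toSeminorm ⟨randomAverage r x, randomAverage_mem r x⟩)
    (fun x y => by
      refine le_trans (N.mono fun s => ?_) (map_add_le_add N.toSeminorm
        ⟨randomAverage r x, randomAverage_mem r x⟩ ⟨randomAverage r y, randomAverage_mem r y⟩)
      have hle : randomAverage r (x + y) s ≤ randomAverage r x s + randomAverage r y s := by
        unfold randomAverage
        rw [← intervalIntegral.integral_add (intervalIntegrable_randomSum r x s)
          (intervalIntegrable_randomSum r y s)]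
        refine intervalIntegral.integral_mono zero_le_one (intervalIntegrable_randomSum r _ s)
          ((intervalIntegrable_randomSum r x s).add (intervalIntegrable_randomSum r y s))
          fun u => ?_
        simp only [randomSum_add]
        exact abs_add_le _ _
      simp only [Submodule.coe_add, Pi.add_apply]
      rw [abs_of_nonneg (randomAverage_nonneg r _ s)]
      exact hle.trans (le_abs_self _))
    (fun c x => by
      have e : (⟨randomAverage r (c • x), randomAverage_mem r (c • x)⟩ : haarSpan) =
          |c| • ⟨randomAverage r x, randomAverage_mem r x⟩ := by
        apply Subtype.ext
        funext s
        simp only [Submodule.coe_smul, Pi.smul_apply, smul_eq_mul, randomAverage, randomSum_smul,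
          abs_mul, intervalIntegral.integral_const_mul]
      rw [e, map_smul_eq_mul, Real.norm_eq_abs, abs_abs, Real.norm_eq_abs])

/-- A copy of `H`, equipped with the norm `hardyNorm N r`. -/
def PreHardy (_N : HaarSystemNorm) (_r : RademacherChoice) : Type := haarSpan

instance (N : HaarSystemNorm) (r : RademacherChoice) : SeminormedAddCommGroup (PreHardy N r) :=
  AddGroupSeminorm.toSeminormedAddCommGroup (E := haarSpan) (hardyNorm N r).toAddGroupSeminorm

instance (N : HaarSystemNorm) (r : RademacherChoice) : NormedSpace ℝ (PreHardy N r) :=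
  letI : Module ℝ (PreHardy N r) := inferInstanceAs (Module ℝ haarSpan)
  { this with
    norm_smul_le := fun c x => (map_smul_eq_mul (hardyNorm N r) c x).le }

/-- The Haar system Hardy space `X(r)`: the completion of `H` under the Hardy norm. -/
abbrev HardySpace (N : HaarSystemNorm) (r : RademacherChoice) : Type :=
  UniformSpace.Completion (PreHardy N r)

/-- The Haar functions as elements of `X(r)`. -/
def haarVec (N : HaarSystemNorm) (r : RademacherChoice) (n : ℕ) : HardySpace N r :=
  let h : PreHardy N r := (⟨haar n, haar_mem n⟩ : haarSpan)
  (h : HardySpace N r)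

/-- The Haar system Hardy space `X₀(r)`: the closed linear span in `X(r)` of the Haar functions of
the dyadic intervals in `[0, 1)`, that is, of the whole Haar system except `h_∅`. -/
abbrev HardySpace₀ (N : HaarSystemNorm) (r : RademacherChoice) : Submodule ℝ (HardySpace N r) :=
  (Submodule.span ℝ (Set.range fun k : ℕ => haarVec N r (k + 1))).topologicalClosure

/-- The Haar functions of the dyadic intervals in `[0, 1)`, in the usual linear order starting
with `[0, 1)` at `k = 0`, as elements of `X₀(r)`. -/
def haarVec₀ (N : HaarSystemNorm) (r : RademacherChoice) (k : ℕ) : HardySpace₀ N r :=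
  ⟨haarVec N r (k + 1), Submodule.le_topologicalClosure _ (Submodule.subset_span ⟨k, rfl⟩)⟩

/-! ### Domination -/

section Domination

variable {E F : Type*} [NormedAddCommGroup E] [NormedSpace ℝ E] [NormedAddCommGroup F]
  [NormedSpace ℝ F]

/-- `(x_k)` is `C`-norm-dominated by `(y_k)`.  Series are limits of their partial sums. -/
def NormDominated (C : ℝ) (x : ℕ → E) (y : ℕ → F) : Prop :=
  ∀ (a : ℕ → ℝ) (t : F), HasSum (fun k => a k • y k) t (SummationFilter.conditional ℕ) →
    ∃ s : E, HasSum (fun k => a k • x k) s (SummationFilter.conditional ℕ) ∧ ‖s‖ ≤ C * ‖t‖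

/-- `t` is the weak* limit of the partial sums of the series `∑ y_k` in the dual of `E`. -/
def HasWeakStarSum (y : ℕ → StrongDual ℝ E) (t : StrongDual ℝ E) : Prop :=
  HasSum (fun k => StrongDual.toWeakDual (y k)) (StrongDual.toWeakDual t)
    (SummationFilter.conditional ℕ)

/-- `(x_k)` is `C`-weak*-dominated by `(y_k)`. -/
def WeakStarDominated (C : ℝ) (x : ℕ → StrongDual ℝ E) (y : ℕ → StrongDual ℝ F) : Prop :=
  ∀ (a : ℕ → ℝ) (t : StrongDual ℝ F), HasWeakStarSum (fun k => a k • y k) t →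
    ∃ s : StrongDual ℝ E, HasWeakStarSum (fun k => a k • x k) s ∧ ‖s‖ ≤ C * ‖t‖

end Domination

/-! ### The infinite game and strategically supporting systems -/

/-- A move of the first player: a finite set `E_k ⊆ ℕ` and scalars `λ_j, μ_j`, for `j ∈ E_k`. -/
structure Move where
  supp : Finset ℕ
  lam : supp → ℝ
  mu : supp → ℝ

/-- A turn of the game: a move, answered by the second player with signs `ε_j`, for `j ∈ E_k`. -/
structure Turn where
  move : Move
  sign : move.supp → ℤˣ

/-- A strategy of the first player assigns a move to every finite list of previous turns. -/
abbrev Strategy := List Turn → Move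

/-- The infinite play `p` is one in which the first player follows the strategy `σ`. -/
def Strategy.Follows (σ : Strategy) (p : ℕ → Turn) : Prop :=
  ∀ k, (p k).move = σ ((List.range k).map p)

section Supporting

variable {E : Type*} [NormedAddCommGroup E] [NormedSpace ℝ E]

/-- `x_k = ∑_{j ∈ E_k} ε_j λ_j e_j`. -/
def Turn.vec (b : SchauderBasis ℝ E) (t : Turn) : E :=
  ∑ j : t.move.supp, (((t.sign j : ℤ) : ℝ) * t.move.lam j) • b j

/-- `x_k* = ∑_{j ∈ E_k} ε_j μ_j e_j*`. -/
def Turn.func (b : SchauderBasis ℝ E) (t : Turn) : StrongDual ℝ E :=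
  ∑ j : t.move.supp, (((t.sign j : ℤ) : ℝ) * t.move.mu j) • b.coord j

/-- The outcome that the first player has to achieve, where all his sets `E_k` have to be subsets
of `M`. -/
structure SupportingPlay (C η : ℝ) (b : SchauderBasis ℝ E) (M : Set ℕ) (p : ℕ → Turn) :
    Prop where
  supp_subset : ∀ k, ((p k).move.supp : Set ℕ) ⊆ M
  norm_dominated : NormDominated (√(C + η)) (fun k => (p k).vec b) b
  weakStar_dominated : WeakStarDominated (√(C + η)) (fun k => (p k).func b) b.coord
  converges : ∀ x : E, ∃ s : E,
    HasSum (fun k => (p k).func b x • b k) s (SummationFilter.conditional ℕ)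
  pairing_eq : ∀ k, (p k).func b ((p k).vec b) = ∑ j, (p k).move.lam j * (p k).move.mu j
  one_le_pairing : ∀ k, 1 ≤ (p k).func b ((p k).vec b)
  pairing_le : ∀ k, (p k).func b ((p k).vec b) ≤ 1 + η
  lam_mul_mu_nonneg : ∀ k j, 0 ≤ (p k).move.lam j * (p k).move.mu j

/-- The system consisting of a Schauder basis and its biorthogonal functionals is
`C`-strategically supporting with projectional factors: for all `η > 0` and all partitions
`ℕ = N₁ ∪ N₂`, for one of the two sets the first player has a strategy that guarantees a
supporting play within this set in which, moreover, `(x_k*)` is biorthogonal to `(x_k)`. -/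
def StrategicallySupportingProj (C : ℝ) (b : SchauderBasis ℝ E) : Prop :=
  ∀ η : ℝ, 0 < η → ∀ N₁ N₂ : Set ℕ, N₁ ∪ N₂ = Set.univ → Disjoint N₁ N₂ →
    ∃ M : Set ℕ, (M = N₁ ∨ M = N₂) ∧ ∃ σ : Strategy, ∀ p : ℕ → Turn, σ.Follows p →
      SupportingPlay C η b M p ∧
        ∀ k l, (p k).func b ((p l).vec b) = if k = l then 1 else 0

end Supporting

end HaarHardy

end

open HaarHardy

/-!
# Strategic support in Haar system Hardy spaces

Dyadic intervals are indexed as in a binary heap: `[0, 1)` has index `1` and the halves of the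
interval with index `q` have indices `2q` and `2q + 1`.  A `BlockSystem` consists of signed blocks
`b_q` of Haar functions, whose supports are nested in the same way as the dyadic intervals.  The
kernel `κ(s, t) = ∑_{q < n} b_q(s) h_q(t) / |I_q|` has two decisive properties.

* It is nonnegative (`BlockSystem.kernel_nonneg`): along the branch of dyadic intervals of `t`, the
  partial sums are `0` or a power of `2`, as for the Haar system itself.
* It is doubly stochastic (`BlockSystem.kernel_mem`).

By Birkhoff's theorem, a doubly stochastic kernel is an average of rearrangements, so it does not
increase a rearrangement invariant norm (`HaarSystemNorm.le_of_doublyStochastic`).  Together with an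
exchange of Rademacher functions at each point `s`, this gives two contractions for the Hardy norm:
`h_q ↦ b_q` (`BlockSystem.hardyNorm_sum_vec_le`), and its transpose, which maps `x` to the element
of `H` with Haar coefficients `⟨x, b_q⟩ / |I_q|` (`BlockSystem.hardyNorm_sum_coeff_le`).  For the
initial segments of the Haar system, the first of these says that the Haar basis is monotone.

The transpose maps `b_q` to `θ_q h_q`, where `θ_q` is the measure of the support of `b_q`, relative
to `|I_q|`.  So the functionals `x_k*` have to be divided by `θ_q`, and if `θ_q` is decreasing,
summation by parts bounds the resulting operator by `2 / inf θ_q - 1 / θ_1`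
(`norm_sum_smul_le_of_monotone`).  This is at most `2 + η` if `θ_q` decreases from almost `1 / 2` to
a limit close to `1 / 2`.  Splitting the factor symmetrically between `x_k` and `x_k*` gives the
constant `√(2 + η)` for both.

It remains to build such blocks from one of the sets of the partition during the game.  For
one of the sets, the points that lie in arbitrarily short intervals with indices in the set
form a set `G` of measure at least `1 / 2` (`exists_half_le_volume_limitSet`); this is where the
factor `2` comes from.  The first player chooses disjoint short intervals with indices in the set,
inside the part of `[0, 1)` where the parent block has the required sign, with the exact total
length `θ_q |I_q|` and almost contained in `G`.  Whatever signs are chosen by the second player,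
both level sets of the new block then meet `G` in a set that is large enough to continue
(`exists_isGoodMove`).
-/

open MeasureTheory ProbabilityTheory

noncomputable section

namespace HaarHardy

/-! ### Values of the Haar and Rademacher functions at dyadic points -/

theorem floor_point {M n : ℕ} (h : n ≤ M) (i : ℕ) :
    ⌊(2 : ℝ) ^ n * ((i : ℝ) / 2 ^ M)⌋₊ = i / 2 ^ (M - n) := by
  rw [floor_of_le h, floor_left_end]

theorem haarFn_apply (j i : ℕ) {s : ℝ} (hs : 0 ≤ s) :
    haarFn j i s =
      if ⌊2 ^ j * s⌋₊ = i then (if ⌊2 ^ (j + 1) * s⌋₊ % 2 = 0 then 1 else -1) else 0 := by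
  classical
  have h := floor_of_le (Nat.le_succ j) s
  rw [Nat.succ_eq_add_one, Nat.add_sub_cancel_left, pow_one] at h
  rw [h, haarFn]
  simp only [Pi.sub_apply, Set.indicator_apply, mem_dyadicInterval, hs, true_and, Pi.one_apply]
  split_ifs <;> first | omega | norm_num

theorem haar_eq_haarFn {q : ℕ} (hq : q ≠ 0) :
    haar q = haarFn (Nat.log 2 q) (q - 2 ^ Nat.log 2 q) := by
  obtain ⟨n, rfl⟩ := Nat.exists_eq_succ_of_ne_zero hq
  rfl

/-- The dyadic interval with heap index `q`: the root `[0, 1)` has index `1`, and the halves of the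
interval with index `q` have indices `2 * q` and `2 * q + 1`.  The index `0` has the junk value
`[0, 1)`. -/
def node (q : ℕ) : Set ℝ := dyadicInterval (Nat.log 2 q) (q - 2 ^ Nat.log 2 q)

theorem mem_node {q : ℕ} (hq : q ≠ 0) {s : ℝ} :
    s ∈ node q ↔ 0 ≤ s ∧ 2 ^ Nat.log 2 q + ⌊2 ^ Nat.log 2 q * s⌋₊ = q := by
  have := Nat.pow_log_le_self 2 hq
  rw [node, mem_dyadicInterval]
  constructor <;> rintro ⟨h, h'⟩ <;> exact ⟨h, by omega⟩

theorem log_two_mul {q : ℕ} (hq : q ≠ 0) : Nat.log 2 (2 * q) = Nat.log 2 q + 1 := by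
  rw [mul_comm, Nat.log_mul_base (by norm_num) hq]

theorem log_two_mul_add_one {q : ℕ} (hq : q ≠ 0) : Nat.log 2 (2 * q + 1) = Nat.log 2 q + 1 := by
  have h1 := Nat.pow_log_le_self 2 hq
  have h2 := Nat.lt_pow_succ_log_self (b := 2) (by norm_num) q
  rw [Nat.log_eq_iff (Or.inr ⟨by norm_num, by omega⟩)]
  rw [pow_succ] at *
  rw [pow_succ]
  omega

theorem floor_succ (j : ℕ) (s : ℝ) :
    ⌊(2 : ℝ) ^ (j + 1) * s⌋₊ / 2 = ⌊(2 : ℝ) ^ j * s⌋₊ := by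
  have h := floor_of_le (Nat.le_succ j) s
  rw [Nat.succ_eq_add_one, Nat.add_sub_cancel_left, pow_one] at h
  exact h.symm

theorem haar_apply {q : ℕ} (hq : q ≠ 0) (s : ℝ) :
    haar q s = (node (2 * q)).indicator 1 s - (node (2 * q + 1)).indicator 1 s := by
  have h1 := Nat.pow_log_le_self 2 hq
  rw [haar_eq_haarFn hq, haarFn, node, node, log_two_mul hq, log_two_mul_add_one hq]
  have e1 : 2 * q - 2 ^ (Nat.log 2 q + 1) = 2 * (q - 2 ^ Nat.log 2 q) := by
    rw [pow_succ]; omega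
  have e2 : 2 * q + 1 - 2 ^ (Nat.log 2 q + 1) = 2 * (q - 2 ^ Nat.log 2 q) + 1 := by
    rw [pow_succ]; omega
  rw [e1, e2]
  rfl

theorem node_two_mul_union {q : ℕ} (hq : q ≠ 0) : node (2 * q) ∪ node (2 * q + 1) = node q := by
  ext s
  have h := floor_succ (Nat.log 2 q) s
  rw [Set.mem_union, mem_node (by omega), mem_node (by omega), mem_node hq, log_two_mul hq,
    log_two_mul_add_one hq, pow_succ 2 (Nat.log 2 q)]
  constructor
  · rintro (⟨h1, h2⟩ | ⟨h1, h2⟩) <;> exact ⟨h1, by omega⟩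
  · rintro ⟨h1, h2⟩
    rcases Nat.mod_two_eq_zero_or_one ⌊(2 : ℝ) ^ (Nat.log 2 q + 1) * s⌋₊ with h3 | h3
    · exact Or.inl ⟨h1, by omega⟩
    · exact Or.inr ⟨h1, by omega⟩

theorem disjoint_node_halves {q : ℕ} (hq : q ≠ 0) : Disjoint (node (2 * q)) (node (2 * q + 1)) := by
  rw [Set.disjoint_left]
  intro s h1 h2
  rw [mem_node (by omega), log_two_mul hq] at h1
  rw [mem_node (by omega), log_two_mul_add_one hq] at h2
  omega

theorem haar_eq_one_iff {q : ℕ} (hq : q ≠ 0) {s : ℝ} : haar q s = 1 ↔ s ∈ node (2 * q) := by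
  classical
  have := fun h1 : s ∈ node (2 * q) => Set.disjoint_left.1 (disjoint_node_halves hq) h1
  rw [haar_apply hq]
  simp only [Set.indicator_apply, Pi.one_apply]
  split_ifs <;> (simp_all; try norm_num)

theorem haar_eq_neg_one_iff {q : ℕ} (hq : q ≠ 0) {s : ℝ} :
    haar q s = -1 ↔ s ∈ node (2 * q + 1) := by
  classical
  have := fun h1 : s ∈ node (2 * q) => Set.disjoint_left.1 (disjoint_node_halves hq) h1
  rw [haar_apply hq]
  simp only [Set.indicator_apply, Pi.one_apply]
  split_ifs <;> (simp_all; try norm_num)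

theorem haar_ne_zero_iff {q : ℕ} (hq : q ≠ 0) {s : ℝ} : haar q s ≠ 0 ↔ s ∈ node q := by
  classical
  have := fun h1 : s ∈ node (2 * q) => Set.disjoint_left.1 (disjoint_node_halves hq) h1
  rw [haar_apply hq, ← node_two_mul_union hq]
  simp only [Set.indicator_apply, Pi.one_apply, Set.mem_union]
  split_ifs <;> simp_all

theorem haar_values {q : ℕ} (hq : q ≠ 0) {s : ℝ} (h : haar q s ≠ 0) :
    haar q s = 1 ∨ haar q s = -1 := by
  rw [haar_eq_one_iff hq, haar_eq_neg_one_iff hq]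
  rwa [haar_ne_zero_iff hq, ← node_two_mul_union hq] at h

theorem haar_zero_apply {s : ℝ} (hs : s ∈ Set.Ico (0 : ℝ) 1) : haar 0 s = 1 := by
  rw [haar, Set.indicator_of_mem hs, Pi.one_apply]

/-- The heap index of the dyadic interval of length `2 ^ (-n)` that contains `s ∈ [0, 1)`. -/
def nodeAt (n : ℕ) (s : ℝ) : ℕ := 2 ^ n + ⌊2 ^ n * s⌋₊

theorem nodeAt_lt {n : ℕ} {s : ℝ} (hs : s ∈ Set.Ico (0 : ℝ) 1) : nodeAt n s < 2 ^ (n + 1) := by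
  have := floor_lt (n := n) hs
  rw [nodeAt, pow_succ]
  omega

theorem log_nodeAt {n : ℕ} {s : ℝ} (hs : s ∈ Set.Ico (0 : ℝ) 1) : Nat.log 2 (nodeAt n s) = n := by
  have h := nodeAt_lt (n := n) hs
  have : 2 ^ n ≤ nodeAt n s := Nat.le_add_right _ _
  rw [Nat.log_eq_iff (Or.inr ⟨by norm_num, by have := Nat.two_pow_pos n; omega⟩)]
  exact ⟨this, h⟩

theorem nodeAt_ne_zero (n : ℕ) (s : ℝ) : nodeAt n s ≠ 0 := by
  have := Nat.two_pow_pos n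
  rw [nodeAt]; omega

theorem nodeAt_succ_div (n : ℕ) (s : ℝ) : nodeAt (n + 1) s / 2 = nodeAt n s := by
  have := floor_succ n s
  rw [nodeAt, nodeAt, pow_succ]
  omega

theorem mem_node_iff_nodeAt {q : ℕ} (hq : q ≠ 0) {s : ℝ} (hs : 0 ≤ s) :
    s ∈ node q ↔ nodeAt (Nat.log 2 q) s = q := by
  rw [mem_node hq, nodeAt]
  exact ⟨fun h => h.2, fun h => ⟨hs, h⟩⟩

theorem node_subset_unit {q : ℕ} (hq : q ≠ 0) : node q ⊆ Set.Ico (0 : ℝ) 1 := by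
  intro s hs
  have h1 := Nat.pow_log_le_self 2 hq
  have h2 := Nat.lt_pow_succ_log_self (b := 2) (by norm_num) q
  rw [pow_succ] at h2
  by_contra h
  have := (isStep_dyadic (n := Nat.log 2 q) (i := q - 2 ^ Nat.log 2 q) (by omega)).1 s h
  rw [Set.indicator_of_mem (show s ∈ dyadicInterval _ _ from hs)] at this
  simp at this

theorem isStep_haar {q M : ℕ} (h : q < 2 ^ M) : IsStep M (haar q) := by
  cases q with
  | zero => exact isStep_haar_zero.mono (Nat.zero_le _)
  | succ n =>
    refine (isStep_haar_succ n).mono ?_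
    exact Nat.log_lt_of_lt_pow (by omega) h

theorem rademacher_apply (n : ℕ) {s : ℝ} (hs : s ∈ Set.Ico (0 : ℝ) 1) :
    rademacher n s = if ⌊2 ^ (n + 1) * s⌋₊ % 2 = 0 then 1 else -1 := by
  rw [rademacher, Finset.sum_apply, Finset.sum_eq_single ⌊2 ^ n * s⌋₊]
  · rw [haarFn_apply _ _ hs.1, if_pos rfl]
  · intro i _ hi
    rw [haarFn_apply _ _ hs.1, if_neg (Ne.symm hi)]
  · intro h
    exact absurd (Finset.mem_range.2 (floor_lt hs)) h

theorem rademacher_eq_or {n : ℕ} {s : ℝ} (hs : s ∈ Set.Ico (0 : ℝ) 1) :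
    rademacher n s = 1 ∨ rademacher n s = -1 := by
  rw [rademacher_apply n hs]
  split_ifs <;> simp

theorem isStep_rademacher {n M : ℕ} (h : n < M) : IsStep M (rademacher n) := by
  refine IsStep.mono h ⟨fun s hs => ?_, fun s hs t ht hst => ?_⟩
  · rw [rademacher, Finset.sum_apply]
    exact Finset.sum_eq_zero fun i hi => (isStep_haarFn (Finset.mem_range.1 hi)).1 s hs
  · rw [rademacher_apply n hs, rademacher_apply n ht, hst]

theorem haar_eq_rademacher_mul {q : ℕ} (hq : q ≠ 0) {s : ℝ} (hs : s ∈ Set.Ico (0 : ℝ) 1) :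
    haar q s = if nodeAt (Nat.log 2 q) s = q then rademacher (Nat.log 2 q) s else 0 := by
  have h1 := Nat.pow_log_le_self 2 hq
  rw [haar_eq_haarFn hq, haarFn_apply _ _ hs.1, rademacher_apply _ hs, nodeAt]
  have : ⌊(2 : ℝ) ^ Nat.log 2 q * s⌋₊ = q - 2 ^ Nat.log 2 q ↔
      2 ^ Nat.log 2 q + ⌊(2 : ℝ) ^ Nat.log 2 q * s⌋₊ = q := by omega
  simp only [this]

/-! ### Flipping a binary digit -/

/-- The index of the point of `[0, 1)` obtained from `i / 2 ^ M` by changing its `j`-th binary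
digit, where digits are counted from `j = 0`. -/
def flip (M j i : ℕ) : ℕ := i ^^^ 2 ^ (M - 1 - j)

theorem flip_flip (M j i : ℕ) : flip M j (flip M j i) = i := by
  rw [flip, flip, Nat.xor_assoc, Nat.xor_self, Nat.xor_zero]

theorem flip_lt {M j i : ℕ} (hj : j < M) (hi : i < 2 ^ M) : flip M j i < 2 ^ M :=
  Nat.xor_lt_two_pow hi (Nat.pow_lt_pow_right (by norm_num) (by omega))

theorem sum_flip {M j : ℕ} (hj : j < M) (g : ℕ → ℝ) :
    ∑ i ∈ Finset.range (2 ^ M), g (flip M j i) = ∑ i ∈ Finset.range (2 ^ M), g i :=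
  Finset.sum_nbij' (flip M j) (flip M j)
    (fun _ hi => Finset.mem_range.2 (flip_lt hj (Finset.mem_range.1 hi)))
    (fun _ hi => Finset.mem_range.2 (flip_lt hj (Finset.mem_range.1 hi)))
    (fun _ _ => flip_flip M j _) (fun _ _ => flip_flip M j _) (fun _ _ => rfl)

/-- The dyadic point `i / 2 ^ M`. -/
def point (M i : ℕ) : ℝ := (i : ℝ) / 2 ^ M

theorem point_mem {M i : ℕ} (hi : i < 2 ^ M) : point M i ∈ Set.Ico (0 : ℝ) 1 := left_end_mem hi

theorem nodeAt_flip {M j n : ℕ} (hj : j < M) (hn : n ≤ j) (i : ℕ) :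
    nodeAt n (point M (flip M j i)) = nodeAt n (point M i) := by
  rw [nodeAt, nodeAt, point, point, floor_point (by omega), floor_point (by omega)]
  congr 1
  rw [flip, Nat.xor_div_two_pow, Nat.div_eq_of_lt (a := 2 ^ (M - 1 - j)), Nat.xor_zero]
  exact Nat.pow_lt_pow_right (by norm_num) (by omega)

theorem rademacher_point {M n i : ℕ} (hn : n < M) (hi : i < 2 ^ M) :
    rademacher n (point M i) = if i.testBit (M - 1 - n) then -1 else 1 := by
  rw [rademacher_apply n (point_mem hi), point, floor_point (by omega),
    Nat.testBit_eq_decide_div_mod_eq, show M - (n + 1) = M - 1 - n by omega]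
  have := Nat.mod_two_eq_zero_or_one (i / 2 ^ (M - 1 - n))
  rcases this with h | h <;> simp [h]

theorem rademacher_flip_self {M j i : ℕ} (hj : j < M) (hi : i < 2 ^ M) :
    rademacher j (point M (flip M j i)) = -rademacher j (point M i) := by
  rw [rademacher_point hj (flip_lt hj hi), rademacher_point hj hi, flip, Nat.testBit_xor,
    Nat.testBit_two_pow_self]
  cases i.testBit (M - 1 - j) <;> simp

theorem rademacher_flip_of_ne {M j n i : ℕ} (hj : j < M) (hn : n < M) (h : n ≠ j)
    (hi : i < 2 ^ M) : rademacher n (point M (flip M j i)) = rademacher n (point M i) := by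
  rw [rademacher_point hn (flip_lt hj hi), rademacher_point hn hi, flip, Nat.testBit_xor,
    Nat.testBit_two_pow_of_ne (by omega), Bool.xor_false]

/-! ### Sums over dyadic points -/

/-- A function that is constant on the support of `h_q` is orthogonal to `h_q`: flipping the digit
with index `log₂ q` exchanges the two halves of the interval. -/
theorem sum_haar {M q : ℕ} (hq : q ≠ 0) (h : q < 2 ^ M) (g : ℝ → ℝ)
    (hg : ∀ s ∈ node q, ∀ t ∈ node q, g s = g t) :
    ∑ i ∈ Finset.range (2 ^ M), g (point M i) * haar q (point M i) = 0 := by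
  have hl : Nat.log 2 q < M := Nat.log_lt_of_lt_pow hq h
  have key : ∀ i ∈ Finset.range (2 ^ M),
      g (point M (flip M (Nat.log 2 q) i)) * haar q (point M (flip M (Nat.log 2 q) i)) =
        -(g (point M i) * haar q (point M i)) := by
    intro i hi
    have hi := Finset.mem_range.1 hi
    have hi' := flip_lt hl hi
    have e := nodeAt_flip hl le_rfl i
    rw [haar_eq_rademacher_mul hq (point_mem hi), haar_eq_rademacher_mul hq (point_mem hi'), e,
      rademacher_flip_self hl hi]
    split_ifs with hn
    · rw [hg _ ((mem_node_iff_nodeAt hq (point_mem hi').1).2 (e.trans hn)) _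
        ((mem_node_iff_nodeAt hq (point_mem hi).1).2 hn)]
      ring
    · simp
  have := sum_flip hl (fun i => g (point M i) * haar q (point M i))
  rw [Finset.sum_congr rfl key, Finset.sum_neg_distrib] at this
  linarith

theorem haar_const_on_node {m q : ℕ} (h : m < q) :
    ∀ s ∈ node q, ∀ t ∈ node q, haar m s = haar m t := by
  intro s hs t ht
  have hq : q ≠ 0 := by omega
  have hsu := node_subset_unit hq hs
  have htu := node_subset_unit hq ht
  have hs' := (mem_node_iff_nodeAt hq hsu.1).1 hs
  have ht' := (mem_node_iff_nodeAt hq htu.1).1 ht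
  rcases Nat.eq_zero_or_pos m with rfl | hm
  · rw [haar_zero_apply hsu, haar_zero_apply htu]
  have hm : m ≠ 0 := by omega
  rcases Nat.lt_or_eq_of_le (Nat.log_mono_right (b := 2) h.le) with hlt | heq
  · obtain ⟨n, rfl⟩ := Nat.exists_eq_succ_of_ne_zero hm
    refine ((isStep_haar_succ n).mono (Nat.succ_le_of_lt hlt)).2 s hsu t htu ?_
    rw [nodeAt] at hs' ht'
    omega
  · rw [haar_eq_rademacher_mul hm hsu, haar_eq_rademacher_mul hm htu, heq, hs', ht',
      if_neg h.ne', if_neg h.ne']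

/-- The reciprocal of the length of the dyadic interval with heap index `q`; the value at `q = 0`
is `1`, the reciprocal of the squared `L²`-norm of `h_∅`. -/
def wt (q : ℕ) : ℝ := 2 ^ Nat.log 2 q

theorem wt_pos (q : ℕ) : 0 < wt q := by unfold wt; positivity

theorem card_nodeAt {M q : ℕ} (hq : q ≠ 0) (h : q < 2 ^ M) :
    ((Finset.range (2 ^ M)).filter fun i => nodeAt (Nat.log 2 q) (point M i) = q).card =
      2 ^ (M - Nat.log 2 q) := by
  have hl : Nat.log 2 q < M := Nat.log_lt_of_lt_pow hq h
  have h1 := Nat.pow_log_le_self 2 hq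
  have h2 := Nat.lt_pow_succ_log_self (b := 2) (by norm_num) q
  rw [pow_succ] at h2
  set j := Nat.log 2 q with hj
  have hM : 2 ^ M = 2 ^ j * 2 ^ (M - j) := by rw [← pow_add]; congr 1; omega
  have hp : 0 < 2 ^ (M - j) := by positivity
  have : ((Finset.range (2 ^ M)).filter fun i => nodeAt j (point M i) = q) =
      Finset.Ico ((q - 2 ^ j) * 2 ^ (M - j)) ((q - 2 ^ j + 1) * 2 ^ (M - j)) := by
    ext i
    rw [Finset.mem_filter, Finset.mem_range, Finset.mem_Ico, nodeAt, point, floor_point hl.le]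
    have e : 2 ^ j + i / 2 ^ (M - j) = q ↔ i / 2 ^ (M - j) = q - 2 ^ j := by omega
    have e' : i / 2 ^ (M - j) = q - 2 ^ j ↔
        q - 2 ^ j ≤ i / 2 ^ (M - j) ∧ i / 2 ^ (M - j) < q - 2 ^ j + 1 := by omega
    rw [e, e', Nat.le_div_iff_mul_le hp, Nat.div_lt_iff_lt_mul hp]
    refine ⟨fun h => h.2, fun h => ⟨h.2.trans_le ?_, h⟩⟩
    rw [hM]
    exact Nat.mul_le_mul_right _ (by omega)
  rw [this, Nat.card_Ico, ← Nat.sub_mul]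
  simp

/-- Orthogonality of the Haar system with respect to the uniform measure on the dyadic points. -/
theorem sum_haar_mul_haar {M q q' : ℕ} (h : q < 2 ^ M) (h' : q' < 2 ^ M) :
    ∑ i ∈ Finset.range (2 ^ M), haar q (point M i) * haar q' (point M i) =
      if q = q' then 2 ^ M / wt q else 0 := by
  split_ifs with he
  · subst he
    rcases Nat.eq_zero_or_pos q with rfl | hq
    · rw [Finset.sum_congr rfl fun i hi => by
        rw [haar_zero_apply (point_mem (Finset.mem_range.1 hi))]]
      simp [wt]
    · have hq : q ≠ 0 := by omega
      have hl : Nat.log 2 q < M := Nat.log_lt_of_lt_pow hq h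
      have key : ∀ i ∈ Finset.range (2 ^ M), haar q (point M i) * haar q (point M i) =
          if nodeAt (Nat.log 2 q) (point M i) = q then 1 else 0 := by
        intro i hi
        have hi := point_mem (Finset.mem_range.1 hi)
        rw [haar_eq_rademacher_mul hq hi]
        split_ifs
        · rcases rademacher_eq_or (n := Nat.log 2 q) hi with h | h <;> rw [h] <;> norm_num
        · simp
      rw [Finset.sum_congr rfl key, Finset.sum_boole, card_nodeAt hq h, wt]
      push_cast
      rw [eq_div_iff (by positivity), ← pow_add]
      congr 1
      omega
  · rcases Nat.lt_or_gt_of_ne he with hlt | hlt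
    · exact sum_haar (by omega) h' _ (haar_const_on_node hlt)
    · rw [Finset.sum_congr rfl fun i _ => mul_comm (haar q (point M i)) (haar q' (point M i))]
      exact sum_haar (by omega) h _ (haar_const_on_node hlt)

theorem IsStep.eq_sum {n : ℕ} {f : ℝ → ℝ} (hf : IsStep n f) :
    f = ∑ i ∈ Finset.range (2 ^ n), f (point n i) • (dyadicInterval n i).indicator (1 : ℝ → ℝ) := by
  funext s
  rw [Finset.sum_apply]
  by_cases hs : s ∈ Set.Ico (0 : ℝ) 1
  · rw [Finset.sum_eq_single ⌊2 ^ n * s⌋₊]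
    · rw [Pi.smul_apply, Set.indicator_of_mem (mem_dyadicInterval.2 ⟨hs.1, rfl⟩)]
      simp only [Pi.one_apply, smul_eq_mul, mul_one]
      exact hf.2 _ hs _ (left_end_mem (floor_lt hs)) (floor_left_end _ _).symm
    · intro i _ hi
      rw [Pi.smul_apply, Set.indicator_of_notMem, smul_zero]
      exact fun h => hi (mem_dyadicInterval.1 h).2.symm
    · intro h
      exact absurd (Finset.mem_range.2 (floor_lt hs)) h
  · rw [hf.1 s hs, Finset.sum_eq_zero]
    intro i hi
    rw [Pi.smul_apply, (isStep_dyadic (Finset.mem_range.1 hi)).1 s hs, smul_zero]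

theorem dyadicInterval_subset {n i : ℕ} (hi : i < 2 ^ n) :
    dyadicInterval n i ⊆ Set.Ico (0 : ℝ) 1 := by
  intro s hs
  by_contra h
  have := (isStep_dyadic hi).1 s h
  rw [Set.indicator_of_mem hs] at this
  simp at this

theorem measurableSet_dyadicInterval (n i : ℕ) : MeasurableSet (dyadicInterval n i) :=
  measurableSet_Ico

theorem volume_dyadicInterval (n i : ℕ) :
    volume (dyadicInterval n i) = ENNReal.ofReal (1 / 2 ^ n) := by
  rw [dyadicInterval, Real.volume_Ico]
  congr 1
  ring

theorem intervalIntegral_eq_sum {M : ℕ} {f : ℝ → ℝ}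
    (hf : ∀ s ∈ Set.Ico (0 : ℝ) 1, ∀ t ∈ Set.Ico (0 : ℝ) 1,
      ⌊2 ^ M * s⌋₊ = ⌊2 ^ M * t⌋₊ → f s = f t) :
    ∫ u in (0 : ℝ)..1, f u = (∑ i ∈ Finset.range (2 ^ M), f (point M i)) / 2 ^ M := by
  have hg : IsStep M ((Set.Ico (0 : ℝ) 1).indicator f) :=
    ⟨fun s hs => Set.indicator_of_notMem hs f, fun s hs t ht h => by
      rw [Set.indicator_of_mem hs, Set.indicator_of_mem ht, hf s hs t ht h]⟩
  have hI : ∀ i ∈ Finset.range (2 ^ M),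
      IntegrableOn (fun u => f (point M i) • (dyadicInterval M i).indicator (1 : ℝ → ℝ) u)
        (Set.Ico (0 : ℝ) 1) := fun i hi =>
    ((integrable_of_mem (dyadic_mem M i (Finset.mem_range.1 hi))).smul (f (point M i))).integrableOn
  have e : ∀ u ∈ Set.Ico (0 : ℝ) 1, f u = ∑ i ∈ Finset.range (2 ^ M),
      f (point M i) • (dyadicInterval M i).indicator (1 : ℝ → ℝ) u := by
    intro u hu
    have := congrFun hg.eq_sum u
    rw [Set.indicator_of_mem hu, Finset.sum_apply] at this
    rw [this]
    refine Finset.sum_congr rfl fun i hi => ?_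
    rw [Pi.smul_apply, Set.indicator_of_mem (point_mem (Finset.mem_range.1 hi))]
  rw [intervalIntegral.integral_of_le zero_le_one, ← integral_Ico_eq_integral_Ioc,
    setIntegral_congr_fun measurableSet_Ico e, integral_finsetSum _ hI, Finset.sum_div]
  refine Finset.sum_congr rfl fun i hi => ?_
  rw [integral_smul, integral_indicator_one (measurableSet_dyadicInterval M i),
    measureReal_restrict_apply (measurableSet_dyadicInterval M i),
    Set.inter_eq_left.2 (dyadicInterval_subset (Finset.mem_range.1 hi)), Measure.real,
    volume_dyadicInterval, ENNReal.toReal_ofReal (by positivity), smul_eq_mul]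
  ring

/-! ### Doubly stochastic averages in Haar system spaces -/

/-- The dyadic step function of level `M` with prescribed values. -/
def stepVec (M : ℕ) (v : Fin (2 ^ M) → ℝ) : haarSpan :=
  ∑ i, v i • ⟨(dyadicInterval M i).indicator 1, dyadic_mem M i i.2⟩

theorem stepVec_apply {M : ℕ} (v : Fin (2 ^ M) → ℝ) {s : ℝ} (hs : s ∈ Set.Ico (0 : ℝ) 1) :
    (stepVec M v).1 s = v ⟨⌊2 ^ M * s⌋₊, floor_lt hs⟩ := by
  rw [stepVec, Submodule.coe_sum, Finset.sum_apply,
    Finset.sum_eq_single ⟨⌊2 ^ M * s⌋₊, floor_lt hs⟩]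
  · simp [Set.indicator_of_mem (mem_dyadicInterval.2 ⟨hs.1, rfl⟩)]
  · intro i _ hi
    have : s ∉ dyadicInterval M i := fun h => hi (Fin.ext (mem_dyadicInterval.1 h).2.symm)
    simp [Set.indicator_of_notMem this]
  · simp

theorem stepVec_apply_of_notMem {M : ℕ} (v : Fin (2 ^ M) → ℝ) {s : ℝ}
    (hs : s ∉ Set.Ico (0 : ℝ) 1) : (stepVec M v).1 s = 0 := by
  rw [stepVec, Submodule.coe_sum, Finset.sum_apply]
  refine Finset.sum_eq_zero fun i _ => ?_
  simp [(isStep_dyadic i.2).1 s hs]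

theorem map_stepVec_apply {M : ℕ} (v : Fin (2 ^ M) → ℝ) {A : Set ℝ} (hA : MeasurableSet A) :
    (volume.restrict (Set.Ico (0 : ℝ) 1)).map (fun s => |(stepVec M v).1 s|) A =
      open Classical in ∑ i, if |v i| ∈ A then ENNReal.ofReal (1 / 2 ^ M) else 0 := by
  classical
  have hm : AEMeasurable (fun s => |(stepVec M v).1 s|) (volume.restrict (Set.Ico (0 : ℝ) 1)) :=
    (integrable_of_mem (stepVec M v).2).abs.aestronglyMeasurable.aemeasurable.restrict
  have hset : (fun s => |(stepVec M v).1 s|) ⁻¹' A ∩ Set.Ico (0 : ℝ) 1 =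
      ⋃ i ∈ Finset.univ.filter (fun i : Fin (2 ^ M) => |v i| ∈ A), dyadicInterval M i := by
    ext s
    simp only [Set.mem_inter_iff, Set.mem_preimage, Set.mem_iUnion, Finset.mem_filter,
      Finset.mem_univ, true_and, exists_prop]
    constructor
    · rintro ⟨h, hs⟩
      rw [stepVec_apply v hs] at h
      exact ⟨_, h, mem_dyadicInterval.2 ⟨hs.1, rfl⟩⟩
    · rintro ⟨i, hi, hs⟩
      have hs' := dyadicInterval_subset i.2 hs
      refine ⟨?_, hs'⟩
      rw [stepVec_apply v hs']
      convert hi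
      exact (mem_dyadicInterval.1 hs).2
  rw [Measure.map_apply_of_aemeasurable hm hA, Measure.restrict_apply' measurableSet_Ico, hset,
    measure_biUnion_finset, Finset.sum_filter]
  · simp only [volume_dyadicInterval]
  · intro i _ j _ hij
    rw [Function.onFun, Set.disjoint_left]
    intro s hi hj
    exact hij (Fin.ext ((mem_dyadicInterval.1 hi).2.symm.trans (mem_dyadicInterval.1 hj).2))
  · exact fun i _ => measurableSet_dyadicInterval M i

theorem HaarSystemNorm.stepVec_perm (N : HaarSystemNorm) {M : ℕ} (v : Fin (2 ^ M) → ℝ)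
    (σ : Equiv.Perm (Fin (2 ^ M))) :
    N.toSeminorm (stepVec M (v ∘ σ)) = N.toSeminorm (stepVec M v) := by
  classical
  have hm : ∀ v : Fin (2 ^ M) → ℝ,
      AEMeasurable (fun s => |(stepVec M v).1 s|) (volume.restrict (Set.Ico (0 : ℝ) 1)) := fun v =>
    (integrable_of_mem (stepVec M v).2).abs.aestronglyMeasurable.aemeasurable.restrict
  refine N.map_eq_of_identDistrib _ _ ⟨hm _, hm _, Measure.ext fun A hA => ?_⟩
  rw [map_stepVec_apply _ hA, map_stepVec_apply _ hA]
  exact Equiv.sum_comp σ fun i => if |v i| ∈ A then ENNReal.ofReal (1 / 2 ^ M) else 0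

theorem eq_point_of_isStep {M : ℕ} {f : ℝ → ℝ} (hf : IsStep M f) {s : ℝ}
    (hs : s ∈ Set.Ico (0 : ℝ) 1) : f s = f (point M ⌊2 ^ M * s⌋₊) :=
  hf.2 _ hs _ (point_mem (floor_lt hs)) (floor_left_end _ _).symm

/-- Doubly stochastic averages of a step function do not increase the norm: by Birkhoff's theorem
they are convex combinations of rearrangements of that function. -/
theorem HaarSystemNorm.le_of_doublyStochastic (N : HaarSystemNorm) {M : ℕ} {x y : haarSpan}
    (hx : IsStep M x.1) (hy : IsStep M y.1) {K : Matrix (Fin (2 ^ M)) (Fin (2 ^ M)) ℝ}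
    (hK : K ∈ doublyStochastic ℝ (Fin (2 ^ M)))
    (h : ∀ i : Fin (2 ^ M), |x.1 (point M i)| ≤ ∑ j, K i j * y.1 (point M j)) :
    N.toSeminorm x ≤ N.toSeminorm y := by
  obtain ⟨w, hw, hw1, rfl⟩ := exists_eq_sum_perm_of_mem_doublyStochastic hK
  set v : Fin (2 ^ M) → ℝ := fun j => y.1 (point M j) with hv
  have hyv : stepVec M v = y := by
    apply Subtype.ext
    funext s
    by_cases hs : s ∈ Set.Ico (0 : ℝ) 1
    · rw [stepVec_apply v hs, eq_point_of_isStep hy hs]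
    · rw [stepVec_apply_of_notMem v hs, hy.1 s hs]
  have hle : N.toSeminorm x ≤ N.toSeminorm (∑ σ, w σ • stepVec M (v ∘ σ)) := by
    refine N.mono fun s => ?_
    by_cases hs : s ∈ Set.Ico (0 : ℝ) 1
    · rw [eq_point_of_isStep hx hs]
      refine (h ⟨⌊2 ^ M * s⌋₊, floor_lt hs⟩).trans ((le_abs_self _).trans (le_of_eq ?_))
      congr 1
      simp only [Submodule.coe_sum, Finset.sum_apply, Submodule.coe_smul, Pi.smul_apply,
        stepVec_apply _ hs, Matrix.sum_apply, Matrix.smul_apply, Finset.sum_mul, smul_eq_mul,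
        Function.comp]
      rw [Finset.sum_comm]
      refine Finset.sum_congr rfl fun σ _ => ?_
      simp only [mul_assoc, ← Finset.mul_sum]
      congr 1
      have := congrFun (Matrix.permMatrix_mulVec (σ := σ) (v := v)) ⟨⌊2 ^ M * s⌋₊, floor_lt hs⟩
      simpa only [Matrix.mulVec, dotProduct, Function.comp] using this
    · rw [hx.1 s hs, abs_zero]
      exact abs_nonneg _
  refine hle.trans ((Finset.le_sum_of_subadditive N.toSeminorm
    (map_zero _).le (map_add_le_add N.toSeminorm) _ _).trans ?_)
  have : ∀ σ, N.toSeminorm (w σ • stepVec M (v ∘ σ)) = w σ * N.toSeminorm y := fun σ => by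
    rw [map_smul_eq_mul, Real.norm_of_nonneg (hw σ), N.stepVec_perm, hyv]
  simp only [this, ← Finset.sum_mul, hw1, one_mul, le_refl]

/-! ### Averages over Rademacher functions -/

theorem rademacherSum_const {ι : Type*} {F : Finset ι} {n : ι → ℕ} {M : ℕ} (hM : ∀ k ∈ F, n k < M)
    (z : ℝ) (c : ι → ℝ) : ∀ s ∈ Set.Ico (0 : ℝ) 1, ∀ t ∈ Set.Ico (0 : ℝ) 1,
      ⌊2 ^ M * s⌋₊ = ⌊2 ^ M * t⌋₊ →
        |z + ∑ k ∈ F, rademacher (n k) s * c k| = |z + ∑ k ∈ F, rademacher (n k) t * c k| := by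
  intro s hs t ht hst
  congr 2
  exact Finset.sum_congr rfl fun k hk => by rw [(isStep_rademacher (hM k hk)).2 s hs t ht hst]

/-- One Rademacher function may be integrated out, because the average is invariant under flipping
the digit on which it depends. -/
theorem integral_abs_rademacher_insert {ι : Type*} [DecidableEq ι] {F : Finset ι} {a : ι}
    (ha : a ∉ F) {n : ι → ℕ} (hn : Set.InjOn n (insert a F : Finset ι)) (z : ℝ) (c : ι → ℝ) :
    ∫ u in (0 : ℝ)..1, |z + ∑ k ∈ insert a F, rademacher (n k) u * c k| =
      ((∫ u in (0 : ℝ)..1, |z + c a + ∑ k ∈ F, rademacher (n k) u * c k|) +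
        ∫ u in (0 : ℝ)..1, |z - c a + ∑ k ∈ F, rademacher (n k) u * c k|) / 2 := by
  obtain ⟨M, hM⟩ : ∃ M, ∀ k ∈ insert a F, n k < M :=
    ⟨(insert a F).sup n + 1, fun k hk => Nat.lt_succ_of_le (Finset.le_sup hk)⟩
  have hM' : ∀ k ∈ F, n k < M := fun k hk => hM k (Finset.mem_insert_of_mem hk)
  have ha' := hM a (Finset.mem_insert_self a F)
  rw [intervalIntegral_eq_sum (rademacherSum_const hM z c),
    intervalIntegral_eq_sum (rademacherSum_const hM' (z + c a) c),
    intervalIntegral_eq_sum (rademacherSum_const hM' (z - c a) c), ← add_div,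
    ← Finset.sum_add_distrib, div_right_comm]
  congr 1
  have hflip := sum_flip ha' fun i => |z + ∑ k ∈ insert a F, rademacher (n k) (point M i) * c k|
  rw [eq_div_iff two_ne_zero, mul_two]
  nth_rewrite 1 [← hflip]
  rw [← Finset.sum_add_distrib]
  refine Finset.sum_congr rfl fun i hi => ?_
  have hi := Finset.mem_range.1 hi
  have e : ∑ k ∈ F, rademacher (n k) (point M (flip M (n a) i)) * c k =
      ∑ k ∈ F, rademacher (n k) (point M i) * c k :=
    Finset.sum_congr rfl fun k hk => by
      rw [rademacher_flip_of_ne ha' (hM' k hk) (fun h => ?_) hi]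
      have : k = a := hn (Finset.mem_insert_of_mem hk) (Finset.mem_insert_self a F) h
      exact ha (this ▸ hk)
  rw [Finset.sum_insert ha, Finset.sum_insert ha, rademacher_flip_self ha' hi, e]
  rcases rademacher_eq_or (n := n a) (point_mem hi) with h | h <;> rw [h] <;> ring_nf

/-- The average does not depend on which distinct Rademacher functions are used. -/
theorem integral_abs_rademacher_reindex {ι : Type*} {F : Finset ι} {n n' : ι → ℕ}
    (hn : Set.InjOn n F) (hn' : Set.InjOn n' F) (c : ι → ℝ) (z : ℝ) :
    ∫ u in (0 : ℝ)..1, |z + ∑ k ∈ F, rademacher (n k) u * c k| =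
      ∫ u in (0 : ℝ)..1, |z + ∑ k ∈ F, rademacher (n' k) u * c k| := by
  classical
  induction F using Finset.induction_on generalizing z with
  | empty => simp
  | insert a F ha ih =>
    have hs : (F : Set ι) ⊆ (insert a F : Finset ι) := by simp
    rw [integral_abs_rademacher_insert ha hn, integral_abs_rademacher_insert ha hn',
      ih (hn.mono hs) (hn'.mono hs), ih (hn.mono hs) (hn'.mono hs)]

theorem intervalIntegrable_rademacherSum {ι : Type*} (F : Finset ι) (n : ι → ℕ) (z : ℝ)
    (c : ι → ℝ) :
    IntervalIntegrable (fun u => |z + ∑ k ∈ F, rademacher (n k) u * c k|) volume 0 1 := by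
  refine IntervalIntegrable.abs (IntervalIntegrable.add (by simp) ?_)
  have : (fun u => ∑ k ∈ F, rademacher (n k) u * c k) = ∑ k ∈ F, c k • rademacher (n k) := by
    funext u
    simp [mul_comm]
  rw [this]
  exact (integrable_of_mem (Submodule.sum_mem _ fun k _ =>
    Submodule.smul_mem _ _ (rademacher_mem (n k)))).intervalIntegrable

/-- Omitting terms of a Rademacher sum does not increase its `L¹`-norm. -/
theorem integral_abs_rademacher_mono {F F' : Finset ℕ} (h : F ⊆ F') (c : ℕ → ℝ) (z : ℝ) :
    ∫ u in (0 : ℝ)..1, |z + ∑ k ∈ F, rademacher k u * c k| ≤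
      ∫ u in (0 : ℝ)..1, |z + ∑ k ∈ F', rademacher k u * c k| := by
  refine (Finset.monotone_iff_forall_le_insert (f := fun F : Finset ℕ =>
    ∫ u in (0 : ℝ)..1, |z + ∑ k ∈ F, rademacher k u * c k|)).2 (fun F a ha => ?_) h
  have e := integral_abs_rademacher_insert ha (n := id) Function.injective_id.injOn z c
  have hI : ∀ z, IntervalIntegrable (fun u => |z + ∑ k ∈ F, rademacher k u * c k|) volume 0 1 :=
    fun z => intervalIntegrable_rademacherSum F id z c
  simp only [id] at e
  rw [e, ← intervalIntegral.integral_add (hI _) (hI _), ← intervalIntegral.integral_div]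
  refine intervalIntegral.integral_mono zero_le_one (hI z) (((hI _).add (hI _)).div_const 2)
    fun u => ?_
  simp only
  rw [le_div_iff₀ two_pos]
  refine le_trans (le_of_eq ?_) (abs_add_le _ _)
  rw [← abs_two, ← abs_mul]
  congr 1
  ring

/-! ### Block systems and their kernels -/

/-- The Haar function with index `n` as an element of `H`. -/
def haarElem (n : ℕ) : haarSpan := ⟨haar n, haar_mem n⟩

/-- A system of signed blocks `b_q = ∑_{J ∈ coll q} ± h_J` of pairwise different Haar functions,
where the functions in each block are disjointly supported, and the supports of the blocks are
nested like dyadic intervals: the support of `b_{2q}` lies in `{b_q = 1}`, and the support of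
`b_{2q+1}` in `{b_q = -1}`.  Blocks may be empty; the block with index `0` is `h_∅`. -/
structure BlockSystem where
  coll : ℕ → Finset ℕ
  sgn : ℕ → ℕ → ℝ
  coll_zero : coll 0 = {0}
  sgn_zero : sgn 0 0 = 1
  sgn_eq : ∀ q, ∀ J ∈ coll q, sgn q J = 1 ∨ sgn q J = -1
  ne_zero : ∀ q ≠ 0, ∀ J ∈ coll q, J ≠ 0
  eq_of_mem : ∀ q, ∀ J ∈ coll q, ∀ J' ∈ coll q, ∀ s, haar J s ≠ 0 → haar J' s ≠ 0 → J = J'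
  disjoint : ∀ q q', q ≠ q' → Disjoint (coll q) (coll q')
  nest_left : ∀ q ≠ 0, ∀ s, ∑ J ∈ coll (2 * q), sgn (2 * q) J * haar J s ≠ 0 →
    ∑ J ∈ coll q, sgn q J * haar J s = 1
  nest_right : ∀ q ≠ 0, ∀ s, ∑ J ∈ coll (2 * q + 1), sgn (2 * q + 1) J * haar J s ≠ 0 →
    ∑ J ∈ coll q, sgn q J * haar J s = -1

namespace BlockSystem

variable (S : BlockSystem)

/-- The block `b_q` as a function. -/
def fn (q : ℕ) (s : ℝ) : ℝ := ∑ J ∈ S.coll q, S.sgn q J * haar J s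

/-- The block `b_q` as an element of `H`. -/
def vec (q : ℕ) : haarSpan := ∑ J ∈ S.coll q, S.sgn q J • haarElem J

theorem fn_zero {s : ℝ} (hs : s ∈ Set.Ico (0 : ℝ) 1) : S.fn 0 s = 1 := by
  rw [fn, S.coll_zero, Finset.sum_singleton, S.sgn_zero, haar_zero_apply hs, one_mul]

/-- At each point, at most one term of a block is nonzero. -/
theorem sum_coll_eq {q J : ℕ} (hJ : J ∈ S.coll q) {s : ℝ} (h : haar J s ≠ 0) (f : ℕ → ℝ) :
    ∑ J' ∈ S.coll q, f J' * haar J' s = f J * haar J s := by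
  refine Finset.sum_eq_single J (fun J' hJ' hne => ?_) (fun h => absurd hJ h)
  by_contra h'
  exact hne (S.eq_of_mem q J' hJ' J hJ s (right_ne_zero_of_mul h') h)

theorem exists_of_fn_ne_zero {q : ℕ} {s : ℝ} (h : S.fn q s ≠ 0) :
    ∃ J ∈ S.coll q, haar J s ≠ 0 := by
  obtain ⟨J, hJ, h⟩ := Finset.exists_ne_zero_of_sum_ne_zero h
  exact ⟨J, hJ, right_ne_zero_of_mul h⟩

theorem fn_ne_zero {q J : ℕ} (hJ : J ∈ S.coll q) {s : ℝ} (h : haar J s ≠ 0) : S.fn q s ≠ 0 := by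
  rw [fn, S.sum_coll_eq hJ h]
  refine mul_ne_zero ?_ h
  rcases S.sgn_eq q J hJ with h | h <;> rw [h] <;> norm_num

theorem fn_values {q : ℕ} (hq : q ≠ 0) {s : ℝ} (h : S.fn q s ≠ 0) :
    S.fn q s = 1 ∨ S.fn q s = -1 := by
  obtain ⟨J, hJ, hJs⟩ := S.exists_of_fn_ne_zero h
  rw [fn, S.sum_coll_eq hJ hJs]
  rcases S.sgn_eq q J hJ with h | h <;>
    rcases haar_values (S.ne_zero q hq J hJ) hJs with h' | h' <;>
    rw [h, h'] <;> norm_num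

end BlockSystem

/-- The partial sum up to level `m` vanishes unless all factors `b_q(s) h_q(t)` along the branch
of `t` are equal to `1`, in which case it is the product of `m` factors `2`. -/
theorem kernel_nonneg_aux {b : ℕ → ℝ} (h0 : b 0 = 1) (hv : ∀ q ≠ 0, b q ≠ 0 → b q = 1 ∨ b q = -1)
    (hl : ∀ q ≠ 0, b (2 * q) ≠ 0 → b q = 1) (hr : ∀ q ≠ 0, b (2 * q + 1) ≠ 0 → b q = -1)
    {t : ℝ} (ht : t ∈ Set.Ico (0 : ℝ) 1) (m : ℕ) :
    0 ≤ ∑ q ∈ Finset.range (2 ^ m), wt q * b q * haar q t ∧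
      (b (nodeAt m t) ≠ 0 → 2 ^ m ≤ ∑ q ∈ Finset.range (2 ^ m), wt q * b q * haar q t) := by
  induction m with
  | zero => simp [wt, h0, haar_zero_apply ht]
  | succ m ih =>
    have hstep : ∑ q ∈ Finset.Ico (2 ^ m) (2 ^ (m + 1)), wt q * b q * haar q t =
        2 ^ m * b (nodeAt m t) * haar (nodeAt m t) t := by
      rw [Finset.sum_eq_single (nodeAt m t), wt, log_nodeAt ht]
      · intro q hq hne
        rw [Finset.mem_Ico] at hq
        have hq0 : q ≠ 0 := by have := Nat.two_pow_pos m; omega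
        have hlog : Nat.log 2 q = m := (Nat.log_eq_iff (Or.inr ⟨by norm_num, hq0⟩)).2 hq
        rw [haar_eq_rademacher_mul hq0 ht, hlog, if_neg hne.symm, mul_zero]
      · intro h
        exact absurd (Finset.mem_Ico.2 ⟨Nat.le_add_right _ _, nodeAt_lt ht⟩) h
    rw [← Finset.sum_range_add_sum_Ico _ (Nat.pow_le_pow_right two_pos (Nat.le_succ m)),
      Nat.succ_eq_add_one, hstep]
    obtain ⟨ih1, ih2⟩ := ih
    have hn0 := nodeAt_ne_zero m t
    set q := nodeAt m t with hq
    set K := ∑ q ∈ Finset.range (2 ^ m), wt q * b q * haar q t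
    have h2 : (0 : ℝ) < 2 ^ m := by positivity
    have hnode : t ∈ node q := by rw [mem_node_iff_nodeAt hn0 ht.1, hq, log_nodeAt ht]
    have hdiv := nodeAt_succ_div m t
    rw [← hq] at hdiv
    rcases haar_values hn0 ((haar_ne_zero_iff hn0).2 hnode) with hh | hh
    · have hnext : nodeAt (m + 1) t = 2 * q := by
        have h := (haar_eq_one_iff hn0).1 hh
        rwa [mem_node_iff_nodeAt (by omega) ht.1, log_two_mul hn0, hq, log_nodeAt ht] at h
      rw [hnext, hh]
      by_cases hb : b q = 0
      · exact ⟨by rw [hb]; linarith, fun h => absurd (hl q hn0 h) (by rw [hb]; norm_num)⟩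
      · have := ih2 hb
        rcases hv q hn0 hb with h | h
        · rw [h, pow_succ]
          exact ⟨by linarith, fun _ => by linarith⟩
        · exact ⟨by rw [h]; linarith, fun h' => absurd (hl q hn0 h') (by rw [h]; norm_num)⟩
    · have hnext : nodeAt (m + 1) t = 2 * q + 1 := by
        have h := (haar_eq_neg_one_iff hn0).1 hh
        rwa [mem_node_iff_nodeAt (by omega) ht.1, log_two_mul_add_one hn0, hq, log_nodeAt ht] at h
      rw [hnext, hh]
      by_cases hb : b q = 0
      · exact ⟨by rw [hb]; linarith, fun h => absurd (hr q hn0 h) (by rw [hb]; norm_num)⟩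
      · have := ih2 hb
        rcases hv q hn0 hb with h | h
        · exact ⟨by rw [h]; linarith, fun h' => absurd (hr q hn0 h') (by rw [h]; norm_num)⟩
        · rw [h, pow_succ]
          exact ⟨by linarith, fun _ => by linarith⟩

namespace BlockSystem

variable (S : BlockSystem)

/-- Every kernel of a block system is nonnegative; blocks with index at least `n` may be replaced by
`0`, so that `n` is without loss of generality a power of `2`. -/
theorem kernel_nonneg {n : ℕ} (hn : 0 < n) {s t : ℝ} (hs : s ∈ Set.Ico (0 : ℝ) 1)
    (ht : t ∈ Set.Ico (0 : ℝ) 1) :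
    0 ≤ ∑ q ∈ Finset.range n, wt q * S.fn q s * haar q t := by
  have h := (kernel_nonneg_aux (b := fun q => if q < n then S.fn q s else 0)
    (by simp [hn, S.fn_zero hs])
    (fun q hq h => by
      by_cases hqn : q < n
      · simp only [hqn, if_true] at h ⊢; exact S.fn_values hq h
      · simp [hqn] at h)
    (fun q hq h => by
      by_cases hqn : 2 * q < n
      · simp only [hqn, if_true] at h
        simp only [show q < n by omega, if_true]
        exact S.nest_left q hq s h
      · simp [hqn] at h)
    (fun q hq h => by
      by_cases hqn : 2 * q + 1 < n
      · simp only [hqn, if_true] at h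
        simp only [show q < n by omega, if_true]
        exact S.nest_right q hq s h
      · simp [hqn] at h) ht n).1
  refine h.trans (le_of_eq ?_)
  rw [← Finset.sum_subset (Finset.range_mono (Nat.lt_two_pow_self (n := n)).le)]
  · exact Finset.sum_congr rfl fun q hq => by rw [if_pos (Finset.mem_range.1 hq)]
  · intro q _ hq
    rw [if_neg (fun h => hq (Finset.mem_range.2 h))]
    simp

/-- The kernel `∑_{q < n} b_q(s) h_q(t) / |I_q|` at the dyadic points of level `M`, as a matrix. -/
def kernel (n M : ℕ) : Matrix (Fin (2 ^ M)) (Fin (2 ^ M)) ℝ := fun i j =>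
  (∑ q ∈ Finset.range n, wt q * S.fn q (point M i) * haar q (point M j)) / 2 ^ M

/-- The kernel maps `h_q` to `b_q`. -/
theorem sum_kernel_mul_haar {n M q : ℕ} (hq : q < n) (hn : n ≤ 2 ^ M) (i : Fin (2 ^ M)) :
    ∑ j, S.kernel n M i j * haar q (point M j) = S.fn q (point M i) := by
  have h : ∀ q' ∈ Finset.range n, ∑ j : Fin (2 ^ M),
      wt q' * S.fn q' (point M i) * haar q' (point M j) * haar q (point M j) =
        if q' = q then 2 ^ M * S.fn q (point M i) else 0 := by
    intro q' hq'
    simp only [mul_assoc, ← Finset.mul_sum]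
    rw [Fin.sum_univ_eq_sum_range fun j => haar q' (point M j) * haar q (point M j),
      sum_haar_mul_haar ((Finset.mem_range.1 hq').trans_le hn) (hq.trans_le hn)]
    split_ifs with h
    · rw [h]
      have := (wt_pos q).ne'
      field_simp
    · simp
  simp only [kernel, div_mul_eq_mul_div, ← Finset.sum_div, Finset.sum_mul]
  rw [Finset.sum_comm, Finset.sum_congr rfl h, Finset.sum_ite_eq',
    if_pos (Finset.mem_range.2 hq), mul_div_cancel_left₀ _ (by positivity)]

theorem sum_fn_mul_haar {M q J : ℕ} (hJ : J < 2 ^ M) (hM : S.coll q ⊆ Finset.range (2 ^ M)) :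
    ∑ i ∈ Finset.range (2 ^ M), S.fn q (point M i) * haar J (point M i) =
      if J ∈ S.coll q then 2 ^ M * (S.sgn q J / wt J) else 0 := by
  simp only [fn, Finset.sum_mul]
  rw [Finset.sum_comm]
  have h : ∀ J' ∈ S.coll q, ∑ i ∈ Finset.range (2 ^ M),
      S.sgn q J' * haar J' (point M i) * haar J (point M i) =
        if J' = J then 2 ^ M * (S.sgn q J / wt J) else 0 := by
    intro J' hJ'
    simp only [mul_assoc, ← Finset.mul_sum]
    rw [sum_haar_mul_haar (Finset.mem_range.1 (hM hJ')) hJ]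
    split_ifs with h
    · rw [h]; ring
    · simp
  rw [Finset.sum_congr rfl h, Finset.sum_ite_eq']

/-- The image of `h_J` under the transposed kernel: a multiple of `h_q` if `h_J` is a term of `b_q`,
and `0` if there is no such block. -/
theorem sum_kernel_mul_haar' {n M J : ℕ} (hJ : J < 2 ^ M)
    (hM : ∀ q < n, S.coll q ⊆ Finset.range (2 ^ M)) (j : Fin (2 ^ M)) :
    ∑ i, S.kernel n M i j * haar J (point M i) = ∑ q ∈ Finset.range n,
      if J ∈ S.coll q then wt q * (S.sgn q J / wt J) * haar q (point M j) else 0 := by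
  have h : ∀ q ∈ Finset.range n, ∑ i : Fin (2 ^ M),
      wt q * S.fn q (point M i) * haar q (point M j) * haar J (point M i) / 2 ^ M =
        if J ∈ S.coll q then wt q * (S.sgn q J / wt J) * haar q (point M j) else 0 := by
    intro q hq
    have e : ∀ i : Fin (2 ^ M),
        wt q * S.fn q (point M i) * haar q (point M j) * haar J (point M i) / 2 ^ M =
        wt q * haar q (point M j) / 2 ^ M * (S.fn q (point M i) * haar J (point M i)) :=
      fun i => by ring
    rw [Finset.sum_congr rfl fun i _ => e i, ← Finset.mul_sum,
      Fin.sum_univ_eq_sum_range fun i => S.fn q (point M i) * haar J (point M i),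
      S.sum_fn_mul_haar hJ (hM q (Finset.mem_range.1 hq))]
    split_ifs
    · field_simp
    · simp
  simp only [kernel, div_mul_eq_mul_div, Finset.sum_mul, Finset.sum_div]
  rw [Finset.sum_comm, Finset.sum_congr rfl h]

/-- The row and column sums of the kernel are its values on the constant function `h_∅`, which the
kernel and its transpose preserve. -/
theorem kernel_mem {n M : ℕ} (hn0 : 0 < n) (hn : n ≤ 2 ^ M)
    (hM : ∀ q < n, S.coll q ⊆ Finset.range (2 ^ M)) :
    S.kernel n M ∈ doublyStochastic ℝ (Fin (2 ^ M)) := by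
  rw [mem_doublyStochastic_iff_sum]
  refine ⟨fun i j => div_nonneg (S.kernel_nonneg hn0 (point_mem i.2) (point_mem j.2))
    (by positivity), fun i => ?_, fun j => ?_⟩
  · have h := S.sum_kernel_mul_haar hn0 hn i
    rw [S.fn_zero (point_mem i.2)] at h
    rw [← h]
    exact Finset.sum_congr rfl fun j _ => by rw [haar_zero_apply (point_mem j.2), mul_one]
  · have h := S.sum_kernel_mul_haar' (J := 0) (by positivity) hM j
    rw [Finset.sum_eq_single (s := Finset.range n) 0, S.coll_zero,
      if_pos (Finset.mem_singleton_self 0), S.sgn_zero, haar_zero_apply (point_mem j.2)] at h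
    · rw [mul_one, mul_div_cancel₀ _ (wt_pos 0).ne'] at h
      rw [← h]
      exact Finset.sum_congr rfl fun i _ => by rw [haar_zero_apply (point_mem i.2), mul_one]
    · intro q _ hq
      rw [if_neg (fun h => S.ne_zero q hq 0 h rfl)]
    · intro h
      exact absurd (Finset.mem_range.2 hn0) h

end BlockSystem

/-! ### Contractions of the Hardy norm -/

/-- `randomSum` is linear in the element of `H`. -/
def randomSumLin (r : RademacherChoice) (u s : ℝ) : haarSpan →ₗ[ℝ] ℝ where
  toFun x := randomSum r x u s
  map_add' x y := randomSum_add r x y u s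
  map_smul' c x := randomSum_smul r c x u s

theorem haarBasis_apply (n : ℕ) : haarBasis n = haarElem n :=
  Module.Basis.span_apply haar_linearIndependent n

theorem randomSumLin_haarElem (r : RademacherChoice) (n : ℕ) (u s : ℝ) :
    randomSumLin r u s (haarElem n) = r.seq n u * haar n s := by
  change randomSum r (haarElem n) u s = _
  rw [← haarBasis_apply, randomSum, Module.Basis.repr_self, Finsupp.sum_single_index] <;> simp

theorem randomSum_sum (r : RademacherChoice) {ι : Type*} (F : Finset ι) (c : ι → ℝ)
    (x : ι → haarSpan) (u s : ℝ) :
    randomSum r (∑ k ∈ F, c k • x k) u s = ∑ k ∈ F, c k * randomSumLin r u s (x k) := by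
  change randomSumLin r u s _ = _
  simp only [map_sum, map_smul, smul_eq_mul]

theorem randomSum_sum_haar (r : RademacherChoice) (F : Finset ℕ) (c : ℕ → ℝ) (u s : ℝ) :
    randomSum r (∑ k ∈ F, c k • haarElem k) u s = ∑ k ∈ F, r.seq k u * (c k * haar k s) := by
  rw [randomSum_sum]
  exact Finset.sum_congr rfl fun k _ => by rw [randomSumLin_haarElem]; ring

theorem randomSum_vec (r : RademacherChoice) (S : BlockSystem) (q : ℕ) (u s : ℝ) :
    randomSumLin r u s (S.vec q) = ∑ J ∈ S.coll q, r.seq J u * (S.sgn q J * haar J s) :=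
  randomSum_sum_haar r _ _ u s

theorem randomSum_mem (r : RademacherChoice) (x : haarSpan) (s : ℝ) :
    (fun u => randomSum r x u s) ∈ haarSpan := by
  have e : (fun u => randomSum r x u s) =
      ∑ n ∈ (haarBasis.repr x).support, (haarBasis.repr x n * haar n s) • r.seq n := by
    funext u
    rw [Finset.sum_apply]
    exact Finset.sum_congr rfl fun n _ => by simp only [Pi.smul_apply, smul_eq_mul]; ring
  rw [e]
  exact Submodule.sum_mem _ fun n _ => Submodule.smul_mem _ _ (r.seq_mem n)

theorem isStep_randomAverage (r : RademacherChoice) {x : haarSpan} {M : ℕ}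
    (h : ∀ u, IsStep M (randomSum r x u)) : IsStep M (randomAverage r x) := by
  refine ⟨fun s hs => ?_, fun s hs t ht hst => ?_⟩
  · simp [randomAverage, fun u => (h u).1 s hs]
  · simp [randomAverage, fun u => (h u).2 s hs t ht hst]

theorem isStep_sum {ι : Type*} {M : ℕ} (F : Finset ι) {f : ι → ℝ → ℝ}
    (h : ∀ k ∈ F, IsStep M (f k)) :
    IsStep M fun s => ∑ k ∈ F, f k s :=
  ⟨fun s hs => Finset.sum_eq_zero fun k hk => (h k hk).1 s hs,
    fun s hs t ht hst => Finset.sum_congr rfl fun k hk => (h k hk).2 s hs t ht hst⟩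

theorem isStep_randomAverage_sum_haar (r : RademacherChoice) {F : Finset ℕ} {M : ℕ}
    (hF : F ⊆ Finset.range (2 ^ M)) (c : ℕ → ℝ) :
    IsStep M (randomAverage r (∑ k ∈ F, c k • haarElem k)) := by
  refine isStep_randomAverage r fun u => ?_
  have : randomSum r (∑ k ∈ F, c k • haarElem k) u =
      fun s => ∑ k ∈ F, (r.seq k u * c k) * haar k s := by
    funext s
    rw [randomSum_sum_haar]
    exact Finset.sum_congr rfl fun k _ => by ring
  rw [this]
  exact isStep_sum F fun k hk => (isStep_haar (Finset.mem_range.1 (hF hk))).smul _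

/-- The triangle inequality for averages with nonnegative weights, integrated. -/
theorem integral_abs_sum_le {ι : Type*} (F : Finset ι) {k : ι → ℝ} (hk : ∀ j ∈ F, 0 ≤ k j)
    {f : ι → ℝ → ℝ} (hf : ∀ j, f j ∈ haarSpan) :
    ∫ u in (0 : ℝ)..1, |∑ j ∈ F, k j * f j u| ≤ ∑ j ∈ F, k j * ∫ u in (0 : ℝ)..1, |f j u| := by
  have hI : ∀ j ∈ F, IntervalIntegrable (fun u => k j * |f j u|) volume 0 1 := fun j _ =>
    ((integrable_of_mem (hf j)).abs.intervalIntegrable).const_mul _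
  have hsum : ∑ j ∈ F, (fun u => k j * |f j u|) = fun u => ∑ j ∈ F, k j * |f j u| := by
    funext u
    rw [Finset.sum_apply]
  have hmem : (fun u => ∑ j ∈ F, k j * f j u) ∈ haarSpan := by
    have : (fun u => ∑ j ∈ F, k j * f j u) = ∑ j ∈ F, k j • f j := by funext u; simp
    rw [this]
    exact Submodule.sum_mem _ fun j _ => Submodule.smul_mem _ _ (hf j)
  simp only [← intervalIntegral.integral_const_mul]
  rw [← intervalIntegral.integral_finsetSum hI]
  refine intervalIntegral.integral_mono zero_le_one
    (integrable_of_mem hmem).abs.intervalIntegrable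
    (hsum ▸ IntervalIntegrable.sum F hI) fun u => ?_
  refine (Finset.abs_sum_le_sum_abs _ _).trans (Finset.sum_le_sum fun j hj => ?_)
  rw [abs_mul, abs_of_nonneg (hk j hj)]

theorem hardyNorm_apply (N : HaarSystemNorm) (r : RademacherChoice) (x : haarSpan) :
    hardyNorm N r x = N.toSeminorm ⟨randomAverage r x, randomAverage_mem r x⟩ := rfl

namespace BlockSystem

variable (S : BlockSystem)

open Classical in
/-- The index of a term of the block `b_q` that does not vanish at `s`, or the junk value `0` if
there is no such term. -/
def active (s : ℝ) (q : ℕ) : ℕ :=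
  if h : ∃ J ∈ S.coll q, haar J s ≠ 0 then h.choose else 0

theorem active_mem {s : ℝ} {q : ℕ} (h : S.fn q s ≠ 0) : S.active s q ∈ S.coll q := by
  have h := S.exists_of_fn_ne_zero h
  rw [active, dif_pos h]
  exact h.choose_spec.1

theorem haar_active {s : ℝ} {q : ℕ} (h : S.fn q s ≠ 0) : haar (S.active s q) s ≠ 0 := by
  have h := S.exists_of_fn_ne_zero h
  rw [active, dif_pos h]
  exact h.choose_spec.2

theorem active_injOn (s : ℝ) : Set.InjOn (S.active s) {q | S.fn q s ≠ 0} := by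
  intro q hq q' hq' h
  by_contra hne
  exact Finset.disjoint_left.1 (S.disjoint q q' hne) (S.active_mem hq) (h ▸ S.active_mem hq')

theorem sum_coll_active {s : ℝ} (q : ℕ) (f : ℕ → ℝ) :
    ∑ J ∈ S.coll q, f J * haar J s =
      if S.fn q s ≠ 0 then f (S.active s q) * haar (S.active s q) s else 0 := by
  split_ifs with h
  · exact S.sum_coll_eq (S.active_mem h) (S.haar_active h) f
  · refine Finset.sum_eq_zero fun J hJ => ?_
    by_contra h'
    exact h (S.fn_ne_zero hJ (right_ne_zero_of_mul h'))

/-- In the average of a sum of blocks, the Rademacher functions of the Haar functions in each block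
may be replaced by the Rademacher function of the index of the block: at each point `s` at most one
term of each block is active, and different blocks have different active terms. -/
theorem integral_relabel (r : RademacherChoice) (n : ℕ) (c : ℕ → ℕ → ℝ) (s : ℝ) :
    ∫ u in (0 : ℝ)..1, |∑ q ∈ Finset.range n, ∑ J ∈ S.coll q, r.seq J u * (c q J * haar J s)| =
      ∫ u in (0 : ℝ)..1, |∑ q ∈ Finset.range n, r.seq q u * ∑ J ∈ S.coll q, c q J * haar J s| := by
  cases r with
  | constant => simp only [RademacherChoice.seq, ← Finset.mul_sum]
  | independent =>
    have e1 : ∀ u, ∑ q ∈ Finset.range n, ∑ J ∈ S.coll q, rademacher J u * (c q J * haar J s) =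
        0 + ∑ q ∈ (Finset.range n).filter (fun q => S.fn q s ≠ 0), rademacher (S.active s q) u *
          (c q (S.active s q) * haar (S.active s q) s) := fun u => by
      rw [zero_add, Finset.sum_filter]
      refine Finset.sum_congr rfl fun q _ => ?_
      simp only [← mul_assoc]
      exact S.sum_coll_active q fun J => rademacher J u * c q J
    have e2 : ∀ u, ∑ q ∈ Finset.range n, rademacher q u * ∑ J ∈ S.coll q, c q J * haar J s =
        0 + ∑ q ∈ (Finset.range n).filter (fun q => S.fn q s ≠ 0), rademacher (id q) u *
          (c q (S.active s q) * haar (S.active s q) s) := fun u => by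
      rw [zero_add, Finset.sum_filter]
      refine Finset.sum_congr rfl fun q _ => ?_
      rw [S.sum_coll_active q fun J => c q J]
      simp
    simp only [RademacherChoice.seq, e1, e2]
    exact integral_abs_rademacher_reindex
      ((S.active_injOn s).mono fun q hq => (Finset.mem_filter.1 hq).2)
      Function.injective_id.injOn _ 0

theorem exists_level (n L : ℕ) :
    ∃ M, n ≤ 2 ^ M ∧ L ≤ 2 ^ M ∧ ∀ q < n, S.coll q ⊆ Finset.range (2 ^ M) := by
  refine ⟨n + L + ∑ q ∈ Finset.range n, ∑ J ∈ S.coll q, J, ?_, ?_, fun q hq J hJ => ?_⟩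
  · exact le_trans (by omega) Nat.lt_two_pow_self.le
  · exact le_trans (by omega) Nat.lt_two_pow_self.le
  · rw [Finset.mem_range]
    refine lt_of_le_of_lt ?_ Nat.lt_two_pow_self
    have h1 : J ≤ ∑ J ∈ S.coll q, J :=
      Finset.single_le_sum (f := fun J => J) (fun _ _ => Nat.zero_le _) hJ
    have h2 : ∑ J ∈ S.coll q, J ≤ ∑ q ∈ Finset.range n, ∑ J ∈ S.coll q, J :=
      Finset.single_le_sum (f := fun q => ∑ J ∈ S.coll q, J) (fun _ _ => Nat.zero_le _)
        (Finset.mem_range.2 hq)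
    omega

/-- Replacing Haar functions by blocks does not increase the Hardy norm: pointwise, the random
average of the image is at most the average of the random averages against the kernel. -/
theorem hardyNorm_sum_vec_le (N : HaarSystemNorm) (r : RademacherChoice) (n : ℕ) (a : ℕ → ℝ) :
    hardyNorm N r (∑ q ∈ Finset.range n, a q • S.vec q) ≤
      hardyNorm N r (∑ q ∈ Finset.range n, a q • haarElem q) := by
  rcases Nat.eq_zero_or_pos n with rfl | hn0
  · simp
  obtain ⟨M, hn, -, hM⟩ := S.exists_level n 0
  have hK := S.kernel_mem hn0 hn hM
  rw [hardyNorm_apply, hardyNorm_apply]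
  refine N.le_of_doublyStochastic (M := M) (isStep_randomAverage r fun u => ?_)
    (isStep_randomAverage_sum_haar r (Finset.range_mono hn) a) hK fun i => ?_
  · have : randomSum r (∑ q ∈ Finset.range n, a q • S.vec q) u = fun s =>
        ∑ q ∈ Finset.range n, ∑ J ∈ S.coll q, (a q * r.seq J u * S.sgn q J) * haar J s := by
      funext s
      rw [randomSum_sum]
      refine Finset.sum_congr rfl fun q _ => ?_
      rw [randomSum_vec, Finset.mul_sum]
      exact Finset.sum_congr rfl fun J _ => by ring
    rw [this]
    exact isStep_sum _ fun q hq => isStep_sum _ fun J hJ =>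
      (isStep_haar (Finset.mem_range.1 (hM q (Finset.mem_range.1 hq) hJ))).smul _
  · rw [abs_of_nonneg (randomAverage_nonneg _ _ _)]
    have e : randomAverage r (∑ q ∈ Finset.range n, a q • S.vec q) (point M i) =
        ∫ u in (0 : ℝ)..1, |∑ j, S.kernel n M i j *
          randomSum r (∑ q ∈ Finset.range n, a q • haarElem q) u (point M j)| := by
      have := S.integral_relabel r n (fun q J => a q * S.sgn q J) (point M i)
      rw [randomAverage]
      refine Eq.trans ?_ (this.trans ?_)
      · congr 1
        funext u
        rw [randomSum_sum]
        congr 1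
        refine Finset.sum_congr rfl fun q _ => ?_
        rw [randomSum_vec, Finset.mul_sum]
        exact Finset.sum_congr rfl fun J _ => by ring
      · congr 1
        funext u
        congr 1
        simp only [randomSum_sum_haar, Finset.mul_sum]
        rw [Finset.sum_comm]
        refine Finset.sum_congr rfl fun q hq => ?_
        have h := S.sum_kernel_mul_haar (Finset.mem_range.1 hq) hn i
        rw [← Finset.mul_sum, Finset.sum_congr rfl fun J _ => mul_assoc (a q) _ _,
          ← Finset.mul_sum, show ∑ J ∈ S.coll q, S.sgn q J * haar J (point M i) =
            S.fn q (point M i) from rfl, ← h, Finset.mul_sum, Finset.mul_sum]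
        exact Finset.sum_congr rfl fun J _ => by ring
    rw [e]
    exact integral_abs_sum_le _ (fun j _ => nonneg_of_mem_doublyStochastic hK)
      fun j => randomSum_mem r _ _

/-- In the independent case, omitting the Haar functions outside the blocks and relabelling the
Rademacher functions does not increase the average. -/
theorem integral_blocks_le (n : ℕ) {L : ℕ} (hL : ∀ q < n, S.coll q ⊆ Finset.range L) (c : ℕ → ℝ)
    (s : ℝ) :
    ∫ u in (0 : ℝ)..1, |∑ q ∈ Finset.range n, rademacher q u * ∑ J ∈ S.coll q, c J * haar J s| ≤
      ∫ u in (0 : ℝ)..1, |∑ J ∈ Finset.range L, rademacher J u * (c J * haar J s)| := by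
  have h := S.integral_relabel .independent n (fun _ J => c J) s
  simp only [RademacherChoice.seq] at h
  rw [← h]
  have e : ∀ u, ∑ q ∈ Finset.range n, ∑ J ∈ S.coll q, rademacher J u * (c J * haar J s) =
      ∑ J ∈ (Finset.range n).biUnion S.coll, rademacher J u * (c J * haar J s) := fun u =>
    (Finset.sum_biUnion fun q _ q' _ hne => S.disjoint q q' hne).symm
  simp only [e]
  have := integral_abs_rademacher_mono (F := (Finset.range n).biUnion S.coll)
    (F' := Finset.range L) (Finset.biUnion_subset.2 fun q hq => hL q (Finset.mem_range.1 hq))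
    (fun J => c J * haar J s) 0
  simpa only [zero_add] using this

/-- The coefficient of the image of `∑ c_J h_J` at `h_q` under the transposed kernel. -/
def coeff (c : ℕ → ℝ) (q : ℕ) : ℝ := wt q * ∑ J ∈ S.coll q, S.sgn q J * c J / wt J

/-- The transposed kernel applied to a combination of the terms of a single block. -/
theorem sum_kernel_mul_block {n M q : ℕ} (hq : q < n)
    (hM : ∀ q < n, S.coll q ⊆ Finset.range (2 ^ M)) (c : ℕ → ℝ) (j : Fin (2 ^ M)) :
    ∑ i, S.kernel n M i j * ∑ J ∈ S.coll q, c J * haar J (point M i) =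
      S.coeff c q * haar q (point M j) := by
  have h : ∀ J ∈ S.coll q, ∑ i, S.kernel n M i j * (c J * haar J (point M i)) =
      wt q * haar q (point M j) * (S.sgn q J * c J / wt J) := by
    intro J hJ
    have e : ∀ i, S.kernel n M i j * (c J * haar J (point M i)) =
        c J * (S.kernel n M i j * haar J (point M i)) := fun i => by ring
    rw [Finset.sum_congr rfl fun i _ => e i, ← Finset.mul_sum,
      S.sum_kernel_mul_haar' (Finset.mem_range.1 (hM q hq hJ)) hM j,
      Finset.sum_eq_single (s := Finset.range n) q, if_pos hJ]
    · ring
    · intro q' _ hne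
      rw [if_neg]
      exact fun h' => Finset.disjoint_left.1 (S.disjoint q' q hne) h' hJ
    · intro h
      exact absurd (Finset.mem_range.2 hq) h
  simp only [Finset.mul_sum]
  rw [Finset.sum_comm, Finset.sum_congr rfl h, ← Finset.mul_sum, coeff]
  ring

/-- The transposed kernel applied to an arbitrary element of `H`. -/
theorem sum_kernel_mul_sum {n L M : ℕ} (hL : ∀ q < n, S.coll q ⊆ Finset.range L)
    (hLM : L ≤ 2 ^ M) (c : ℕ → ℝ) (j : Fin (2 ^ M)) :
    ∑ i, S.kernel n M i j * ∑ J ∈ Finset.range L, c J * haar J (point M i) =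
      ∑ q ∈ Finset.range n, S.coeff c q * haar q (point M j) := by
  have hM : ∀ q < n, S.coll q ⊆ Finset.range (2 ^ M) := fun q hq =>
    (hL q hq).trans (Finset.range_mono hLM)
  have h : ∀ J ∈ Finset.range L, ∑ i, S.kernel n M i j * (c J * haar J (point M i)) =
      ∑ q ∈ Finset.range n, if J ∈ S.coll q then
        wt q * haar q (point M j) * (S.sgn q J * c J / wt J) else 0 := by
    intro J hJ
    have e : ∀ i, S.kernel n M i j * (c J * haar J (point M i)) =
        c J * (S.kernel n M i j * haar J (point M i)) := fun i => by ring
    rw [Finset.sum_congr rfl fun i _ => e i, ← Finset.mul_sum,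
      S.sum_kernel_mul_haar' ((Finset.mem_range.1 hJ).trans_le hLM) hM j, Finset.mul_sum]
    refine Finset.sum_congr rfl fun q _ => ?_
    split_ifs
    · ring
    · simp
  simp only [Finset.mul_sum]
  rw [Finset.sum_comm, Finset.sum_congr rfl h, Finset.sum_comm]
  refine Finset.sum_congr rfl fun q hq => ?_
  rw [Finset.sum_ite_mem, Finset.inter_eq_right.2 (hL q (Finset.mem_range.1 hq)), ← Finset.mul_sum,
    coeff]
  ring

/-- The transposed operator, which maps `x` to the element of `H` with Haar coefficients
`⟨x, b_q⟩ / |I_q|`, does not increase the Hardy norm. -/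
theorem hardyNorm_sum_coeff_le (N : HaarSystemNorm) (r : RademacherChoice) (n : ℕ) {L : ℕ}
    (hL : ∀ q < n, S.coll q ⊆ Finset.range L) (c : ℕ → ℝ) :
    hardyNorm N r (∑ q ∈ Finset.range n, S.coeff c q • haarElem q) ≤
      hardyNorm N r (∑ J ∈ Finset.range L, c J • haarElem J) := by
  rcases Nat.eq_zero_or_pos n with rfl | hn0
  · simp
  obtain ⟨M, hn, hLM, hM⟩ := S.exists_level n L
  have hK := S.kernel_mem hn0 hn hM
  rw [hardyNorm_apply, hardyNorm_apply]
  refine N.le_of_doublyStochastic (M := M)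
    (isStep_randomAverage_sum_haar r (Finset.range_mono hn) _)
    (isStep_randomAverage_sum_haar r (Finset.range_mono hLM) _)
    (transpose_mem_doublyStochastic_iff.2 hK) fun j => ?_
  rw [abs_of_nonneg (randomAverage_nonneg _ _ _)]
  simp only [Matrix.transpose_apply, randomAverage]
  have hpos : ∀ i ∈ Finset.univ, 0 ≤ S.kernel n M i j := fun i _ =>
    nonneg_of_mem_doublyStochastic hK
  cases r with
  | constant =>
    refine le_trans (le_of_eq ?_) (integral_abs_sum_le Finset.univ hpos
      (f := fun i u => randomSum .constant (∑ J ∈ Finset.range L, c J • haarElem J) u (point M i))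
      fun i => randomSum_mem _ _ _)
    congr 1
    funext u
    simp only [randomSum_sum_haar, RademacherChoice.seq, ← Finset.mul_sum]
    rw [← S.sum_kernel_mul_sum hL hLM c j, Finset.mul_sum]
    congr 1
    exact Finset.sum_congr rfl fun i _ => by ring
  | independent =>
    have hmem : ∀ i : Fin (2 ^ M), (fun u => ∑ q ∈ Finset.range n,
        rademacher q u * ∑ J ∈ S.coll q, c J * haar J (point M i)) ∈ haarSpan := fun i => by
      have : (fun u => ∑ q ∈ Finset.range n,
          rademacher q u * ∑ J ∈ S.coll q, c J * haar J (point M i)) =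
          ∑ q ∈ Finset.range n, (∑ J ∈ S.coll q, c J * haar J (point M i)) • rademacher q := by
        funext u
        rw [Finset.sum_apply]
        exact Finset.sum_congr rfl fun q _ => by rw [Pi.smul_apply, smul_eq_mul, mul_comm]
      rw [this]
      exact Submodule.sum_mem _ fun q _ => Submodule.smul_mem _ _ (rademacher_mem q)
    refine le_trans (le_of_eq ?_) ((integral_abs_sum_le Finset.univ hpos
      (f := fun i u => ∑ q ∈ Finset.range n,
        rademacher q u * ∑ J ∈ S.coll q, c J * haar J (point M i)) hmem).trans
      (Finset.sum_le_sum fun i hi => mul_le_mul_of_nonneg_left ?_ (hpos i hi)))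
    · congr 1
      funext u
      simp only [randomSum_sum_haar, RademacherChoice.seq]
      congr 1
      have e : ∀ i, S.kernel n M i j * ∑ q ∈ Finset.range n,
          rademacher q u * ∑ J ∈ S.coll q, c J * haar J (point M i) =
          ∑ q ∈ Finset.range n, rademacher q u *
            (S.kernel n M i j * ∑ J ∈ S.coll q, c J * haar J (point M i)) := fun i => by
        rw [Finset.mul_sum]
        exact Finset.sum_congr rfl fun q _ => by ring
      rw [Finset.sum_congr rfl fun i _ => e i, Finset.sum_comm]
      refine Finset.sum_congr rfl fun q hq => ?_
      rw [← Finset.mul_sum, S.sum_kernel_mul_block (Finset.mem_range.1 hq) hM c j]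
    · simp only [randomSum_sum_haar, RademacherChoice.seq]
      exact S.integral_blocks_le n hL c (point M i)

end BlockSystem

/-- The initial segment of the Haar system of length `n` as a block system, with empty blocks after
it. -/
def initialSystem (n : ℕ) : BlockSystem where
  coll q := if q = 0 ∨ q < n then {q} else ∅
  sgn _ _ := 1
  coll_zero := by simp
  sgn_zero := rfl
  sgn_eq _ _ _ := Or.inl rfl
  ne_zero q hq J hJ := by
    split_ifs at hJ
    · rwa [Finset.mem_singleton.1 hJ]
    · simp at hJ
  eq_of_mem q J hJ J' hJ' _ _ _ := by
    split_ifs at hJ hJ'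
    · rw [Finset.mem_singleton.1 hJ, Finset.mem_singleton.1 hJ']
    · simp at hJ
  disjoint q q' h := by split_ifs <;> simp [h]
  nest_left q hq s h := by
    split_ifs at h with h1
    · rw [if_pos (by omega)]
      simp only [Finset.sum_singleton, one_mul] at h ⊢
      exact (haar_eq_one_iff hq).2 ((haar_ne_zero_iff (by omega)).1 h)
    · simp at h
  nest_right q hq s h := by
    by_cases h1 : 2 * q + 1 < n
    · rw [if_pos (Or.inr h1)] at h
      rw [if_pos (by omega)]
      simp only [Finset.sum_singleton, one_mul] at h ⊢
      exact (haar_eq_neg_one_iff hq).2 ((haar_ne_zero_iff (by omega)).1 h)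
    · rw [if_neg (by omega)] at h
      simp at h

/-- The Haar system is a monotone basic sequence for the Hardy norm, since the partial sum
projections are given by the kernels of its initial segments. -/
theorem hardyNorm_partialSum_le (N : HaarSystemNorm) (r : RademacherChoice) {n m : ℕ} (h : n ≤ m)
    (a : ℕ → ℝ) :
    hardyNorm N r (∑ q ∈ Finset.range n, a q • haarElem q) ≤
      hardyNorm N r (∑ q ∈ Finset.range m, a q • haarElem q) := by
  rcases Nat.eq_zero_or_pos n with rfl | hn0
  · simp
  have key := (initialSystem n).hardyNorm_sum_vec_le N r m a
  have e : ∑ q ∈ Finset.range m, a q • (initialSystem n).vec q =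
      ∑ q ∈ Finset.range n, a q • haarElem q := by
    rw [← Finset.sum_subset (Finset.range_mono h)]
    · refine Finset.sum_congr rfl fun q hq => ?_
      simp [BlockSystem.vec, initialSystem, Finset.mem_range.1 hq]
    · intro q _ hq
      rw [Finset.mem_range] at hq
      simp [BlockSystem.vec, initialSystem, hq, show q ≠ 0 by omega]
  rwa [e] at key

/-! ### Monotone bases and domination in Banach spaces -/

section Banach

variable {E : Type*} [NormedAddCommGroup E] [NormedSpace ℝ E]

theorem hasSum_conditional_iff {E : Type*} [AddCommMonoid E] [TopologicalSpace E] {f : ℕ → E}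
    {x : E} : HasSum f x (SummationFilter.conditional ℕ) ↔
      Filter.Tendsto (fun n => ∑ k ∈ Finset.range n, f k) Filter.atTop (nhds x) := by
  rw [HasSum, SummationFilter.conditional_filter_eq_map_range, Filter.tendsto_map'_iff]
  rfl

theorem hasWeakStarSum_iff {y : ℕ → StrongDual ℝ E} {t : StrongDual ℝ E} :
    HasWeakStarSum y t ↔ ∀ x : E, Filter.Tendsto (fun n => ∑ k ∈ Finset.range n, y k x)
      Filter.atTop (nhds (t x)) := by
  rw [HasWeakStarSum, hasSum_conditional_iff]
  simp only [← map_sum]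
  rw [tendsto_iff_forall_eval_tendsto_topDualPairing]
  refine forall_congr' fun x => ?_
  have h : ∀ n, (∑ k ∈ Finset.range n, y k) x = ∑ k ∈ Finset.range n, y k x :=
    fun n => sum_apply _ _ _
  exact ⟨fun h' => h'.congr h, fun h' => h'.congr fun n => (h n).symm⟩

theorem norm_le_of_dense {F : Type*} [NormedAddCommGroup F] [NormedSpace ℝ F] {D : Set E}
    (hD : Dense D) {C : ℝ} (T : E →L[ℝ] F) (h : ∀ x ∈ D, ‖T x‖ ≤ C * ‖x‖) (x : E) :
    ‖T x‖ ≤ C * ‖x‖ :=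
  (isClosed_le (by fun_prop) (by fun_prop) : IsClosed {x | ‖T x‖ ≤ C * ‖x‖}).closure_subset_iff.2 h
    (hD x)

/-- A uniformly bounded sequence of operators converges at every point if it does so on a dense
set. -/
theorem cauchySeq_of_dense {F : Type*} [NormedAddCommGroup F] [NormedSpace ℝ F] {D : Set E}
    (hD : Dense D) {C : ℝ} (hC : 0 ≤ C) (T : ℕ → E →L[ℝ] F) (h : ∀ n, ∀ x, ‖T n x‖ ≤ C * ‖x‖)
    (hT : ∀ x ∈ D, CauchySeq fun n => T n x) (x : E) : CauchySeq fun n => T n x := by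
  rw [Metric.cauchySeq_iff]
  intro ε hε
  obtain ⟨y, hy, hxy⟩ := Metric.dense_iff.1 hD x (ε / (3 * (C + 1))) (by positivity)
  obtain ⟨n₀, hn₀⟩ := Metric.cauchySeq_iff.1 (hT y hxy) (ε / 3) (by positivity)
  refine ⟨n₀, fun m hm n hn => ?_⟩
  have hb : ∀ k, dist (T k x) (T k y) < ε / 3 := fun k => by
    rw [dist_eq_norm, ← map_sub]
    refine (h k _).trans_lt ?_
    rw [Metric.mem_ball, dist_comm, dist_eq_norm, lt_div_iff₀ (by positivity)] at hy
    nlinarith [norm_nonneg (x - y)]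
  calc dist (T m x) (T n x)
      ≤ dist (T m x) (T m y) + dist (T m y) (T n y) + dist (T n y) (T n x) := dist_triangle4 _ _ _ _
    _ < ε := by
      have h1 := hb m
      have h2 := hb n
      rw [dist_comm] at h2
      linarith [hn₀ m hm n hn]

theorem linearCombination_eq_sum_range (e : ℕ → E) (l : ℕ →₀ ℝ) {n : ℕ}
    (hn : l.support ⊆ Finset.range n) :
    Finsupp.linearCombination ℝ e l = ∑ k ∈ Finset.range n, l k • e k := by
  rw [Finsupp.linearCombination_apply]
  exact Finsupp.sum_of_support_subset l hn _ (by simp)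

theorem exists_support_subset_range (l : ℕ →₀ ℝ) : ∃ n, l.support ⊆ Finset.range n :=
  ⟨l.support.sup id + 1, fun _ hk =>
    Finset.mem_range.2 (Nat.lt_succ_of_le (Finset.le_sup (f := id) hk))⟩

theorem norm_sum_range_le_linearCombination {e : ℕ → E}
    (hm : ∀ (a : ℕ → ℝ) (n m : ℕ), n ≤ m →
      ‖∑ k ∈ Finset.range n, a k • e k‖ ≤ ‖∑ k ∈ Finset.range m, a k • e k‖) (l : ℕ →₀ ℝ) (n : ℕ) :
    ‖∑ k ∈ Finset.range n, l k • e k‖ ≤ ‖Finsupp.linearCombination ℝ e l‖ := by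
  obtain ⟨m, hl⟩ := exists_support_subset_range l
  rw [linearCombination_eq_sum_range e l (hl.trans (Finset.range_mono (le_max_right n m)))]
  exact hm _ _ _ (le_max_left n m)

/-- A monotone basic sequence with dense linear span is a Schauder basis. -/
theorem exists_schauderBasis [CompleteSpace E] {e : ℕ → E} (he : ∀ k, e k ≠ 0)
    (hd : DenseRange (Finsupp.linearCombination ℝ e))
    (hm : ∀ (a : ℕ → ℝ) (n m : ℕ), n ≤ m →
      ‖∑ k ∈ Finset.range n, a k • e k‖ ≤ ‖∑ k ∈ Finset.range m, a k • e k‖) :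
    ∃ b : SchauderBasis ℝ E, ∀ k, b k = e k := by
  have hP := norm_sum_range_le_linearCombination hm
  have hc : ∀ k, ∃ C : ℝ, ∀ l : ℕ →₀ ℝ,
      ‖(Finsupp.lapply k : (ℕ →₀ ℝ) →ₗ[ℝ] ℝ) l‖ ≤ C * ‖Finsupp.linearCombination ℝ e l‖ := by
    intro k
    -- The `k`-th term is the difference of two partial sums.
    refine ⟨2 / ‖e k‖, fun l => ?_⟩
    have hk : 0 < ‖e k‖ := norm_pos_iff.2 (he k)
    rw [div_mul_eq_mul_div, le_div_iff₀ hk, Finsupp.lapply_apply, ← norm_smul]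
    have h1 := hP l (k + 1)
    have h2 := hP l k
    have h3 : l k • e k =
        ∑ i ∈ Finset.range (k + 1), l i • e i - ∑ i ∈ Finset.range k, l i • e i := by
      rw [Finset.sum_range_succ, add_sub_cancel_left]
    rw [h3]
    exact (norm_sub_le _ _).trans (by linarith)
  let c : ℕ → StrongDual ℝ E := fun k =>
    (Finsupp.lapply k : (ℕ →₀ ℝ) →ₗ[ℝ] ℝ).extendOfNorm (Finsupp.linearCombination ℝ e)
  have hcl : ∀ k l, c k (Finsupp.linearCombination ℝ e l) = l k := fun k l =>
    LinearMap.extendOfNorm_eq hd (hc k) l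
  let P : ℕ → E →L[ℝ] E := fun n => ∑ k ∈ Finset.range n, (c k).smulRight (e k)
  have hPa : ∀ n x, P n x = ∑ k ∈ Finset.range n, c k x • e k := fun n x => by
    simp [P]
  have hPl : ∀ n l, P n (Finsupp.linearCombination ℝ e l) = ∑ k ∈ Finset.range n, l k • e k :=
    fun n l => by rw [hPa]; simp only [hcl]
  have hPn : ∀ n x, ‖(P n - ContinuousLinearMap.id ℝ E) x‖ ≤ 2 * ‖x‖ := fun n x => by
    have h := norm_le_of_dense (C := 1) hd (P n) (by
      rintro _ ⟨l, rfl⟩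
      rw [hPl, one_mul]
      exact hP l n) x
    rw [one_mul] at h
    exact (norm_sub_le _ _).trans (by simpa [two_mul] using h)
  refine ⟨⟨e, c, fun i j => ?_, fun x => ?_⟩, fun _ => rfl⟩
  · have := hcl i (Finsupp.single j 1)
    rw [Finsupp.linearCombination_single, one_smul] at this
    rw [this]
    simp only [Finsupp.single_apply, Pi.single_apply]
    by_cases h : i = j
    · simp [h]
    · simp [h, Ne.symm h]
  · rw [hasSum_conditional_iff, Metric.tendsto_atTop]
    intro ε hε
    obtain ⟨_, hy, l, rfl⟩ := Metric.dense_iff.1 hd x (ε / 2) (by positivity)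
    obtain ⟨n₀, hn₀⟩ := exists_support_subset_range l
    refine ⟨n₀, fun n hn => ?_⟩
    set y := Finsupp.linearCombination ℝ e l with hy'
    have hfix : (P n - ContinuousLinearMap.id ℝ E) y = 0 := by
      have := linearCombination_eq_sum_range e l (hn₀.trans (Finset.range_mono hn))
      simp only [sub_apply, ContinuousLinearMap.id_apply, hy', hPl, ← this,
        sub_self]
    rw [Metric.mem_ball, dist_comm, dist_eq_norm] at hy
    have h2 := hPn n (x - y)
    rw [map_sub, hfix, sub_zero] at h2
    rw [← hPa, dist_eq_norm]
    exact lt_of_le_of_lt h2 (by linarith)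

theorem denseRange_linearCombination (b : SchauderBasis ℝ E) :
    DenseRange (Finsupp.linearCombination ℝ b) := by
  intro x
  refine mem_closure_of_tendsto (SchauderBasis.tendsto_proj b x) (Filter.Eventually.of_forall
    fun n => ?_)
  rw [SchauderBasis.proj_apply]
  refine ⟨∑ k ∈ Finset.range n, Finsupp.single k (b.coord k x), ?_⟩
  simp

theorem coord_linearCombination (b : SchauderBasis ℝ E) (k : ℕ) (l : ℕ →₀ ℝ) :
    b.coord k (Finsupp.linearCombination ℝ b l) = l k := by
  rw [Finsupp.linearCombination_apply, Finsupp.sum, map_sum]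
  simp only [map_smul, b.ortho, Pi.single_apply, smul_eq_mul, mul_ite, mul_one, mul_zero]
  rw [Finset.sum_ite_eq]
  simp only [Finsupp.mem_support_iff, ne_eq, ite_not]
  split_ifs with h <;> simp [h]

/-- An estimate for all finite sums gives domination: applied to sums that start at `m`, it shows
that the dominated series is Cauchy. -/
theorem normDominated_of_bound [CompleteSpace E] (b : SchauderBasis ℝ E) {x : ℕ → E} {C : ℝ}
    (hC : 0 ≤ C) (hx : ∀ (a : ℕ → ℝ) (n : ℕ),
      ‖∑ k ∈ Finset.range n, a k • x k‖ ≤ C * ‖∑ k ∈ Finset.range n, a k • b k‖) :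
    NormDominated C x b := by
  intro a t ht
  rw [hasSum_conditional_iff] at ht
  have hdiff : ∀ m n, m ≤ n →
      dist (∑ k ∈ Finset.range n, a k • x k) (∑ k ∈ Finset.range m, a k • x k) ≤
        C * dist (∑ k ∈ Finset.range n, a k • b k) (∑ k ∈ Finset.range m, a k • b k) := by
    intro m n hmn
    have key : ∀ v : ℕ → E, ∑ k ∈ Finset.range n, (if k < m then 0 else a k) • v k =
        ∑ k ∈ Finset.range n, a k • v k - ∑ k ∈ Finset.range m, a k • v k := by
      intro v
      rw [← Finset.sum_range_add_sum_Ico _ hmn, ← Finset.sum_range_add_sum_Ico _ hmn,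
        add_sub_cancel_left, Finset.sum_eq_zero, zero_add]
      · exact Finset.sum_congr rfl fun k hk => by
          rw [if_neg (not_lt.2 (Finset.mem_Ico.1 hk).1)]
      · intro k hk
        rw [if_pos (Finset.mem_range.1 hk), zero_smul]
    have := hx (fun k => if k < m then 0 else a k) n
    rwa [key, key, ← dist_eq_norm, ← dist_eq_norm] at this
  have hcau : CauchySeq fun n => ∑ k ∈ Finset.range n, a k • x k := by
    rw [Metric.cauchySeq_iff']
    intro ε hε
    obtain ⟨m, hm⟩ := Metric.cauchySeq_iff'.1 ht.cauchySeq (ε / (C + 1)) (by positivity)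
    refine ⟨m, fun n hn => (hdiff m n hn).trans_lt ?_⟩
    have h := hm n hn
    rw [lt_div_iff₀ (by positivity)] at h
    nlinarith [@dist_nonneg _ _ (∑ k ∈ Finset.range n, a k • b k)
      (∑ k ∈ Finset.range m, a k • b k)]
  obtain ⟨s, hs⟩ := cauchySeq_tendsto_of_complete hcau
  exact ⟨s, hasSum_conditional_iff.2 hs,
    le_of_tendsto_of_tendsto' hs.norm (ht.norm.const_mul C) fun n => hx a n⟩

/-- If the operators `y ↦ ∑_{k < n} f_k(y) b_k` are uniformly bounded, they converge to a bounded
operator `A`, and weak* convergent series `∑ a_k b_k*` are mapped by the adjoint of `A` to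
`∑ a_k f_k`. -/
theorem weakStarDominated_of_bound [CompleteSpace E] (b : SchauderBasis ℝ E)
    {f : ℕ → StrongDual ℝ E} {C : ℝ} (hC : 0 ≤ C)
    (hf : ∀ (l : ℕ →₀ ℝ) (n : ℕ),
      ‖∑ k ∈ Finset.range n, f k (Finsupp.linearCombination ℝ b l) • b k‖ ≤
        C * ‖Finsupp.linearCombination ℝ b l‖)
    (h0 : ∀ j, ∃ n, ∀ k, n ≤ k → f k (b j) = 0) :
    WeakStarDominated C f b.coord ∧
      ∀ x : E, ∃ s : E, HasSum (fun k => f k x • b k) s (SummationFilter.conditional ℕ) := by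
  have hd := denseRange_linearCombination b
  let T : ℕ → E →L[ℝ] E := fun n => ∑ k ∈ Finset.range n, (f k).smulRight (b k)
  have hTa : ∀ n x, T n x = ∑ k ∈ Finset.range n, f k x • b k := fun n x => by
    simp [T]
  have hT : ∀ n x, ‖T n x‖ ≤ C * ‖x‖ := fun n => norm_le_of_dense hd (T n) (by
    rintro _ ⟨l, rfl⟩
    rw [hTa]
    exact hf l n)
  have hev : ∀ l : ℕ →₀ ℝ, ∃ n, ∀ k, n ≤ k → f k (Finsupp.linearCombination ℝ b l) = 0 := by
    intro l
    choose g hg using h0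
    refine ⟨l.support.sup g, fun k hk => ?_⟩
    rw [Finsupp.linearCombination_apply, Finsupp.sum, map_sum]
    refine Finset.sum_eq_zero fun j hj => ?_
    rw [map_smul, hg j k ((Finset.le_sup hj).trans hk), smul_zero]
  have hcau : ∀ x, CauchySeq fun n => T n x := cauchySeq_of_dense hd hC T hT (by
    rintro _ ⟨l, rfl⟩
    obtain ⟨n, hn⟩ := hev l
    refine (tendsto_atTop_of_eventually_const (x := T n (Finsupp.linearCombination ℝ b l))
      (i₀ := n) fun m hm => ?_).cauchySeq
    rw [hTa, hTa, ← Finset.sum_range_add_sum_Ico _ hm, add_eq_left]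
    exact Finset.sum_eq_zero fun k hk => by rw [hn k (Finset.mem_Ico.1 hk).1, zero_smul])
  choose A hA using fun x => cauchySeq_tendsto_of_complete (hcau x)
  have hA' : Filter.Tendsto (fun n x => T n x) Filter.atTop (nhds A) := tendsto_pi_nhds.2 hA
  refine ⟨fun a t ht => ?_, fun x => ⟨A x, ?_⟩⟩
  · let B : E →L[ℝ] E := continuousLinearMapOfTendsto T hA'
    have hB : ∀ x, Filter.Tendsto (fun n => T n x) Filter.atTop (nhds (B x)) := hA
    rw [hasWeakStarSum_iff] at ht
    have hta : ∀ k, t (b k) = a k := by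
      intro k
      refine tendsto_nhds_unique (ht (b k)) (tendsto_atTop_of_eventually_const (i₀ := k + 1)
        fun n hn => ?_)
      simp only [smul_apply, b.ortho, Pi.single_apply, smul_eq_mul, mul_ite,
        mul_one, mul_zero]
      rw [Finset.sum_ite_eq', if_pos (Finset.mem_range.2 hn)]
    refine ⟨t.comp B, hasWeakStarSum_iff.2 fun x => ?_, ?_⟩
    · refine ((t.continuous.tendsto _).comp (hB x)).congr fun n => ?_
      simp only [Function.comp, hTa, map_sum, map_smul, hta, smul_eq_mul,
        smul_apply]
      exact Finset.sum_congr rfl fun k _ => mul_comm _ _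
    · refine ContinuousLinearMap.opNorm_le_bound _ (by positivity) fun x => ?_
      have hBx : ‖B x‖ ≤ C * ‖x‖ := le_of_tendsto' (hB x).norm fun n => hT n x
      refine (t.le_opNorm (B x)).trans ((mul_le_mul_of_nonneg_left hBx (norm_nonneg t)).trans_eq ?_)
      ring
  · rw [hasSum_conditional_iff]
    exact (hA x).congr fun n => hTa n x

/-- Multiplication of the terms of a sum by a nondecreasing bounded sequence, estimated by means of
summation by parts. -/
theorem norm_sum_smul_le_of_monotone {v : ℕ → E} {m : ℕ → ℝ} (hm : Monotone m) {μ B : ℝ}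
    (h0 : 0 ≤ m 0) (hμ : ∀ k, m k ≤ μ) {n : ℕ}
    (hB : ∀ j ≤ n, ‖∑ k ∈ Finset.range j, v k‖ ≤ B) :
    ‖∑ k ∈ Finset.range n, m k • v k‖ ≤ (2 * μ - m 0) * B := by
  have hB0 : 0 ≤ B := (norm_nonneg _).trans (hB n le_rfl)
  rw [Finset.sum_range_by_parts]
  have h1 : ‖m (n - 1) • ∑ k ∈ Finset.range n, v k‖ ≤ m (n - 1) * B := by
    rw [norm_smul, Real.norm_of_nonneg (h0.trans (hm (Nat.zero_le _)))]
    exact mul_le_mul_of_nonneg_left (hB n le_rfl) (h0.trans (hm (Nat.zero_le _)))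
  have h2 : ‖∑ i ∈ Finset.range (n - 1), (m (i + 1) - m i) • ∑ k ∈ Finset.range (i + 1), v k‖ ≤
      (m (n - 1) - m 0) * B := by
    rw [← Finset.sum_range_sub, Finset.sum_mul]
    refine norm_sum_le_of_le _ fun i hi => ?_
    have hd : 0 ≤ m (i + 1) - m i := sub_nonneg.2 (hm (Nat.le_succ i))
    rw [norm_smul, Real.norm_of_nonneg hd]
    exact mul_le_mul_of_nonneg_left (hB _ (by have := Finset.mem_range.1 hi; omega)) hd
  refine (norm_sub_le _ _).trans ?_
  nlinarith [hμ (n - 1)]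

end Banach

/-! ### The Haar basis of a Haar system Hardy space -/

/-- The canonical map of `H` into `X(r)`. -/
def hardyEmb (N : HaarSystemNorm) (r : RademacherChoice) : haarSpan →ₗ[ℝ] HardySpace N r :=
  (UniformSpace.Completion.toComplₗᵢ (𝕜 := ℝ) (E := PreHardy N r)).toLinearMap.comp
    ({ toFun := fun x => x, map_add' := fun _ _ => rfl, map_smul' := fun _ _ => rfl } :
      haarSpan →ₗ[ℝ] PreHardy N r)

theorem norm_hardyEmb (N : HaarSystemNorm) (r : RademacherChoice) (x : haarSpan) :
    ‖hardyEmb N r x‖ = hardyNorm N r x :=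
  UniformSpace.Completion.norm_coe (E := PreHardy N r) x

theorem coe_haarVec₀ (N : HaarSystemNorm) (r : RademacherChoice) (k : ℕ) :
    (haarVec₀ N r k : HardySpace N r) = hardyEmb N r (haarElem (k + 1)) := rfl

theorem norm_sum_haarVec₀ (N : HaarSystemNorm) (r : RademacherChoice) {ι : Type*} (F : Finset ι)
    (c : ι → ℝ) (n : ι → ℕ) : ‖∑ k ∈ F, c k • haarVec₀ N r (n k)‖ =
      hardyNorm N r (∑ k ∈ F, c k • haarElem (n k + 1)) := by
  change ‖((∑ k ∈ F, c k • haarVec₀ N r (n k) : HardySpace₀ N r) : HardySpace N r)‖ = _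
  rw [← norm_hardyEmb, map_sum, Submodule.coe_sum]
  simp only [Submodule.coe_smul, coe_haarVec₀, map_smul]

/-- The random average of `h_q` is `|h_q|`, because the Rademacher functions have modulus `1`. -/
theorem hardyNorm_haarElem_pos (N : HaarSystemNorm) (r : RademacherChoice) (q : ℕ) :
    0 < hardyNorm N r (haarElem q) := by
  refine lt_of_le_of_ne (apply_nonneg _ _) fun h => ?_
  have h0 := N.eq_zero_of_map_eq_zero _ h.symm
  have hs : ∃ s ∈ Set.Ico (0 : ℝ) 1, haar q s ≠ 0 := by
    rcases Nat.eq_zero_or_pos q with rfl | hq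
    · exact ⟨0, by simp, by rw [haar_zero_apply (by simp)]; norm_num⟩
    · obtain ⟨n, rfl⟩ := Nat.exists_eq_succ_of_ne_zero hq.ne'
      exact ⟨_, left_end_mem (log_index n), by rw [Nat.succ_eq_add_one, haar_self_left]; norm_num⟩
  obtain ⟨s, -, hs⟩ := hs
  have h1 : randomAverage r (haarElem q) s = |haar q s| := by
    have hr : ∀ u ∈ Set.Ioo (0 : ℝ) 1, |randomSum r (haarElem q) u s| = |haar q s| := by
      intro u hu
      change |randomSumLin r u s (haarElem q)| = _
      rw [randomSumLin_haarElem, abs_mul]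
      have : |r.seq q u| = 1 := by
        have hu : u ∈ Set.Ico (0 : ℝ) 1 := ⟨hu.1.le, hu.2⟩
        cases r with
        | independent => rcases rademacher_eq_or (n := q) hu with h | h <;>
            simp [RademacherChoice.seq, h]
        | constant => rcases rademacher_eq_or (n := 0) hu with h | h <;>
            simp [RademacherChoice.seq, h]
      rw [this, one_mul]
    rw [randomAverage, intervalIntegral.integral_of_le zero_le_one, integral_Ioc_eq_integral_Ioo,
      setIntegral_congr_fun measurableSet_Ioo hr]
    simp
  have h2 : randomAverage r (haarElem q) s = 0 := congrFun (congrArg Subtype.val h0) s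
  rw [h2] at h1
  exact hs (abs_eq_zero.1 h1.symm)

theorem norm_haarVec₀ (N : HaarSystemNorm) (r : RademacherChoice) (k : ℕ) :
    ‖haarVec₀ N r k‖ = hardyNorm N r (haarElem (k + 1)) := norm_hardyEmb N r _

theorem norm_haarVec₀_pos (N : HaarSystemNorm) (r : RademacherChoice) (k : ℕ) :
    0 < ‖haarVec₀ N r k‖ := by
  rw [norm_haarVec₀]
  exact hardyNorm_haarElem_pos N r _

/-- The partial sums of a Haar series without the term `h_∅`, as sums over heap indices. -/
theorem sum_shift (c : ℕ → ℝ) (n : ℕ) (x : ℕ → haarSpan) :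
    ∑ k ∈ Finset.range n, c k • x (k + 1) =
      ∑ q ∈ Finset.range (n + 1), (if q = 0 then 0 else c (q - 1)) • x q := by
  rw [Finset.sum_range_succ']
  simp

theorem norm_partialSum_haarVec₀_le (N : HaarSystemNorm) (r : RademacherChoice) (a : ℕ → ℝ)
    {n m : ℕ} (h : n ≤ m) :
    ‖∑ k ∈ Finset.range n, a k • haarVec₀ N r k‖ ≤
      ‖∑ k ∈ Finset.range m, a k • haarVec₀ N r k‖ := by
  rw [norm_sum_haarVec₀ N r _ a fun k => k, norm_sum_haarVec₀ N r _ a fun k => k,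
    sum_shift a n haarElem, sum_shift a m haarElem]
  exact hardyNorm_partialSum_le N r (by omega) _

theorem denseRange_haarVec₀ (N : HaarSystemNorm) (r : RademacherChoice) :
    DenseRange (Finsupp.linearCombination ℝ
      fun k => ‖haarVec₀ N r k‖⁻¹ • haarVec₀ N r k) := by
  intro x
  rw [closure_subtype]
  refine closure_mono ?_ x.2
  intro y hy
  rw [SetLike.mem_coe] at hy
  induction hy using Submodule.span_induction with
  | mem y hy =>
    obtain ⟨k, rfl⟩ := hy
    refine ⟨haarVec₀ N r k, ⟨Finsupp.single k ‖haarVec₀ N r k‖, ?_⟩, rfl⟩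
    rw [Finsupp.linearCombination_single, smul_smul,
      mul_inv_cancel₀ (norm_haarVec₀_pos N r k).ne', one_smul]
  | zero => exact ⟨0, ⟨0, map_zero _⟩, rfl⟩
  | add y z _ _ hy hz =>
    obtain ⟨_, ⟨l, rfl⟩, rfl⟩ := hy
    obtain ⟨_, ⟨l', rfl⟩, rfl⟩ := hz
    exact ⟨_, ⟨l + l', map_add _ _ _⟩, rfl⟩
  | smul c y _ hy =>
    obtain ⟨_, ⟨l, rfl⟩, rfl⟩ := hy
    exact ⟨_, ⟨c • l, map_smul _ _ _⟩, rfl⟩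

instance (N : HaarSystemNorm) (r : RademacherChoice) : CompleteSpace (HardySpace₀ N r) :=
  (Submodule.isClosed_topologicalClosure _).completeSpace_coe

theorem exists_haar_schauderBasis (N : HaarSystemNorm) (r : RademacherChoice) :
    ∃ b : SchauderBasis ℝ (HardySpace₀ N r),
      ∀ k, b k = ‖haarVec₀ N r k‖⁻¹ • haarVec₀ N r k := by
  refine exists_schauderBasis (fun k => ?_) (denseRange_haarVec₀ N r) fun a n m h => ?_
  · have h := norm_haarVec₀_pos N r k
    exact smul_ne_zero (inv_ne_zero h.ne') (norm_pos_iff.1 h)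
  · simp only [smul_smul]
    exact norm_partialSum_haarVec₀_le N r _ h

/-! ### Choosing families of dyadic intervals of prescribed total length -/

theorem node_subset_of_mem {p q : ℕ} (hp : p ≠ 0) (hq : q ≠ 0) (h : Nat.log 2 p ≤ Nat.log 2 q)
    {s : ℝ} (hsp : s ∈ node p) (hsq : s ∈ node q) : node q ⊆ node p := by
  intro t ht
  rw [mem_node hp] at hsp ⊢
  rw [mem_node hq] at hsq ht
  have e1 := floor_of_le h s
  have e2 := floor_of_le h t
  have : ⌊(2 : ℝ) ^ Nat.log 2 q * s⌋₊ = ⌊(2 : ℝ) ^ Nat.log 2 q * t⌋₊ := by omega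
  rw [← this, ← e1] at e2
  exact ⟨ht.1, by rw [e2]; exact hsp.2⟩

theorem measurableSet_node (q : ℕ) : MeasurableSet (node q) := measurableSet_dyadicInterval _ _

theorem volume_node (q : ℕ) : volume.real (node q) = (wt q)⁻¹ := by
  rw [node, Measure.real, volume_dyadicInterval, ENNReal.toReal_ofReal (by positivity), wt, one_div]

theorem node_ne_top {A : Set ℝ} (h : A ⊆ Set.Ico (0 : ℝ) 1) : volume A ≠ ⊤ :=
  ne_top_of_le_ne_top (by simp) (measure_mono h)

theorem wt_two_mul {q : ℕ} (hq : q ≠ 0) : wt (2 * q) = 2 * wt q := by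
  rw [wt, wt, log_two_mul hq, pow_succ, mul_comm]

theorem wt_two_mul_add_one {q : ℕ} (hq : q ≠ 0) : wt (2 * q + 1) = 2 * wt q := by
  rw [wt, wt, log_two_mul_add_one hq, pow_succ, mul_comm]

/-- The members of a finite family of dyadic intervals that are not contained in earlier ones are
disjoint and have the same union. -/
theorem exists_disjoint_subfamily (F : Finset ℕ) (hF : ∀ q ∈ F, q ≠ 0) :
    ∃ F' ⊆ F, (F' : Set ℕ).PairwiseDisjoint node ∧ ⋃ q ∈ F', node q = ⋃ q ∈ F, node q := by
  classical
  refine ⟨F.filter fun q => ∀ p ∈ F, p < q → Disjoint (node p) (node q), Finset.filter_subset _ _,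
    ?_, ?_⟩
  · intro p hp q hq hne
    rw [Finset.mem_coe, Finset.mem_filter] at hp hq
    rcases Nat.lt_or_gt_of_ne hne with h | h
    · exact hq.2 p hp.1 h
    · exact (hp.2 q hq.1 h).symm
  · refine Set.Subset.antisymm
      (Set.biUnion_subset_biUnion_left fun q hq => (Finset.mem_filter.1 hq).1) fun s hs => ?_
    have hex : ∃ q, q ∈ F ∧ s ∈ node q := by simpa using hs
    obtain ⟨h1, h2⟩ := Nat.find_spec hex
    refine Set.mem_biUnion (Finset.mem_coe.2 (Finset.mem_filter.2 ⟨h1, fun p hp hlt => ?_⟩)) h2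
    rw [Set.disjoint_left]
    intro t htp htq
    exact Nat.find_min hex hlt ⟨hp, node_subset_of_mem (hF p hp) (hF _ h1)
      (Nat.log_mono_right hlt.le) htp htq h2⟩

/-- `exists_subset_sum_eq` for lengths between `2 ^ (-m - d)` and `2 ^ (-m)`, by induction on `d`:
the intervals of maximal length are used up first. -/
theorem exists_subset_sum_eq_aux {ι : Type*} (l : ι → ℕ) (d : ℕ) : ∀ (m c : ℕ) (F : Finset ι),
    (∀ i ∈ F, m ≤ l i ∧ l i ≤ m + d) → (c : ℝ) / 2 ^ m ≤ ∑ i ∈ F, ((2 : ℝ) ^ l i)⁻¹ →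
      ∃ F' ⊆ F, ∑ i ∈ F', ((2 : ℝ) ^ l i)⁻¹ = c / 2 ^ m := by
  classical
  have hconst : ∀ (m : ℕ) (F : Finset ι), (∀ i ∈ F, l i = m) →
      ∑ i ∈ F, ((2 : ℝ) ^ l i)⁻¹ = F.card / 2 ^ m := fun m F h => by
    rw [Finset.sum_congr rfl fun i hi => by rw [h i hi], Finset.sum_const, nsmul_eq_mul,
      div_eq_mul_inv]
  have hcard : ∀ (m c : ℕ) (F : Finset ι), (∀ i ∈ F, l i = m) → c ≤ F.card →
      ∃ F' ⊆ F, ∑ i ∈ F', ((2 : ℝ) ^ l i)⁻¹ = c / 2 ^ m := fun m c F h hc => by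
    obtain ⟨F', hF', hc'⟩ := Finset.exists_subset_card_eq hc
    exact ⟨F', hF', by rw [hconst m F' fun i hi => h i (hF' hi), hc']⟩
  induction d with
  | zero =>
    intro m c F hF hc
    have hF' : ∀ i ∈ F, l i = m := fun i hi => by have := hF i hi; omega
    rw [hconst m F hF', div_le_div_iff_of_pos_right (by positivity)] at hc
    exact hcard m c F hF' (by exact_mod_cast hc)
  | succ d ih =>
    intro m c F hF hc
    set F₀ := F.filter fun i => l i = m with hF₀
    set F₁ := F.filter fun i => ¬l i = m with hF₁
    have h0 : ∀ i ∈ F₀, l i = m := fun i hi => (Finset.mem_filter.1 hi).2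
    rcases le_or_gt c F₀.card with h | h
    · obtain ⟨F', hF', h'⟩ := hcard m c F₀ h0 h
      exact ⟨F', hF'.trans (Finset.filter_subset _ _), h'⟩
    · obtain ⟨c', rfl⟩ := Nat.exists_eq_add_of_le h.le
      rw [← Finset.sum_filter_add_sum_filter_not F (fun i => l i = m), ← hF₀, ← hF₁,
        hconst m F₀ h0] at hc
      obtain ⟨F', hF', h'⟩ := ih (m + 1) (2 * c') F₁ (fun i hi => by
        have h1 := Finset.mem_filter.1 hi
        have h2 := hF i h1.1
        omega) (by
          push_cast at hc ⊢
          rw [add_div] at hc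
          rw [pow_succ, mul_comm (2 : ℝ) c', mul_div_mul_right _ _ two_ne_zero]
          linarith)
      refine ⟨F₀ ∪ F', Finset.union_subset (Finset.filter_subset _ _)
        (hF'.trans (Finset.filter_subset _ _)), ?_⟩
      rw [Finset.sum_union, hconst m F₀ h0, h']
      · push_cast
        rw [pow_succ, mul_comm (2 : ℝ) c', mul_div_mul_right _ _ two_ne_zero, add_div]
      · exact Finset.disjoint_of_subset_right hF' (Finset.disjoint_filter_filter_not _ _ _)

/-- Among finitely many dyadic lengths, each at most `2 ^ (-m)`, with sum at least `c 2 ^ (-m)`,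
there are some whose sum is exactly `c 2 ^ (-m)`. -/
theorem exists_subset_sum_eq {ι : Type*} (l : ι → ℕ) {m c : ℕ} {F : Finset ι}
    (hF : ∀ i ∈ F, m ≤ l i) (hc : (c : ℝ) / 2 ^ m ≤ ∑ i ∈ F, ((2 : ℝ) ^ l i)⁻¹) :
    ∃ F' ⊆ F, ∑ i ∈ F', ((2 : ℝ) ^ l i)⁻¹ = c / 2 ^ m :=
  exists_subset_sum_eq_aux l (F.sup l) m c F
    (fun i hi => ⟨hF i hi, (Finset.le_sup hi).trans (Nat.le_add_left _ _)⟩) hc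

/-! ### Points covered by arbitrarily short intervals -/

/-- The union of the dyadic intervals of length at most `2 ^ (-m)` with (shifted) index in `M`. -/
def cover (M : Set ℕ) (m : ℕ) : Set ℝ := ⋃ j ∈ {j | j ∈ M ∧ m ≤ Nat.log 2 (j + 1)}, node (j + 1)

/-- The set of points that lie in arbitrarily short dyadic intervals with index in `M`. -/
def limitSet (M : Set ℕ) : Set ℝ := ⋂ m, cover M m

theorem cover_subset (M : Set ℕ) (m : ℕ) : cover M m ⊆ Set.Ico (0 : ℝ) 1 :=
  Set.iUnion₂_subset fun _ _ => node_subset_unit (by omega)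

theorem measurableSet_cover (M : Set ℕ) (m : ℕ) : MeasurableSet (cover M m) :=
  MeasurableSet.biUnion (Set.to_countable _) fun _ _ => measurableSet_node _

theorem measurableSet_limitSet (M : Set ℕ) : MeasurableSet (limitSet M) :=
  MeasurableSet.iInter (measurableSet_cover M)

theorem antitone_cover (M : Set ℕ) : Antitone (cover M) := fun _ _ h =>
  Set.biUnion_subset_biUnion_left fun _ hj => ⟨hj.1, h.trans hj.2⟩

theorem tendsto_volume_cover (M : Set ℕ) : Filter.Tendsto (fun m => volume.real (cover M m))
    Filter.atTop (nhds (volume.real (limitSet M))) := by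
  have h := tendsto_measure_iInter_atTop (μ := volume)
    (fun m => (measurableSet_cover M m).nullMeasurableSet) (antitone_cover M)
    ⟨0, node_ne_top (cover_subset M 0)⟩
  exact (ENNReal.tendsto_toReal (node_ne_top
    ((Set.iInter_subset _ 0).trans (cover_subset M 0)))).comp h

theorem cover_union (N₁ N₂ : Set ℕ) (h : N₁ ∪ N₂ = Set.univ) (m : ℕ) :
    cover N₁ m ∪ cover N₂ m = Set.Ico (0 : ℝ) 1 := by
  refine Set.Subset.antisymm (Set.union_subset (cover_subset _ _) (cover_subset _ _)) fun s hs => ?_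
  have hn := nodeAt_ne_zero m s
  have hlog := log_nodeAt (n := m) hs
  have hmem : s ∈ node (nodeAt m s) := by rw [mem_node_iff_nodeAt hn hs.1, hlog]
  have e : nodeAt m s - 1 + 1 = nodeAt m s := by omega
  have hM : nodeAt m s - 1 ∈ N₁ ∪ N₂ := h ▸ Set.mem_univ _
  rcases hM with h1 | h1
  · exact Or.inl (Set.mem_biUnion (show _ ∈ {j | j ∈ N₁ ∧ m ≤ Nat.log 2 (j + 1)} from
      ⟨h1, by rw [e, hlog]⟩) (by rwa [e]))
  · exact Or.inr (Set.mem_biUnion (show _ ∈ {j | j ∈ N₂ ∧ m ≤ Nat.log 2 (j + 1)} from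
      ⟨h1, by rw [e, hlog]⟩) (by rwa [e]))

/-- For one of two sets that cover all indices, the limit set fills at least half of `[0, 1)`. -/
theorem exists_half_le_volume_limitSet (N₁ N₂ : Set ℕ) (h : N₁ ∪ N₂ = Set.univ) :
    ∃ M : Set ℕ, (M = N₁ ∨ M = N₂) ∧ 1 / 2 ≤ volume.real (limitSet M) := by
  have h1 : 1 ≤ volume.real (limitSet N₁) + volume.real (limitSet N₂) := by
    refine ge_of_tendsto' ((tendsto_volume_cover N₁).add (tendsto_volume_cover N₂)) fun m => ?_
    have := measureReal_union_le (μ := volume) (cover N₁ m) (cover N₂ m)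
    rw [cover_union N₁ N₂ h] at this
    simpa using this
  by_cases h2 : 1 / 2 ≤ volume.real (limitSet N₁)
  · exact ⟨N₁, Or.inl rfl, h2⟩
  · exact ⟨N₂, Or.inr rfl, by linarith⟩

/-- In a finite union `U` of dyadic intervals, finitely many disjoint dyadic intervals with indices
in `M` can be chosen such that their total length has any prescribed dyadic value less than the
measure of the part of the limit set in `U`, and their union is almost contained in the limit
set. -/
theorem exists_family (M : Set ℕ) {U : Set ℝ} {S : Finset ℕ} (hS : ∀ i ∈ S, i ≠ 0)
    (hU : U = ⋃ i ∈ S, node i) {c m₀ : ℕ}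
    (hG : (c : ℝ) / 2 ^ m₀ < volume.real (U ∩ limitSet M)) {δ : ℝ} (hδ : 0 < δ) (L : ℕ) :
    ∃ F : Finset ℕ, (F : Set ℕ) ⊆ M ∧ (∀ j ∈ F, L < j) ∧ (∀ j ∈ F, node (j + 1) ⊆ U) ∧
      (F : Set ℕ).PairwiseDisjoint (fun j => node (j + 1)) ∧
      ∑ j ∈ F, (wt (j + 1))⁻¹ = c / 2 ^ m₀ ∧
      volume.real ((⋃ j ∈ F, node (j + 1)) \ limitSet M) ≤ δ := by
  classical
  have hUu : U ⊆ Set.Ico (0 : ℝ) 1 := by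
    rw [hU]
    exact Set.iUnion₂_subset fun i hi => node_subset_unit (hS i hi)
  -- All intervals will have length at most `2 ^ (-m)`: then they lie in `U` as soon as they meet
  -- it, and as `log₂ (j + 1) ≤ j`, their indices exceed `L`.
  obtain ⟨m, hm, hmS⟩ : ∃ m, volume.real (cover M m) ≤ volume.real (limitSet M) + δ ∧
      m₀ + (L + 2) + S.sup (Nat.log 2) ≤ m :=
    (((tendsto_volume_cover M).eventually_le_const (by linarith)).and
      (Filter.eventually_ge_atTop _)).exists
  -- By continuity from below, the intervals with index less than some `R` suffice.
  let W : ℕ → Set ℝ := fun R =>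
    ⋃ j ∈ (Finset.range R).filter fun j => j ∈ M ∧ m ≤ Nat.log 2 (j + 1), node (j + 1)
  have hWm : Monotone fun R => U ∩ W R := fun R R' h =>
    Set.inter_subset_inter_right _ (Set.biUnion_subset_biUnion_left fun j hj => by
      rw [Finset.mem_coe, Finset.mem_filter, Finset.mem_range] at hj ⊢
      exact ⟨hj.1.trans_le h, hj.2⟩)
  have hWU : ⋃ R, U ∩ W R = U ∩ cover M m := by
    rw [← Set.inter_iUnion]
    congr 1
    ext s
    simp only [W, cover, Set.mem_iUnion, Finset.mem_filter, Finset.mem_range, exists_prop,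
      Set.mem_ofPred_eq]
    constructor
    · rintro ⟨R, j, ⟨-, h⟩, hs⟩
      exact ⟨j, h, hs⟩
    · rintro ⟨j, h, hs⟩
      exact ⟨j + 1, j, ⟨Nat.lt_succ_self j, h⟩, hs⟩
  have hlt : (c : ℝ) / 2 ^ m₀ < volume.real (U ∩ cover M m) :=
    hG.trans_le (measureReal_mono (Set.inter_subset_inter_right _ (Set.iInter_subset _ m))
      (node_ne_top (Set.inter_subset_left.trans hUu)))
  obtain ⟨R, hR⟩ : ∃ R, (c : ℝ) / 2 ^ m₀ < volume.real (U ∩ W R) := by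
    have h := tendsto_measure_iUnion_atTop (μ := volume) hWm
    rw [hWU] at h
    exact (((ENNReal.tendsto_toReal (node_ne_top (Set.inter_subset_left.trans hUu))).comp
      h).eventually_const_lt hlt).exists
  let F₀ := (Finset.range (R + 1)).filter fun q =>
    q ≠ 0 ∧ q - 1 ∈ M ∧ m ≤ Nat.log 2 q ∧ node q ⊆ U
  have hF₀ : U ∩ W R ⊆ ⋃ q ∈ F₀, node q := by
    rintro s ⟨hsU, hs⟩
    simp only [W, Set.mem_iUnion, Finset.mem_filter, Finset.mem_range, exists_prop] at hs
    obtain ⟨j, ⟨hjR, hjM, hjm⟩, hsj⟩ := hs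
    rw [hU] at hsU
    simp only [Set.mem_iUnion, exists_prop] at hsU
    obtain ⟨i, hi, hsi⟩ := hsU
    have hle : Nat.log 2 i ≤ S.sup (Nat.log 2) := Finset.le_sup hi
    refine Set.mem_biUnion (Finset.mem_coe.2 (Finset.mem_filter.2 ⟨Finset.mem_range.2
      (Nat.succ_lt_succ hjR), Nat.succ_ne_zero j, hjM, hjm, ?_⟩)) hsj
    rw [hU]
    exact (node_subset_of_mem (hS i hi) (show j + 1 ≠ 0 by omega) (by omega) hsi hsj).trans
      (Set.subset_biUnion_of_mem (u := fun i => node i) hi)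
  obtain ⟨F₁, hF₁, hdisj, hun⟩ := exists_disjoint_subfamily F₀
    fun q hq => (Finset.mem_filter.1 hq).2.1
  have hmem : ∀ q ∈ F₁, q ≠ 0 ∧ q - 1 ∈ M ∧ m ≤ Nat.log 2 q ∧ node q ⊆ U := fun q hq =>
    (Finset.mem_filter.1 (hF₁ hq)).2
  have hvol : volume.real (⋃ q ∈ F₁, node q) = ∑ q ∈ F₁, ((2 : ℝ) ^ Nat.log 2 q)⁻¹ := by
    rw [measureReal_biUnion_finset hdisj (fun q _ => measurableSet_node q)
      (fun q hq => node_ne_top (node_subset_unit (hmem q hq).1))]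
    exact Finset.sum_congr rfl fun q _ => volume_node q
  have hc : ((c * 2 ^ (m - m₀) : ℕ) : ℝ) / 2 ^ m = c / 2 ^ m₀ := by
    have : (2 : ℝ) ^ m = 2 ^ m₀ * 2 ^ (m - m₀) := by rw [← pow_add]; congr 1; omega
    rw [this]
    push_cast
    rw [mul_div_mul_right _ _ (by positivity)]
  obtain ⟨F₂, hF₂, hsum⟩ := exists_subset_sum_eq (Nat.log 2) (m := m) (c := c * 2 ^ (m - m₀))
    (F := F₁) (fun q hq => (hmem q hq).2.2.1) (by
      rw [hc, ← hvol, hun]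
      exact hR.le.trans (measureReal_mono hF₀ (node_ne_top (Set.iUnion₂_subset fun q hq =>
        node_subset_unit (Finset.mem_filter.1 hq).2.1))))
  rw [hc] at hsum
  have hsucc : ∀ j, j ∈ F₂.preimage Nat.succ Nat.succ_injective.injOn ↔ j + 1 ∈ F₂ := fun j =>
    Finset.mem_preimage
  refine ⟨F₂.preimage Nat.succ Nat.succ_injective.injOn, fun j hj => ?_, fun j hj => ?_,
    fun j hj => ?_, fun j hj j' hj' hne => ?_, ?_, ?_⟩
  · exact (hmem _ (hF₂ ((hsucc j).1 hj))).2.1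
  · have h := (hmem _ (hF₂ ((hsucc j).1 hj))).2.2.1
    have h1 : Nat.log 2 (j + 1) ≤ j := Nat.lt_succ_iff.1 (Nat.log_lt_self 2 (by omega))
    omega
  · exact (hmem _ (hF₂ ((hsucc j).1 hj))).2.2.2
  · exact hdisj (hF₂ ((hsucc j).1 hj)) (hF₂ ((hsucc j').1 hj')) (by omega)
  · rw [← hsum]
    refine Finset.sum_preimage Nat.succ F₂ Nat.succ_injective.injOn
      (fun q => ((2 : ℝ) ^ Nat.log 2 q)⁻¹) fun q hq hq' => ?_
    exact absurd ⟨q - 1, Nat.succ_pred_eq_of_ne_zero (hmem q (hF₂ hq)).1⟩ hq'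
  · have hsub : (⋃ j ∈ F₂.preimage Nat.succ Nat.succ_injective.injOn, node (j + 1)) ⊆ cover M m :=
      Set.iUnion₂_subset fun j hj => by
        have h := hmem _ (hF₂ ((hsucc j).1 hj))
        exact Set.subset_biUnion_of_mem (u := fun j => node (j + 1))
          (show j ∈ {j | j ∈ M ∧ m ≤ Nat.log 2 (j + 1)} from ⟨h.2.1, h.2.2.1⟩)
    have h1 := measureReal_mono (μ := volume) (Set.sdiff_subset_sdiff_left (t := limitSet M) hsub)
      (node_ne_top (Set.sdiff_subset.trans (cover_subset M m)))
    rw [measureReal_sdiff (show limitSet M ⊆ cover M m from Set.iInter_subset _ m)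
      (measurableSet_limitSet M)
      (node_ne_top (cover_subset M m))] at h1
    linarith

/-! ### The strategy of the first player -/

/-- The total length `density e q`, relative to the length of the interval with heap index `q`, of
the intervals of the block with index `q`.  It decreases to `1 / 2 - 2 ^ (-e)`; the strict decrease
leaves room for the part of earlier blocks that lies outside the limit set. -/
def density (e q : ℕ) : ℝ := 1 / 2 - 1 / 2 ^ e + 1 / 2 ^ (e + q)

/-- The measure that the intervals of the block with index `q` may have outside the limit set. -/
def defect (e q : ℕ) : ℝ := 1 / 2 ^ (e + 2 * q + 2)

theorem density_antitone (e : ℕ) : Antitone (density e) := fun q q' h => by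
  unfold density
  have : (1 : ℝ) / 2 ^ (e + q') ≤ 1 / 2 ^ (e + q) :=
    one_div_le_one_div_of_le (by positivity) (pow_le_pow_right₀ one_le_two (by omega))
  linarith

theorem lt_density (e q : ℕ) : 1 / 2 - 1 / 2 ^ e < density e q :=
  lt_add_of_pos_right _ (by positivity)

theorem density_pos {e : ℕ} (he : 2 ≤ e) (q : ℕ) : 0 < density e q := by
  have h1 := lt_density e q
  have h2 : (1 : ℝ) / 2 ^ e ≤ 1 / 2 ^ 2 :=
    one_div_le_one_div_of_le (by positivity) (pow_le_pow_right₀ one_le_two he)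
  norm_num at h2
  norm_num at h1
  linarith

theorem density_one_lt {e : ℕ} : density e 1 < 1 / 2 := by
  have : (1 : ℝ) / 2 ^ (e + 1) = 1 / 2 ^ e / 2 := by rw [pow_succ]; field_simp
  have h2 : (0 : ℝ) < 1 / 2 ^ e := by positivity
  rw [density, this]
  linarith

/-- The total length of the intervals of a block is a dyadic rational, so that it can be attained
exactly by finitely many dyadic intervals. -/
theorem density_div_wt {e : ℕ} (he : 2 ≤ e) (q : ℕ) :
    ∃ c m : ℕ, density e q / wt q = c / 2 ^ m := by
  refine ⟨2 ^ (e + q - 1) + 1 - 2 ^ q, e + q + Nat.log 2 q, ?_⟩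
  have h1 : 2 ^ q ≤ 2 ^ (e + q - 1) + 1 :=
    (Nat.pow_le_pow_right two_pos (by omega)).trans (Nat.le_succ _)
  have h2 : (2 : ℝ) ^ (e + q) = 2 * 2 ^ (e + q - 1) := by rw [← pow_succ']; congr 1; omega
  have h3 : (1 : ℝ) / 2 ^ e = 2 ^ q / 2 ^ (e + q) := by rw [pow_add]; field_simp
  have h4 : (1 : ℝ) / 2 = 2 ^ (e + q - 1) / 2 ^ (e + q) := by rw [h2]; field_simp
  push_cast [Nat.cast_sub h1]
  rw [density, h3, h4, wt, pow_add 2 (e + q), ← sub_div, ← add_div, div_div]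
  ring

/-- Half of the block with index `p`, without its part outside the limit set, has more than the
measure that is needed for the blocks with indices `2 * p` and `2 * p + 1`. -/
theorem density_div_wt_lt {e p q : ℕ} (hp : p ≠ 0) (hpq : q = 2 * p ∨ q = 2 * p + 1) :
    density e q / wt q < density e p / wt p / 2 - defect e p := by
  have hw : wt q = 2 * wt p := by
    rcases hpq with rfl | rfl
    · exact wt_two_mul hp
    · exact wt_two_mul_add_one hp
  have hwp : wt p < 2 ^ p := pow_lt_pow_right₀ one_lt_two (Nat.log_lt_self 2 hp)
  have hw0 := wt_pos p
  have h1 : density e q ≤ density e p - 1 / 2 ^ (e + p + 1) := by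
    refine (density_antitone e (show p + 1 ≤ q by omega)).trans_eq ?_
    rw [density, density, ← add_assoc e p 1, pow_succ 2 (e + p)]
    field_simp
    ring
  have h2 : defect e p < 1 / 2 ^ (e + p + 1) / (2 * wt p) := by
    rw [defect, div_div]
    refine one_div_lt_one_div_of_lt (by positivity) ?_
    rw [show e + 2 * p + 2 = (e + p + 1) + (p + 1) by ring, pow_add 2 (e + p + 1), pow_succ 2 p]
    refine mul_lt_mul_of_pos_left ?_ (by positivity)
    linarith
  have h3 : density e q / wt q ≤ (density e p - 1 / 2 ^ (e + p + 1)) / (2 * wt p) := by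
    rw [hw]
    exact div_le_div_of_nonneg_right h1 (by positivity)
  rw [sub_div] at h3
  rw [div_div, mul_comm (wt p)]
  linarith

/-- The sign with index `j` chosen in a turn, with the junk value `1` outside the support. -/
def Turn.sgn (t : Turn) (j : ℕ) : ℝ :=
  if h : j ∈ t.move.supp then ((t.sign ⟨j, h⟩ : ℤ) : ℝ) else 1

theorem Turn.sgn_eq (t : Turn) (j : ℕ) : t.sgn j = 1 ∨ t.sgn j = -1 := by
  unfold Turn.sgn
  split_ifs with h
  · rcases Int.units_eq_one_or (t.sign ⟨j, h⟩) with h | h <;> simp [h]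
  · exact Or.inl rfl

/-- The signed block of Haar functions chosen in a turn. -/
def Turn.fn (t : Turn) (s : ℝ) : ℝ := ∑ j ∈ t.move.supp, t.sgn j * haar (j + 1) s

/-- The heap index of the half of the interval with heap index `j + 1` on which the block of the
turn has the value `ε`, where `ε = ±1`. -/
def Turn.half (t : Turn) (ε : ℝ) (j : ℕ) : ℕ :=
  if t.sgn j = ε then 2 * (j + 1) else 2 * (j + 1) + 1

theorem Turn.half_ne_zero (t : Turn) (ε : ℝ) (j : ℕ) : t.half ε j ≠ 0 := by
  unfold Turn.half
  split_ifs <;> omega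

theorem Turn.node_half_subset (t : Turn) (ε : ℝ) (j : ℕ) : node (t.half ε j) ⊆ node (j + 1) := by
  rw [← node_two_mul_union (show j + 1 ≠ 0 by omega), Turn.half]
  split_ifs
  exacts [Set.subset_union_left, Set.subset_union_right]

theorem Turn.wt_half (t : Turn) (ε : ℝ) (j : ℕ) : wt (t.half ε j) = 2 * wt (j + 1) := by
  unfold Turn.half
  split_ifs
  exacts [wt_two_mul (by omega), wt_two_mul_add_one (by omega)]

theorem Turn.mem_node_half (t : Turn) {ε : ℝ} (hε : ε = 1 ∨ ε = -1) (j : ℕ) (s : ℝ) :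
    s ∈ node (t.half ε j) ↔ t.sgn j * haar (j + 1) s = ε := by
  have hj : j + 1 ≠ 0 := by omega
  rw [Turn.half]
  split_ifs with h
  · rw [← haar_eq_one_iff hj, ← h]
    rcases t.sgn_eq j with h1 | h1 <;> rw [h1] <;> constructor <;> intro h2 <;> linarith
  · rw [← haar_eq_neg_one_iff hj]
    have : t.sgn j = -ε := by
      rcases t.sgn_eq j with h1 | h1 <;> rcases hε with h2 | h2 <;>
        first | exact absurd (h1.trans h2.symm) h | simp [h1, h2]
    rw [this]
    rcases hε with h1 | h1 <;> rw [h1] <;> constructor <;> intro h2 <;> linarith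

theorem Turn.setOf_fn_eq (t : Turn)
    (hd : (t.move.supp : Set ℕ).PairwiseDisjoint fun j => node (j + 1)) {ε : ℝ}
    (hε : ε = 1 ∨ ε = -1) : {s | t.fn s = ε} = ⋃ j ∈ t.move.supp, node (t.half ε j) := by
  have hterm : ∀ j ∈ t.move.supp, ∀ s ∈ node (j + 1), t.fn s = t.sgn j * haar (j + 1) s := by
    intro j hj s hs
    refine Finset.sum_eq_single j (fun j' hj' hne => ?_) (fun h => absurd hj h)
    by_contra h
    exact Set.disjoint_left.1 (hd hj hj' hne.symm) hs
      ((haar_ne_zero_iff (by omega)).1 (right_ne_zero_of_mul h))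
  ext s
  simp only [Set.mem_ofPred_eq, Set.mem_iUnion, exists_prop]
  constructor
  · intro h
    have h0 : t.fn s ≠ 0 := by rw [h]; rcases hε with h | h <;> rw [h] <;> norm_num
    obtain ⟨j, hj, hjs⟩ := Finset.exists_ne_zero_of_sum_ne_zero h0
    have hs := (haar_ne_zero_iff (by omega)).1 (right_ne_zero_of_mul hjs)
    exact ⟨j, hj, (t.mem_node_half hε j s).2 ((hterm j hj s hs).symm.trans h)⟩
  · rintro ⟨j, hj, hs⟩
    rw [hterm j hj s (t.node_half_subset ε j hs)]
    exact (t.mem_node_half hε j s).1 hs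

/-- The set in which the block chosen in turn `k` has to be supported.  The block of turn `k` has
heap index `k + 1`; its support lies in one of the two level sets of the block with index
`(k + 1) / 2`. -/
def parentRegion (p : ℕ → Turn) (k : ℕ) : Set ℝ :=
  if k = 0 then node 1 else {s | (p ((k + 1) / 2 - 1)).fn s = if Even (k + 1) then 1 else -1}

/-- The choice of `F` as the finite set for turn `k` is good for the first player, given the earlier
turns.  The field `fresh` is responsible for biorthogonality, and the field `le` makes every basis
vector annihilated by all but finitely many functionals. -/
structure IsGoodMove (M : Set ℕ) (e : ℕ) (p : ℕ → Turn) (k : ℕ) (F : Finset ℕ) : Prop where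
  subset : (F : Set ℕ) ⊆ M
  le : ∀ j ∈ F, k ≤ j
  fresh : ∀ i < k, Disjoint F (p i).move.supp
  region : ∀ j ∈ F, node (j + 1) ⊆ parentRegion p k
  disjoint : (F : Set ℕ).PairwiseDisjoint fun j => node (j + 1)
  sum_eq : ∑ j ∈ F, (wt (j + 1))⁻¹ = density e (k + 1) / wt (k + 1)
  volume_le : volume.real ((⋃ j ∈ F, node (j + 1)) \ limitSet M) ≤ defect e (k + 1)

theorem IsGoodMove.congr {M : Set ℕ} {e : ℕ} {p p' : ℕ → Turn} {k : ℕ} {F : Finset ℕ}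
    (h : ∀ i < k, p i = p' i) (hF : IsGoodMove M e p k F) : IsGoodMove M e p' k F where
  subset := hF.subset
  le := hF.le
  fresh i hi := by rw [← h i hi]; exact hF.fresh i hi
  region j hj := by
    have hr := hF.region j hj
    unfold parentRegion at hr ⊢
    by_cases hk : k = 0
    · rwa [if_pos hk] at hr ⊢
    · rw [if_neg hk] at hr ⊢
      rwa [← h _ (by omega)]
  disjoint := hF.disjoint
  sum_eq := hF.sum_eq
  volume_le := hF.volume_le

theorem exists_isGoodMove_of_region {M : Set ℕ} {e : ℕ} (he : 2 ≤ e) (p : ℕ → Turn) (k : ℕ)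
    {S : Finset ℕ} (hS : ∀ i ∈ S, i ≠ 0) (hU : parentRegion p k = ⋃ i ∈ S, node i)
    (hG : density e (k + 1) / wt (k + 1) < volume.real (parentRegion p k ∩ limitSet M)) :
    ∃ F, IsGoodMove M e p k F := by
  obtain ⟨c, m, hc⟩ := density_div_wt he (k + 1)
  rw [hc] at hG
  obtain ⟨F, h1, h2, h3, h4, h5, h6⟩ := exists_family M hS hU hG (δ := defect e (k + 1))
    (by unfold defect; positivity) (k + (Finset.range k).sup fun i => (p i).move.supp.sup id)
  refine ⟨F, h1, fun j hj => by have := h2 j hj; omega, fun i hi => ?_, h3, h4, by rw [h5, hc], h6⟩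
  rw [Finset.disjoint_left]
  intro j hj hj'
  have hle : j ≤ (Finset.range k).sup fun i => (p i).move.supp.sup id :=
    (Finset.le_sup (f := id) hj').trans
      (Finset.le_sup (f := fun i => (p i).move.supp.sup id) (Finset.mem_range.2 hi))
  have := h2 j hj
  omega

/-- After good moves in all earlier turns, the first player has a good move: the region for the new
block has slightly more than the required measure within the limit set. -/
theorem exists_isGoodMove {M : Set ℕ} (hM : 1 / 2 ≤ volume.real (limitSet M)) {e : ℕ} (he : 2 ≤ e)
    (p : ℕ → Turn) (k : ℕ) (h : ∀ i < k, IsGoodMove M e p i (p i).move.supp) :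
    ∃ F, IsGoodMove M e p k F := by
  have hlim : limitSet M ⊆ Set.Ico (0 : ℝ) 1 := (Set.iInter_subset _ 0).trans (cover_subset M 0)
  rcases Nat.eq_zero_or_pos k with rfl | hk
  · have hU : parentRegion p 0 = node 1 := if_pos rfl
    have h1 : node 1 = Set.Ico (0 : ℝ) 1 := by simp [node, dyadicInterval]
    refine exists_isGoodMove_of_region he p 0 (S := {1}) (by simp) (by simp [hU]) ?_
    rw [hU, h1, Set.inter_eq_self_of_subset_right hlim]
    have : wt (0 + 1) = 1 := by simp [wt]
    rw [this, div_one]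
    exact density_one_lt.trans_le hM
  -- The parent of the block with heap index `k + 1` was produced in turn `i`.
  · set i := (k + 1) / 2 - 1 with hi
    set ε : ℝ := if Even (k + 1) then 1 else -1 with hε
    have hε' : ε = 1 ∨ ε = -1 := by rw [hε]; split_ifs <;> simp
    have hgood := h i (by omega)
    have hU : parentRegion p k = ⋃ j ∈ (p i).move.supp, node ((p i).half ε j) := by
      rw [← (p i).setOf_fn_eq hgood.disjoint hε', parentRegion, if_neg (by omega)]
    refine exists_isGoodMove_of_region he p k (S := (p i).move.supp.image ((p i).half ε)) ?_ ?_ ?_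
    · intro q hq
      obtain ⟨j, -, rfl⟩ := Finset.mem_image.1 hq
      exact (p i).half_ne_zero ε j
    · rw [hU, Finset.set_biUnion_finset_image]
    · have hsub : (⋃ j ∈ (p i).move.supp, node ((p i).half ε j)) ⊆
          ⋃ j ∈ (p i).move.supp, node (j + 1) :=
        Set.iUnion₂_mono fun j _ => (p i).node_half_subset ε j
      have hfin : ∀ {A}, A ⊆ (⋃ j ∈ (p i).move.supp, node (j + 1)) → volume A ≠ ⊤ := fun hA =>
        node_ne_top (hA.trans (Set.iUnion₂_subset fun j _ => node_subset_unit (by omega)))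
      have hvol : volume.real (parentRegion p k) = density e (i + 1) / wt (i + 1) / 2 := by
        rw [hU, measureReal_biUnion_finset
          (fun j hj j' hj' hne => (hgood.disjoint hj hj' hne).mono ((p i).node_half_subset ε j)
            ((p i).node_half_subset ε j')) (fun j _ => measurableSet_node _)
          (fun j _ => node_ne_top (node_subset_unit ((p i).half_ne_zero ε j))), ← hgood.sum_eq,
          Finset.sum_div]
        refine Finset.sum_congr rfl fun j _ => ?_
        rw [volume_node, Turn.wt_half, mul_inv, mul_comm, div_eq_mul_inv]
      have hout : volume.real (parentRegion p k \ limitSet M) ≤ defect e (i + 1) := by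
        refine (measureReal_mono (Set.sdiff_subset_sdiff_left ?_) (hfin ?_)).trans hgood.volume_le
        · rw [hU]; exact hsub
        · exact Set.sdiff_subset
      have hadd := measureReal_inter_add_sdiff (μ := volume) (s := parentRegion p k)
        (measurableSet_limitSet M) (hfin (by rw [hU]; exact hsub))
      have hlt := density_div_wt_lt (e := e) (p := i + 1) (q := k + 1) (by omega) (by omega)
      linarith

/-- A turn in which the first player chooses the empty set. -/
def emptyTurn : Turn := ⟨⟨∅, fun _ => 0, fun _ => 0⟩, fun _ => 1⟩

/-- The strategy of choosing good sets, as long as this is possible, and scalars that only depend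
on the number of the turn and on the index. -/
def goodStrategy (M : Set ℕ) (e : ℕ) (lam mu : ℕ → ℕ → ℝ) : Strategy := fun hist =>
  ⟨Classical.epsilon (IsGoodMove M e (fun i => hist.getD i emptyTurn) hist.length),
    fun j => lam hist.length j, fun j => mu hist.length j⟩

theorem move_eq_of_follows {M : Set ℕ} {e : ℕ} {lam mu : ℕ → ℕ → ℝ} {p : ℕ → Turn}
    (hp : (goodStrategy M e lam mu).Follows p) (k : ℕ) : ∃ F : Finset ℕ,
      (p k).move = ⟨F, fun j => lam k j, fun j => mu k j⟩ ∧
        ((∃ F, IsGoodMove M e p k F) → IsGoodMove M e p k F) := by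
  have hget : ∀ i < k, ((List.range k).map p).getD i emptyTurn = p i := fun i hi => by
    simp [List.getD, hi]
  have hk := hp k
  rw [goodStrategy, show ((List.range k).map p).length = k by simp] at hk
  refine ⟨_, hk, fun ⟨F, hF⟩ => (Classical.epsilon_spec (p := IsGoodMove M e
    (fun i => ((List.range k).map p).getD i emptyTurn) k) ⟨F, ?_⟩).congr hget⟩
  exact hF.congr fun i hi => (hget i hi).symm

theorem isGoodMove_of_follows {M : Set ℕ} (hM : 1 / 2 ≤ volume.real (limitSet M)) {e : ℕ}
    (he : 2 ≤ e) {lam mu : ℕ → ℕ → ℝ} {p : ℕ → Turn}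
    (hp : (goodStrategy M e lam mu).Follows p) (k : ℕ) :
    IsGoodMove M e p k (p k).move.supp := by
  induction k using Nat.strong_induction_on with
  | _ k ih =>
    obtain ⟨F, hF, hgood⟩ := move_eq_of_follows hp k
    rw [hF]
    exact hgood (exists_isGoodMove hM he p k ih)

theorem lam_mu_of_follows {M : Set ℕ} {e : ℕ} {lam mu : ℕ → ℕ → ℝ} {p : ℕ → Turn}
    (hp : (goodStrategy M e lam mu).Follows p) (k : ℕ) (j : (p k).move.supp) :
    (p k).move.lam j = lam k j ∧ (p k).move.mu j = mu k j := by
  obtain ⟨F, hF, -⟩ := move_eq_of_follows hp k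
  generalize (p k).move = m at hF j
  subst hF
  exact ⟨rfl, rfl⟩

/-- The block system produced by a play with good moves.  The index `j` of a basis vector belongs to
the Haar function with heap index `j + 1`, and turn `k` produces the block with index `k + 1`. -/
def playSystem {M : Set ℕ} {e : ℕ} (p : ℕ → Turn)
    (hp : ∀ k, IsGoodMove M e p k (p k).move.supp) : BlockSystem where
  coll q := if q = 0 then {0} else (p (q - 1)).move.supp.map (addRightEmbedding 1)
  sgn q J := if q = 0 then 1 else (p (q - 1)).sgn (J - 1)
  coll_zero := rfl
  sgn_zero := rfl
  sgn_eq q J _ := by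
    split_ifs
    exacts [Or.inl rfl, Turn.sgn_eq _ _]
  ne_zero q hq J hJ := by
    rw [if_neg hq, Finset.mem_map] at hJ
    obtain ⟨j, -, rfl⟩ := hJ
    exact Nat.succ_ne_zero j
  eq_of_mem q J hJ J' hJ' s h h' := by
    split_ifs at hJ hJ'
    · rw [Finset.mem_singleton.1 hJ, Finset.mem_singleton.1 hJ']
    · obtain ⟨j, hj, rfl⟩ := Finset.mem_map.1 hJ
      obtain ⟨j', hj', rfl⟩ := Finset.mem_map.1 hJ'
      rw [addRightEmbedding_apply, haar_ne_zero_iff (by omega)] at h h'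
      by_contra hne
      exact Set.disjoint_left.1 ((hp _).disjoint hj hj' fun h => hne (by rw [h])) h h'
  disjoint q q' h := by
    have hlt : ∀ k l, k < l → Disjoint (p k).move.supp (p l).move.supp := fun k l h =>
      ((hp l).fresh k h).symm
    split_ifs with h1 h2 h2
    · omega
    · simp
    · simp
    · rw [Finset.disjoint_map]
      rcases Nat.lt_or_gt_of_ne (show q - 1 ≠ q' - 1 by omega) with h3 | h3
      exacts [hlt _ _ h3, (hlt _ _ h3).symm]
  nest_left q hq s h := by
    rw [if_neg (by omega), Finset.sum_map] at h
    obtain ⟨j, hj, hjs⟩ := Finset.exists_ne_zero_of_sum_ne_zero h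
    have hs := (haar_ne_zero_iff (by simp)).1 (right_ne_zero_of_mul hjs)
    have hr := (hp _).region j hj hs
    rw [parentRegion, if_neg (by omega), show 2 * q - 1 + 1 = 2 * q by omega,
      if_pos (even_two_mul q), Nat.mul_div_cancel_left _ two_pos] at hr
    simp only [if_neg hq, Finset.sum_map]
    exact hr
  nest_right q hq s h := by
    rw [if_neg (by omega), Finset.sum_map] at h
    obtain ⟨j, hj, hjs⟩ := Finset.exists_ne_zero_of_sum_ne_zero h
    have hs := (haar_ne_zero_iff (by simp)).1 (right_ne_zero_of_mul hjs)
    have hr := (hp _).region j hj hs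
    rw [parentRegion, if_neg (by omega), show 2 * q + 1 - 1 + 1 = 2 * q + 1 by omega,
      if_neg (by simp), show (2 * q + 1) / 2 - 1 = q - 1 by omega] at hr
    simp only [if_neg hq, Finset.sum_map]
    exact hr

/-! ### The vectors and functionals produced by the strategy -/

theorem Turn.sgn_coe (t : Turn) (j : t.move.supp) : t.sgn j = ((t.sign j : ℤ) : ℝ) := dif_pos j.2

theorem Turn.sgn_mul_self (t : Turn) (j : ℕ) : t.sgn j * t.sgn j = 1 := by
  rcases t.sgn_eq j with h | h <;> rw [h] <;> norm_num

section

variable {E : Type*} [NormedAddCommGroup E] [NormedSpace ℝ E]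

theorem Turn.vec_eq (b : SchauderBasis ℝ E) (t : Turn) {lam : ℕ → ℝ}
    (h : ∀ j, t.move.lam j = lam j) :
    t.vec b = ∑ j ∈ t.move.supp, (t.sgn j * lam j) • b j := by
  rw [← Finset.sum_coe_sort, Turn.vec]
  exact Finset.sum_congr rfl fun j _ => by rw [h, Turn.sgn_coe]

theorem Turn.func_apply (b : SchauderBasis ℝ E) (t : Turn) {mu : ℕ → ℝ}
    (h : ∀ j, t.move.mu j = mu j) (x : E) :
    t.func b x = ∑ j ∈ t.move.supp, t.sgn j * mu j * b.coord j x := by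
  rw [← Finset.sum_coe_sort, Turn.func, sum_apply]
  exact Finset.sum_congr rfl fun j _ => by
    rw [h, Turn.sgn_coe, smul_apply, smul_eq_mul]

theorem coord_basis (b : SchauderBasis ℝ E) (i j : ℕ) :
    b.coord i (b j) = if i = j then 1 else 0 := by
  simp only [b.ortho, Pi.single_apply]
  split_ifs <;> rfl

theorem Turn.coord_vec (b : SchauderBasis ℝ E) (t : Turn) {lam : ℕ → ℝ}
    (h : ∀ j, t.move.lam j = lam j) (i : ℕ) :
    b.coord i (t.vec b) = if i ∈ t.move.supp then t.sgn i * lam i else 0 := by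
  rw [t.vec_eq b h, map_sum]
  simp only [map_smul, coord_basis, smul_eq_mul, mul_ite, mul_one, mul_zero, Finset.sum_ite_eq]

end

/-- The constant in the estimate for the functionals, from summation by parts with the multipliers
`1 / density e q`, which lie between `2` and `2 + O(2 ^ (-e))`. -/
theorem two_mul_inv_sub_inv_density_le {e : ℕ} (he : 2 ≤ e) {η : ℝ} (hη : 1 / 2 ^ e ≤ η / 16) :
    2 * (1 / 2 - 1 / 2 ^ e : ℝ)⁻¹ - (density e 1)⁻¹ ≤ 2 + η := by
  have h1 : (1 : ℝ) / 2 ^ e ≤ 1 / 4 := by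
    refine (one_div_le_one_div_of_le (by positivity) (pow_le_pow_right₀ one_le_two he)).trans ?_
    norm_num
  have h0 : (0 : ℝ) < 1 / 2 ^ e := by positivity
  have h2 : 2 ≤ (density e 1)⁻¹ := by
    rw [le_inv_comm₀ two_pos (density_pos he 1)]
    have := density_one_lt (e := e)
    linarith
  have h3 : (1 / 2 - 1 / 2 ^ e : ℝ)⁻¹ ≤ 2 + 8 * (1 / 2 ^ e) := by
    rw [inv_le_comm₀ (by linarith) (by positivity), inv_eq_one_div, div_le_iff₀ (by positivity)]
    nlinarith
  linarith

/-- The coefficients of `x_k`, chosen so that `x_k` is a multiple of the block `b_{k + 1}`. -/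
def lamCoeff (N : HaarSystemNorm) (r : RademacherChoice) (τ : ℝ) (k j : ℕ) : ℝ :=
  τ * ‖haarVec₀ N r j‖ / ‖haarVec₀ N r k‖

/-- The coefficients of `x_k*`, chosen so that `x_k*` is a multiple of integration against the block
`b_{k + 1}`, with `⟨x_k*, x_k⟩ = 1`. -/
def muCoeff (N : HaarSystemNorm) (r : RademacherChoice) (τ : ℝ) (e k j : ℕ) : ℝ :=
  τ⁻¹ * (‖haarVec₀ N r k‖ / ‖haarVec₀ N r j‖) * (wt (k + 1) / density e (k + 1) / wt (j + 1))

theorem lamCoeff_mul_muCoeff (N : HaarSystemNorm) (r : RademacherChoice) {τ : ℝ} (hτ : τ ≠ 0)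
    (e k j : ℕ) : lamCoeff N r τ k j * muCoeff N r τ e k j =
      wt (k + 1) / density e (k + 1) * (wt (j + 1))⁻¹ := by
  have h1 := (norm_haarVec₀_pos N r k).ne'
  have h2 := (norm_haarVec₀_pos N r j).ne'
  rw [lamCoeff, muCoeff]
  field_simp

section

variable {N : HaarSystemNorm} {r : RademacherChoice} {b : SchauderBasis ℝ (HardySpace₀ N r)}
  {M : Set ℕ} {e : ℕ} {p : ℕ → Turn} {τ : ℝ}

theorem sum_lamCoeff_mul_muCoeff (N : HaarSystemNorm) (r : RademacherChoice) (he : 2 ≤ e)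
    (hp : ∀ k, IsGoodMove M e p k (p k).move.supp) (hτ : τ ≠ 0) (k : ℕ) :
    ∑ j ∈ (p k).move.supp, lamCoeff N r τ k j * muCoeff N r τ e k j = 1 := by
  simp only [lamCoeff_mul_muCoeff N r hτ]
  rw [← Finset.mul_sum, (hp k).sum_eq]
  have h1 := (density_pos he (k + 1)).ne'
  have h2 := (wt_pos (k + 1)).ne'
  field_simp

theorem func_vec_eq (he : 2 ≤ e) (hp : ∀ k, IsGoodMove M e p k (p k).move.supp) (hτ : τ ≠ 0)
    (hlam : ∀ k j, (p k).move.lam j = lamCoeff N r τ k j)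
    (hmu : ∀ k j, (p k).move.mu j = muCoeff N r τ e k j) (k l : ℕ) :
    (p k).func b ((p l).vec b) = if k = l then 1 else 0 := by
  rw [(p k).func_apply b (hmu k)]
  simp only [(p l).coord_vec b (hlam l)]
  split_ifs with h
  · subst h
    rw [← sum_lamCoeff_mul_muCoeff N r he hp hτ k]
    refine Finset.sum_congr rfl fun j hj => ?_
    rw [if_pos hj]
    linear_combination (lamCoeff N r τ k j * muCoeff N r τ e k j) * (p k).sgn_mul_self j
  · have hd : Disjoint (p k).move.supp (p l).move.supp := by
      rcases Nat.lt_or_gt_of_ne h with h | h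
      exacts [((hp l).fresh k h).symm, (hp k).fresh l h]
    exact Finset.sum_eq_zero fun j hj => by rw [if_neg (Finset.disjoint_left.1 hd hj), mul_zero]

theorem coe_vec_eq (hb : ∀ k, b k = ‖haarVec₀ N r k‖⁻¹ • haarVec₀ N r k)
    (hp : ∀ k, IsGoodMove M e p k (p k).move.supp)
    (hlam : ∀ k j, (p k).move.lam j = lamCoeff N r τ k j) (k : ℕ) :
    (((p k).vec b : HardySpace₀ N r) : HardySpace N r) =
      hardyEmb N r ((τ / ‖haarVec₀ N r k‖) • (playSystem p hp).vec (k + 1)) := by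
  rw [(p k).vec_eq b (hlam k), map_smul, BlockSystem.vec, map_sum, Finset.smul_sum,
    Submodule.coe_sum]
  simp only [playSystem, if_neg (Nat.succ_ne_zero k), Nat.add_sub_cancel, Finset.sum_map,
    addRightEmbedding_apply]
  refine Finset.sum_congr rfl fun j _ => ?_
  have h := (norm_haarVec₀_pos N r j).ne'
  rw [hb, Submodule.coe_smul, Submodule.coe_smul, coe_haarVec₀, map_smul, smul_smul, smul_smul]
  congr 1
  rw [lamCoeff]
  field_simp

theorem normDominated_vec (hb : ∀ k, b k = ‖haarVec₀ N r k‖⁻¹ • haarVec₀ N r k)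
    (hp : ∀ k, IsGoodMove M e p k (p k).move.supp) (hτ : 0 ≤ τ)
    (hlam : ∀ k j, (p k).move.lam j = lamCoeff N r τ k j) :
    NormDominated τ (fun k => (p k).vec b) b := by
  refine normDominated_of_bound b hτ fun a n => ?_
  have h1 : ‖∑ k ∈ Finset.range n, a k • (p k).vec b‖ =
      hardyNorm N r (∑ k ∈ Finset.range n,
        (a k * (τ / ‖haarVec₀ N r k‖)) • (playSystem p hp).vec (k + 1)) := by
    change ‖((∑ k ∈ Finset.range n, a k • (p k).vec b : HardySpace₀ N r) : HardySpace N r)‖ = _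
    rw [← norm_hardyEmb, map_sum, Submodule.coe_sum]
    simp only [Submodule.coe_smul, coe_vec_eq hb hp hlam, map_smul, smul_smul]
  have h2 : τ • ∑ k ∈ Finset.range n, a k • b k =
      ∑ k ∈ Finset.range n, (a k * (τ / ‖haarVec₀ N r k‖)) • haarVec₀ N r k := by
    rw [Finset.smul_sum]
    refine Finset.sum_congr rfl fun k _ => ?_
    rw [hb, smul_smul, smul_smul]
    congr 1
    ring
  rw [h1, ← Real.norm_of_nonneg hτ, ← norm_smul, Real.norm_of_nonneg hτ, h2,
    norm_sum_haarVec₀ N r _ _ fun k => k, sum_shift _ n (playSystem p hp).vec,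
    sum_shift _ n haarElem]
  exact (playSystem p hp).hardyNorm_sum_vec_le N r (n + 1) _

/-- The coefficients `⟨x_k*, x⟩` are those of the transposed kernel operator, up to the multipliers
`1 / density e q`. -/
theorem func_linearCombination (hp : ∀ k, IsGoodMove M e p k (p k).move.supp)
    (hmu : ∀ k j, (p k).move.mu j = muCoeff N r τ e k j) (l : ℕ →₀ ℝ) (k : ℕ) :
    (p k).func b (Finsupp.linearCombination ℝ b l) =
      (density e (k + 1))⁻¹ * (τ⁻¹ * ‖haarVec₀ N r k‖ * (playSystem p hp).coeff
        (fun J => if J = 0 then 0 else ‖haarVec₀ N r (J - 1)‖⁻¹ * l (J - 1)) (k + 1)) := by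
  rw [(p k).func_apply b (hmu k), BlockSystem.coeff]
  simp only [playSystem, if_neg (Nat.succ_ne_zero k), Nat.add_sub_cancel, Finset.sum_map,
    addRightEmbedding_apply, coord_linearCombination, if_neg (Nat.succ_ne_zero _), Finset.mul_sum]
  refine Finset.sum_congr rfl fun j _ => ?_
  rw [muCoeff]
  ring

theorem weakStarDominated_func (hb : ∀ k, b k = ‖haarVec₀ N r k‖⁻¹ • haarVec₀ N r k) (he : 2 ≤ e)
    (hp : ∀ k, IsGoodMove M e p k (p k).move.supp) (hτ : 0 ≤ τ)
    (hmu : ∀ k j, (p k).move.mu j = muCoeff N r τ e k j) {C : ℝ}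
    (hC : (2 * (1 / 2 - 1 / 2 ^ e : ℝ)⁻¹ - (density e 1)⁻¹) * τ⁻¹ ≤ C) (hC0 : 0 ≤ C) :
    WeakStarDominated C (fun k => (p k).func b) b.coord ∧
      ∀ x, ∃ s, HasSum (fun k => (p k).func b x • b k) s (SummationFilter.conditional ℕ) := by
  have hlow : (0 : ℝ) < 1 / 2 - 1 / 2 ^ e := by
    have : (1 : ℝ) / 2 ^ e ≤ 1 / 2 ^ 2 :=
      one_div_le_one_div_of_le (by positivity) (pow_le_pow_right₀ one_le_two he)
    norm_num at this ⊢
    linarith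
  refine weakStarDominated_of_bound b hC0 (fun l n => ?_) fun j => ⟨j + 1, fun k hk => ?_⟩
  · set S := playSystem p hp
    set c : ℕ → ℝ := fun J => if J = 0 then 0 else ‖haarVec₀ N r (J - 1)‖⁻¹ * l (J - 1) with hc
    have hc0 : S.coeff c 0 = 0 := by
      rw [BlockSystem.coeff, S.coll_zero, Finset.sum_singleton]
      simp [hc]
    set v : ℕ → HardySpace₀ N r := fun k => (τ⁻¹ * S.coeff c (k + 1)) • haarVec₀ N r k with hv
    have hsum : ∑ k ∈ Finset.range n, (p k).func b (Finsupp.linearCombination ℝ b l) • b k =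
        ∑ k ∈ Finset.range n, (density e (k + 1))⁻¹ • v k := by
      refine Finset.sum_congr rfl fun k _ => ?_
      have h := (norm_haarVec₀_pos N r k).ne'
      rw [func_linearCombination hp hmu, hb, hv, smul_smul, smul_smul]
      congr 1
      change _ * (_ * _ * S.coeff c (k + 1)) * _ = _
      generalize S.coeff c (k + 1) = x
      field_simp
    have hB : ∀ m ≤ n, ‖∑ k ∈ Finset.range m, v k‖ ≤
        τ⁻¹ * ‖Finsupp.linearCombination ℝ b l‖ := by
      intro m _
      obtain ⟨L₁, hL₁⟩ := exists_support_subset_range l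
      obtain ⟨K, -, -, hK⟩ := S.exists_level (m + 1) 0
      set L := max L₁ (2 ^ K) with hL
      have h1 : ∑ k ∈ Finset.range m, v k =
          τ⁻¹ • ∑ k ∈ Finset.range m, S.coeff c (k + 1) • haarVec₀ N r k := by
        simp only [hv, Finset.smul_sum, smul_smul]
      have h2 : Finsupp.linearCombination ℝ b l =
          ∑ k ∈ Finset.range L, (‖haarVec₀ N r k‖⁻¹ * l k) • haarVec₀ N r k := by
        rw [linearCombination_eq_sum_range b l
          (hL₁.trans (Finset.range_mono (le_max_left L₁ (2 ^ K))))]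
        exact Finset.sum_congr rfl fun k _ => by rw [hb, smul_smul, mul_comm]
      rw [h1, norm_smul, Real.norm_of_nonneg (inv_nonneg.2 hτ)]
      refine mul_le_mul_of_nonneg_left ?_ (inv_nonneg.2 hτ)
      rw [h2, norm_sum_haarVec₀ N r _ _ fun k => k, norm_sum_haarVec₀ N r _ _ fun k => k,
        sum_shift _ m haarElem, sum_shift _ L haarElem]
      have h3 := S.hardyNorm_sum_coeff_le N r (m + 1) (L := L + 1) (fun q hq => (hK q hq).trans
        (Finset.range_mono ((le_max_right L₁ (2 ^ K)).trans (Nat.le_succ _)))) c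
      refine Eq.trans_le ?_ h3
      congr 1
      refine Finset.sum_congr rfl fun q _ => ?_
      split_ifs with hq
      · rw [hq, hc0]
      · rw [Nat.sub_add_cancel (Nat.one_le_iff_ne_zero.2 hq)]
    rw [hsum]
    refine (norm_sum_smul_le_of_monotone (m := fun k => (density e (k + 1))⁻¹)
      (fun k k' h => inv_anti₀ (density_pos he _) (density_antitone e (by omega)))
      (inv_nonneg.2 (density_pos he _).le)
      (fun k => inv_anti₀ hlow (lt_density e (k + 1)).le) hB).trans ?_
    rw [← mul_assoc]
    exact mul_le_mul_of_nonneg_right hC (norm_nonneg _)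
  · rw [(p k).func_apply b (hmu k)]
    refine Finset.sum_eq_zero fun i hi => ?_
    have := (hp k).le i hi
    rw [coord_basis, if_neg (by omega), mul_zero]

end

end HaarHardy

end

theorem theorem10p2 (N : HaarSystemNorm) (r : RademacherChoice) :
    ∃ b : SchauderBasis ℝ (HardySpace₀ N r),
      (∀ k, b k = ‖haarVec₀ N r k‖⁻¹ • haarVec₀ N r k) ∧ StrategicallySupportingProj 2 b := by
  obtain ⟨b, hb⟩ := exists_haar_schauderBasis N r
  refine ⟨b, hb, fun η hη N₁ N₂ hN _ => ?_⟩
  obtain ⟨M, hM, hvol⟩ := exists_half_le_volume_limitSet N₁ N₂ hN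
  obtain ⟨e, he, heη⟩ : ∃ e : ℕ, 2 ≤ e ∧ (1 : ℝ) / 2 ^ e ≤ η / 16 := by
    obtain ⟨n, hn⟩ := exists_pow_lt_of_lt_one (show 0 < η / 16 by positivity) one_half_lt_one
    refine ⟨n + 2, by omega, le_trans ?_ hn.le⟩
    rw [one_div_pow]
    exact one_div_le_one_div_of_le (by positivity) (pow_le_pow_right₀ one_le_two (by omega))
  -- `x_k` and `x_k*` carry the factors `√(2 + η)` and `1 / √(2 + η)`.
  have hτ : 0 < √(2 + η) := Real.sqrt_pos.2 (by positivity)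
  refine ⟨M, hM, goodStrategy M e (lamCoeff N r √(2 + η)) (muCoeff N r √(2 + η) e), fun p hp => ?_⟩
  have hgood := isGoodMove_of_follows hvol he hp
  have hlam := fun k j => (lam_mu_of_follows hp k j).1
  have hmu := fun k j => (lam_mu_of_follows hp k j).2
  have hpair := func_vec_eq (b := b) he hgood hτ.ne' hlam hmu
  have hone : ∀ k, (p k).func b ((p k).vec b) = 1 := fun k => by rw [hpair, if_pos rfl]
  have hC : (2 * (1 / 2 - 1 / 2 ^ e : ℝ)⁻¹ - (density e 1)⁻¹) * (√(2 + η))⁻¹ ≤ √(2 + η) := by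
    rw [← div_eq_mul_inv, div_le_iff₀ hτ, Real.mul_self_sqrt (by positivity)]
    exact two_mul_inv_sub_inv_density_le he heη
  obtain ⟨hweak, hconv⟩ := weakStarDominated_func hb he hgood hτ.le hmu hC hτ.le
  refine ⟨⟨fun k => (hgood k).subset, normDominated_vec hb hgood hτ.le hlam, hweak, hconv,
    fun k => ?_, fun k => (hone k).ge, fun k => (hone k).trans_le (by linarith), fun k j => ?_⟩,
    hpair⟩
  · rw [hone, ← sum_lamCoeff_mul_muCoeff N r he hgood hτ.ne' k, ← Finset.sum_coe_sort]
    exact Finset.sum_congr rfl fun j _ => by rw [hlam, hmu]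
  · rw [hlam, hmu, lamCoeff_mul_muCoeff N r hτ.ne']
    exact mul_nonneg (div_nonneg (wt_pos _).le (density_pos he _).le) (inv_nonneg.2 (wt_pos _).le)
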